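/- All C$^*$-algebras below are unital. A \emph{Popa algebra} is a simple (in particular nonzero), separable, unital C$^*$-algebra $A$ such that for every finite subset $F\subset A$ and every $\varepsilon>0$ there is a nonzero finite dimensional C$^*$-subalgebra $B\subset A$ with unit $e$ (not necessarily the unit of $A$) such that $\|ex-xe\|\le\varepsilon$ for all $x\in F$, and for each $x\in F$ there is $b\in B$ with $\|exe-b\|\le\varepsilon$. A C$^*$-algebra $E$ is \emph{residually finite dimensional} if for every $0\neq x\in E$ there are $n\in\mathbb N$ and a $*$-homomorphism $\pi:E\to M_n(\mathbb C)$ with $\pi(x)\neq 0$. For a C$^*$-algebra $A$, $\mathrm T(A)$ is the set of tracial states of $A$; for $\tau\in\mathrm T(A)$, $\pi_\tau$ is the GNS representation and $\pi_\tau(A)''$ the von Neumann algebra that it generates on $L^2(A,\tau)$. $R$ denotes the hyperfinite II$_1$ factor, $\bar\otimes$ the von Neumann algebra tensor product, and $\cong$ denotes $*$-isomorphism of von Neumann algebras. \textbf{Theorem.} Let $\mathfrak C$ be a class of C$^*$-algebras which is closed under increasing unions (that is, under inductive limits of sequences with injective unital connecting maps; in particular $\mathfrak C$ is closed under isomorphism)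 and under tensoring with the matrix algebras $M_n(\mathbb C)$, $n\ge 1$. Let $E\in\mathfrak C$ be a nonzero, separable, residually finite dimensional C$^*$-algebra. Then there exists a Popa algebra $A\in\mathfrak C$ such that for every $\varepsilon>0$ there is a unital $*$-monomorphism $\rho:E\hookrightarrow A$ with the following property: for each $\tau\in\mathrm T(E)$ there exists $\gamma\in\mathrm T(A)$ such that \begin{enumerate} \item $|\gamma(\rho(x))-\tau(x)|<\varepsilon\|x\|$ for all $0\neq x\in E$, and \item $\pi_\gamma(A)''\cong R\,\bar\otimes\,\pi_\tau(E)''$. \end{enumerate} -/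

import Mathlib

open scoped ComplexOrder TensorProduct symmDiff

universe u v

/-! ## Residually finite dimensional and Popa algebras -/

/-- A C⋆-algebra is residually finite dimensional if its finite dimensional representations
separate its points. -/
def IsResiduallyFiniteDimensional (E : Type u) [CStarAlgebra E] : Prop :=
  ∀ x : E, x ≠ 0 → ∃ (n : ℕ) (π : E →⋆ₙₐ[ℂ] Matrix (Fin n) (Fin n) ℂ), π x ≠ 0

/-- A unital C⋆-algebra is simple if it is nonzero and has no closed two-sided ideals other than
zero and the whole algebra. -/
def IsSimpleCStarAlgebra (A : Type u) [CStarAlgebra A] : Prop :=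
  Nontrivial A ∧ ∀ I : TwoSidedIdeal A, IsClosed (I : Set A) → I = ⊥ ∨ I = ⊤

/-- A Popa algebra is a simple, separable, unital C⋆-algebra `A` such that for every finite subset
`F` and every `ε > 0` there is a nonzero finite dimensional C⋆-subalgebra `B` of `A`, with unit `e`,
such that `‖e x - x e‖ ≤ ε` for all `x ∈ F` and every `e x e`, `x ∈ F`, is within `ε` of `B`.
(The unit `e` of `B` need not be the unit of `A`, and `B ≠ 0` means that `e ≠ 0`.) -/
structure IsPopaAlgebra (A : Type u) [CStarAlgebra A] : Prop where
  simple : IsSimpleCStarAlgebra A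
  separable : TopologicalSpace.SeparableSpace A
  finite_dimensional_approximation : ∀ (F : Finset A) (ε : ℝ), 0 < ε →
    ∃ (B : NonUnitalStarSubalgebra ℂ A) (e : A),
      FiniteDimensional ℂ B ∧ e ≠ 0 ∧ e ∈ B ∧ (∀ b ∈ B, e * b = b ∧ b * e = b) ∧
      (∀ x ∈ F, ‖e * x - x * e‖ ≤ ε) ∧
      (∀ x ∈ F, ∃ b ∈ B, ‖e * x * e - b‖ ≤ ε)

/-! ## Closure properties of a class of C⋆-algebras -/

/-- The class `C` is closed under increasing unions: if `A` is the inductive limit of a sequence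
`B 0 ⊆ B 1 ⊆ ⋯` of members of `C` with injective (unital) connecting maps, then `A` belongs to `C`.
Here the embeddings `j n : B n → A` have increasing ranges whose union is dense in `A`. -/
def ClosedUnderIncreasingUnions (C : ∀ (B : Type u) [CStarAlgebra B], Prop) : Prop :=
  ∀ (B : ℕ → Type u) [∀ n, CStarAlgebra (B n)] (A : Type u) [CStarAlgebra A]
    (j : ∀ n, B n →⋆ₐ[ℂ] A),
    (∀ n, Function.Injective (j n)) →
    (∀ n, Set.range (j n) ⊆ Set.range (j (n + 1))) →
    Dense (⋃ n, Set.range (j n)) →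
    (∀ n, C (B n)) → C A

/-- The class `C` is closed under tensoring with the matrix algebras `M_n(ℂ)`, `n ≥ 1`; the tensor
product of `B` with `M_n(ℂ)` is the C⋆-algebra of `n × n` matrices over `B`. (The order on `B` is
the usual order of a C⋆-algebra, which `StarOrderedRing` determines uniquely.) -/
def ClosedUnderMatrixTensoring (C : ∀ (B : Type u) [CStarAlgebra B], Prop) : Prop :=
  ∀ (B : Type u) [CStarAlgebra B] [PartialOrder B] [StarOrderedRing B] (n : ℕ), 1 ≤ n →
    C B → C (CStarMatrix (Fin n) (Fin n) B)

/-! ## Von Neumann algebras -/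

section VonNeumann

variable {H : Type u} [NormedAddCommGroup H] [InnerProductSpace ℂ H] [CompleteSpace H]
variable {K : Type v} [NormedAddCommGroup K] [InnerProductSpace ℂ K] [CompleteSpace K]

/-- The von Neumann algebra generated by a set of bounded operators: the double commutant of
the set together with the adjoints of its elements. -/
noncomputable def vonNeumannAlgebraGenerated (S : Set (H →L[ℂ] H)) : VonNeumannAlgebra H where
  toStarSubalgebra :=
    StarSubalgebra.centralizer ℂ (Set.centralizer (S ∪ star S) : Set (H →L[ℂ] H))
  centralizer_centralizer' := by
    simp

variable (H K) in
/-- The Hilbert space tensor product. -/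
abbrev HilbertTensor : Type (max u v) := UniformSpace.Completion (H ⊗[ℂ] K)

/-- The bounded operator `x ⊗ y` on the Hilbert space tensor product. -/
noncomputable def operatorTensor (x : H →L[ℂ] H) (y : K →L[ℂ] K) :
    HilbertTensor H K →L[ℂ] HilbertTensor H K :=
  (TensorProduct.mapL x y).completion

/-- The von Neumann algebra tensor product of `M ⊆ B(H)` and `N ⊆ B(K)`: the von Neumann algebra
on the Hilbert space tensor product generated by the `x ⊗ y` with `x ∈ M` and `y ∈ N`. -/
noncomputable def VonNeumannAlgebra.tensor (M : VonNeumannAlgebra H) (N : VonNeumannAlgebra K) :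
    VonNeumannAlgebra (HilbertTensor H K) :=
  vonNeumannAlgebraGenerated {T | ∃ x ∈ M, ∃ y ∈ N, T = operatorTensor x y}

/-- Isomorphism of von Neumann algebras, as `⋆`-algebras (a `⋆`-isomorphism between von Neumann
algebras is automatically normal). -/
def VonNeumannAlgebra.Isomorphic (M : VonNeumannAlgebra H) (N : VonNeumannAlgebra K) : Prop :=
  Nonempty (M.toStarSubalgebra ≃⋆ₐ[ℂ] N.toStarSubalgebra)

end VonNeumann

/-! ## Tracial states and their GNS von Neumann algebras -/

/-- A tracial state on a unital C⋆-algebra: a positive linear functional `τ` with `τ 1 = 1` and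
`τ (x y) = τ (y x)`. -/
structure TracialState (A : Type u) [CStarAlgebra A] [PartialOrder A] [StarOrderedRing A] where
  /-- The underlying positive linear functional. -/
  toFunctional : A →ₚ[ℂ] ℂ
  map_one : toFunctional 1 = 1
  map_mul_comm : ∀ x y, toFunctional (x * y) = toFunctional (y * x)

/-- The von Neumann algebra `π_τ(A)''` on the GNS Hilbert space `L²(A, τ)`. -/
noncomputable def TracialState.gnsVonNeumannAlgebra {A : Type u} [CStarAlgebra A] [PartialOrder A]
    [StarOrderedRing A] (τ : TracialState A) : VonNeumannAlgebra τ.toFunctional.GNS :=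
  vonNeumannAlgebraGenerated (Set.range τ.toFunctional.gnsStarAlgHom)

/-! ## The hyperfinite II₁ factor

`R` is realised as the weak closure of the CAR algebra `⨂_ℕ M₂(ℂ)` in the GNS representation of its
tracial state. Let `X j` and `Z j` be the Pauli matrices `!![0, 1; 1, 0]` and `!![1, 0; 0, -1]` in
the `j`-th tensor factor. The monomials `X^S Z^T = (∏ j ∈ S, X j) * (∏ j ∈ T, Z j)`, for finite
`S, T ⊆ ℕ`, form an orthonormal basis of `L²(⨂_ℕ M₂(ℂ), tr)`, which is thereby identified with
`ℓ²(Finset ℕ × Finset ℕ)`. Left multiplication by `X j` sends `X^S Z^T` to `X^(S ∆ {j}) Z^T`,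
and left multiplication by `Z j` sends it to `(-1)^[j ∈ S] X^S Z^(T ∆ {j})`. -/

/-- The Hilbert space `L²(⨂_ℕ M₂(ℂ), tr)`, in the orthonormal basis of the Pauli monomials. -/
abbrev PauliSpace : Type := lp (fun _ : Finset ℕ × Finset ℕ => ℂ) 2

/-- The unitary operator `(U f) i = c i * f (e i)` on `ℓ²(ι)`, for a permutation `e` of `ι` and
numbers `c i` of modulus one. -/
noncomputable def weightedPermutation {ι : Type} (e : Equiv.Perm ι) (c : ι → ℂ)
    (hc : ∀ i, ‖c i‖ = 1) :
    lp (fun _ : ι => ℂ) 2 →L[ℂ] lp (fun _ : ι => ℂ) 2 :=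
  LinearIsometry.toContinuousLinearMap
    { toFun := fun f => ⟨fun i => c i * f (e i), by
        have h := (memℓp_gen_iff (by norm_num : 0 < (2 : ENNReal).toReal)).1 f.2
        refine memℓp_gen ?_
        simpa [hc, Function.comp_def] using e.summable_iff.2 h⟩
      map_add' := fun f g => by
        ext i
        exact mul_add (c i) (f (e i)) (g (e i))
      map_smul' := fun a f => by
        ext i
        simp [mul_left_comm]
      norm_map' := fun f => by
        have h2 : 0 < (2 : ENNReal).toReal := by norm_num
        rw [lp.norm_eq_tsum_rpow h2, lp.norm_eq_tsum_rpow h2]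
        congr 1
        rw [← e.tsum_eq (fun i => ‖f i‖ ^ (2 : ENNReal).toReal)]
        simp [hc] }

/-- The involution `S ↦ S ∆ {j}` of the finite subsets of `ℕ`. -/
def flipAt (j : ℕ) : Equiv.Perm (Finset ℕ) :=
  Function.Involutive.toPerm (fun S => S ∆ {j}) (fun S => symmDiff_symmDiff_cancel_right {j} S)

/-- Left multiplication by `X j`. -/
noncomputable def pauliX (j : ℕ) : PauliSpace →L[ℂ] PauliSpace :=
  weightedPermutation (Equiv.prodCongr (flipAt j) (Equiv.refl (Finset ℕ))) (fun _ => 1) (by simp)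

/-- Left multiplication by `Z j`. -/
noncomputable def pauliZ (j : ℕ) : PauliSpace →L[ℂ] PauliSpace :=
  weightedPermutation (Equiv.prodCongr (Equiv.refl (Finset ℕ)) (flipAt j))
    (fun p => if j ∈ p.1 then -1 else 1) (fun p => by split_ifs <;> simp)

/-- The hyperfinite II₁ factor `R`. -/
noncomputable def hyperfiniteFactor : VonNeumannAlgebra PauliSpace :=
  vonNeumannAlgebraGenerated (Set.range pauliX ∪ Set.range pauliZ)

/-! Put A_0 = E and A_{m+1} = M_{2^l}(A_m) with l = l_m. The connecting map is x ↦ π_m(x) + (1 -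
π_m(1))(1 ⊗ x), where π_m : A_m → M_{2^l}(ℂ) is a non-unital representation, bounded below by 1/2 on
a prescribed finite set, such that π_m(1) has normalised trace at most 4^{-(m+1)}. Residual finite
dimensionality provides π_m: take a sum of finite dimensional representations and pad it by a large
zero block. Let A be the limit; it lies in the class because every A_m does.

The scalar projection π_m(1) commutes with the image of A_m and cuts it down to the finite
dimensional algebra π_m(A_m), which gives the approximation property
(`Tower.isPopaAlgebra_of_dense`). An ideal element close to x becomes, after cutting by π_n(1) at a
late stage n, close to a scalar matrix of norm comparable to ‖x‖. Full matrix algebras being simple,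
the ideal then contains 1 (`Tower.one_mem_of_norm_sub_lt`).

For a tracial state τ of E, let H = L²(R) ⊗ L²(E, τ). Consecutive blocks of Pauli operators give
commuting matrix units of sizes 2^l, so there are representations ψ_m of A_m on H with ψ_{m+1}(x ⊗
1) = ψ_m(x). They are not compatible with the connecting maps, but the defect is carried by a
projection p_m with ‖p_m f‖ ≤ 2^{-(m+1)}‖f‖ for f supported on the earlier tensor factors. Hence the
ψ_n composed with the connecting maps converge strongly to representations σ_m that are compatible,
and they define a representation of A on H (`AsymptoticRep.limit`).

The σ_m are strong limits of the ψ_n, and conversely ψ_m(x) is the strong limit of σ_n(x ⊗ 1). So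
both families have the same commutant, which is that of R ⊗ π_τ(E)'' (`PauliRep.commute_limit_iff`,
`commute_tensor_iff`). The product trace vector is a cyclic trace vector for A; its vector state is
γ, and uniqueness of the GNS representation identifies π_γ(A)''. Finally ρ sends E by constant
diagonal matrices into A_m and then into A. Since ψ_m of a constant diagonal is exactly π_τ, only
the tail of the defects from stage m on separates γ ∘ ρ from τ. The algebra A depends neither on ε
nor on τ; only m depends on ε. -/

open Filter Topology
open scoped ENNReal

/-! ### Amplifications, connecting maps and matrix units. -/

namespace CStarMatrix

variable {n : Type*} [Fintype n] [DecidableEq n]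

section Algebra

variable {A : Type*} [Ring A] [StarRing A] [Algebra ℂ A] [StarModule ℂ A]

/-- The amplification `x ↦ diag(x, …, x)`. -/
def amplify (n : Type*) [Fintype n] [DecidableEq n] (A : Type*) [Ring A] [StarRing A]
    [Algebra ℂ A] [StarModule ℂ A] : A →⋆ₐ[ℂ] CStarMatrix n n A where
  toFun x := fun i j => if i = j then x else 0
  map_one' := rfl
  map_mul' x y := by
    ext i j
    change (if i = j then x * y else 0) = ∑ k, (if i = k then x else 0) * (if k = j then y else 0)
    by_cases h : i = j <;> simp [h]
  map_zero' := by
    ext i j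
    change (if i = j then (0 : A) else 0) = 0
    simp
  map_add' x y := by
    ext i j
    change (if i = j then x + y else 0) = (if i = j then x else 0) + (if i = j then y else 0)
    by_cases h : i = j <;> simp [h]
  commutes' r := rfl
  map_star' x := by
    ext i j
    change (if i = j then star x else 0) = star (if j = i then x else 0)
    by_cases h : i = j
    · simp [h]
    · simp [h, Ne.symm h]

theorem amplify_apply (x : A) (i j : n) : amplify n A x i j = if i = j then x else 0 := rfl

/-- Complex matrices as matrices over `A` with scalar entries. -/
def ofScalar (n : Type*) [Fintype n] [DecidableEq n] (A : Type*) [Ring A] [StarRing A]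
    [Algebra ℂ A] [StarModule ℂ A] : CStarMatrix n n ℂ →⋆ₐ[ℂ] CStarMatrix n n A where
  toFun T := fun i j => algebraMap ℂ A (T i j)
  map_one' := by
    ext i j
    change algebraMap ℂ A (if i = j then 1 else 0) = if i = j then 1 else 0
    by_cases h : i = j <;> simp [h]
  map_mul' x y := by
    ext i j
    change algebraMap ℂ A (∑ k, x i k * y k j) = ∑ k, algebraMap ℂ A (x i k) * algebraMap ℂ A (y k j)
    simp
  map_zero' := by
    ext i j
    exact map_zero _
  map_add' x y := by
    ext i j
    exact map_add _ _ _
  commutes' r := by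
    ext i j
    change algebraMap ℂ A (if i = j then r else 0) = if i = j then algebraMap ℂ A r else 0
    by_cases h : i = j <;> simp [h]
  map_star' x := by
    ext i j
    exact algebraMap_star_comm _

theorem ofScalar_apply (T : CStarMatrix n n ℂ) (i j : n) :
    ofScalar n A T i j = algebraMap ℂ A (T i j) := rfl

theorem amplify_mul_apply (x : A) (y : CStarMatrix n n A) (i j : n) :
    (amplify n A x * y) i j = x * y i j := by
  simp [mul_apply, amplify_apply]

theorem mul_amplify_apply (x : A) (y : CStarMatrix n n A) (i j : n) :
    (y * amplify n A x) i j = y i j * x := by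
  simp [mul_apply, amplify_apply]

theorem ofScalar_commute_amplify (T : CStarMatrix n n ℂ) (x : A) :
    ofScalar n A T * amplify n A x = amplify n A x * ofScalar n A T := by
  ext i j
  rw [amplify_mul_apply, mul_amplify_apply, ofScalar_apply, Algebra.commutes]

/-- The connecting map `x ↦ π(x) + (1 - π(1)) (1 ⊗ x)` attached to a finite dimensional
representation `π`. -/
def connect (π : A →⋆ₙₐ[ℂ] CStarMatrix n n ℂ) : A →⋆ₐ[ℂ] CStarMatrix n n A where
  toFun x := ofScalar n A (π x) + (1 - ofScalar n A (π 1)) * amplify n A x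
  map_one' := by simp
  map_mul' x y := by
    have h1 : ofScalar n A (π x) * ofScalar n A (π y) = ofScalar n A (π (x * y)) := by
      rw [map_mul, map_mul]
    have h2 : ofScalar n A (π x) * ofScalar n A (π 1) = ofScalar n A (π x) := by
      rw [← map_mul, ← map_mul, mul_one]
    have h3 : ofScalar n A (π 1) * ofScalar n A (π y) = ofScalar n A (π y) := by
      rw [← map_mul, ← map_mul, one_mul]
    have h4 : ofScalar n A (π 1) * ofScalar n A (π 1) = ofScalar n A (π 1) := by
      rw [← map_mul, ← map_mul, one_mul]
    have c1 := fun T : CStarMatrix n n ℂ => ofScalar_commute_amplify (n := n) T x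
    set a := amplify n A x
    set b := amplify n A y
    set p := ofScalar n A (π 1)
    have e1 : ofScalar n A (π x) * ((1 - p) * b) = 0 := by
      rw [← mul_assoc, mul_sub, mul_one, h2, sub_self, zero_mul]
    have e2 : (1 - p) * a * ofScalar n A (π y) = 0 := by
      rw [mul_assoc, ← c1, ← mul_assoc, sub_mul, one_mul, h3, sub_self, zero_mul]
    have c2 : a * (1 - p) = (1 - p) * a := by
      rw [mul_sub, sub_mul, mul_one, one_mul, c1]
    have e3 : (1 - p) * a * ((1 - p) * b) = (1 - p) * (a * b) := by
      have : (1 - p) * (1 - p) = 1 - p := by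
        rw [mul_sub, sub_mul, sub_mul, h4]; simp
      rw [mul_assoc, ← mul_assoc a, c2, ← mul_assoc, ← mul_assoc, this, mul_assoc]
    rw [map_mul (amplify n A), ← h1, add_mul, mul_add, mul_add, e1, e2, e3]
    simp [a, b]
  map_zero' := by simp
  map_add' x y := by
    simp only [map_add, mul_add]; abel
  commutes' r := by
    simp only [Algebra.algebraMap_eq_smul_one, map_smul, map_one, mul_one, mul_smul_comm]
    rw [smul_sub]; abel
  map_star' x := by
    have h : star (π 1) = π 1 := by rw [← map_star, star_one]
    have c : star (ofScalar n A (π 1)) = ofScalar n A (π 1) := by rw [← map_star, h]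
    rw [star_add, star_mul, star_sub, star_one, c, ← map_star, ← map_star, ← map_star]
    congr 1
    rw [sub_mul, mul_sub, ofScalar_commute_amplify]; simp

theorem connect_apply (π : A →⋆ₙₐ[ℂ] CStarMatrix n n ℂ) (x : A) :
    connect π x = ofScalar n A (π x) + (1 - ofScalar n A (π 1)) * amplify n A x := rfl

/-- With its mirror image below, this makes the scalar projection π(1) central over the image of the
connecting map, with finite dimensional corner. Both the Popa property and simplicity rest on it. -/
theorem ofScalar_mul_connect (π : A →⋆ₙₐ[ℂ] CStarMatrix n n ℂ) (x : A) :
    ofScalar n A (π 1) * connect π x = ofScalar n A (π x) := by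
  rw [connect_apply, mul_add, ← mul_assoc, mul_sub, mul_one, ← map_mul, ← map_mul, one_mul,
    ← map_mul, ← map_mul, mul_one]
  simp

theorem connect_mul_ofScalar (π : A →⋆ₙₐ[ℂ] CStarMatrix n n ℂ) (x : A) :
    connect π x * ofScalar n A (π 1) = ofScalar n A (π x) := by
  rw [connect_apply, add_mul, mul_assoc, ← ofScalar_commute_amplify, ← mul_assoc, sub_mul, one_mul,
    ← map_mul, ← map_mul, mul_one, ← map_mul, ← map_mul, mul_one]
  simp

/-- If x is killed, cutting by π(1) gives π(x) = 0, and what remains is (1 - π(1)) ⊗ x. Some entry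
of the scalar matrix 1 - π(1) is nonzero, which forces x = 0. -/
theorem connect_injective [Nontrivial A] (π : A →⋆ₙₐ[ℂ] CStarMatrix n n ℂ) (h : π 1 ≠ 1) :
    Function.Injective (connect π) := by
  rw [injective_iff_map_eq_zero]
  intro x hx
  have h1 : π x = 0 := by
    have := ofScalar_mul_connect π x
    rw [hx, mul_zero] at this
    ext i j
    have h2 : algebraMap ℂ A (π x i j) = 0 := (congrArg (fun M : CStarMatrix n n A => M i j) this).symm
    exact (map_eq_zero_iff _ (algebraMap ℂ A).injective).1 h2
  rw [connect_apply, h1, map_zero, zero_add] at hx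
  have h3 : ∃ i j, (1 - π 1 : CStarMatrix n n ℂ) i j ≠ 0 := by
    by_contra! hc
    exact h (sub_eq_zero.1 (by ext i j; simpa using hc i j)).symm
  obtain ⟨i, j, hij⟩ := h3
  have h4 : ((1 - ofScalar n A (π 1)) * amplify n A x) i j = 0 := by rw [hx]; rfl
  rw [← map_one (ofScalar n A), ← map_sub, mul_amplify_apply, ofScalar_apply,
    ← Algebra.smul_def] at h4
  exact (smul_eq_zero.1 h4).resolve_left hij

end Algebra

end CStarMatrix

/-- A system of matrix units in a star ring. -/
structure IsMatrixUnits {n B : Type*} [Fintype n] [DecidableEq n] [Ring B] [StarRing B]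
    (F : n → n → B) : Prop where
  mul_eq : ∀ i j k l, F i j * F k l = if j = k then F i l else 0
  star_eq : ∀ i j, star (F i j) = F j i
  sum_eq : ∑ i, F i i = 1

namespace IsMatrixUnits

variable {n : Type*} [Fintype n] [DecidableEq n] {A B : Type*} [Ring A] [StarRing A] [Algebra ℂ A]
  [StarModule ℂ A] [Ring B] [StarRing B] [Algebra ℂ B] [StarModule ℂ B]

/-- The representation of `M_n(A)` given by a representation of `A` and a commuting system of
matrix units. -/
def lift {F : n → n → B} (hF : IsMatrixUnits F) (ψ : A →⋆ₐ[ℂ] B)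
    (hc : ∀ i j x, Commute (ψ x) (F i j)) : CStarMatrix n n A →⋆ₐ[ℂ] B where
  toFun x := ∑ i, ∑ j, ψ (x i j) * F i j
  map_one' := by
    rw [← hF.sum_eq]
    refine Finset.sum_congr rfl fun i _ => ?_
    rw [Finset.sum_eq_single i]
    · simp
    · intro j _ hj; simp [CStarMatrix.one_apply_ne hj.symm]
    · simp
  map_mul' x y := by
    have key : ∀ i j k l, ψ (x i j) * F i j * (ψ (y k l) * F k l)
        = if j = k then ψ (x i j * y k l) * F i l else 0 := by
      intro i j k l
      rw [mul_assoc, ← mul_assoc (F i j), ← (hc i j (y k l)).eq, mul_assoc, hF.mul_eq, ← mul_assoc,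
        ← map_mul]
      split_ifs <;> simp
    calc ∑ i, ∑ l, ψ ((x * y) i l) * F i l
        = ∑ i, ∑ l, ∑ j, ψ (x i j * y j l) * F i l := by
          simp only [CStarMatrix.mul_apply, map_sum, Finset.sum_mul]
      _ = ∑ i, ∑ j, ∑ k, ∑ l, ψ (x i j) * F i j * (ψ (y k l) * F k l) := by
          refine Finset.sum_congr rfl fun i _ => ?_
          rw [Finset.sum_comm]
          refine Finset.sum_congr rfl fun j _ => ?_
          rw [eq_comm, Finset.sum_eq_single j (fun k _ hk => by simp only [key, hk.symm, if_false, Finset.sum_const_zero]) (by simp)]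
          simp only [key, if_true]
      _ = _ := by
          simp only [Finset.sum_mul]
          simp only [Finset.mul_sum]
  map_zero' := by simp
  map_add' x y := by simp [add_mul, Finset.sum_add_distrib]
  commutes' r := by
    rw [Algebra.algebraMap_eq_smul_one (A := B), ← hF.sum_eq, Finset.smul_sum]
    refine Finset.sum_congr rfl fun i _ => ?_
    rw [Finset.sum_eq_single i]
    · simp [CStarMatrix.algebraMap_apply, Algebra.algebraMap_eq_smul_one]
    · intro j _ hj; simp [CStarMatrix.algebraMap_apply, hj.symm]
    · simp
  map_star' x := by
    simp only [star_sum, star_mul, hF.star_eq, CStarMatrix.star_apply]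
    rw [Finset.sum_comm]
    refine Finset.sum_congr rfl fun i _ => Finset.sum_congr rfl fun j _ => ?_
    rw [← map_star]
    exact (hc j i _).eq

variable {F : n → n → B} (hF : IsMatrixUnits F) (ψ : A →⋆ₐ[ℂ] B)
    (hc : ∀ i j x, Commute (ψ x) (F i j))

theorem lift_apply (x : CStarMatrix n n A) : hF.lift ψ hc x = ∑ i, ∑ j, ψ (x i j) * F i j := rfl

theorem lift_amplify (x : A) : hF.lift ψ hc (CStarMatrix.amplify n A x) = ψ x := by
  rw [lift_apply]
  have : ∀ i, ∑ j, ψ (CStarMatrix.amplify n A x i j) * F i j = ψ x * F i i := by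
    intro i
    rw [Finset.sum_eq_single i]
    · simp [CStarMatrix.amplify_apply]
    · intro j _ hj; simp [CStarMatrix.amplify_apply, hj.symm]
    · simp
  simp only [this, ← Finset.mul_sum, hF.sum_eq, mul_one]

theorem lift_ofScalar (T : CStarMatrix n n ℂ) :
    hF.lift ψ hc (CStarMatrix.ofScalar n A T) = ∑ i, ∑ j, T i j • F i j := by
  rw [lift_apply]
  simp [CStarMatrix.ofScalar_apply, Algebra.algebraMap_eq_smul_one]

/-- The connecting map and the amplification agree off the projection π(1), so their difference
factors through it. This factor on the right is what makes the defect small on vectors. -/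
theorem lift_connect_sub (π : A →⋆ₙₐ[ℂ] CStarMatrix n n ℂ) (x : A) :
    hF.lift ψ hc (CStarMatrix.connect π x) - ψ x
      = (hF.lift ψ hc (CStarMatrix.ofScalar n A (π x)) - ψ x) *
        hF.lift ψ hc (CStarMatrix.ofScalar n A (π 1)) := by
  rw [← lift_amplify hF ψ hc x, sub_mul, ← map_mul, ← map_mul, ← map_mul, ← map_mul, mul_one,
    CStarMatrix.connect_apply, map_add, sub_mul, one_mul, map_sub,
    CStarMatrix.ofScalar_commute_amplify]
  abel

end IsMatrixUnits

/-! ### Finite dimensional representations with small range projection. -/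

/-- The star homomorphism into a product of C⋆-algebras with given components. -/
noncomputable def lpInftyProd {ι : Type*} {B : ι → Type*} [∀ i, NonUnitalCStarAlgebra (B i)]
    {A : Type*} [NonUnitalCStarAlgebra A] (f : ∀ i, A →⋆ₙₐ[ℂ] B i) : A →⋆ₙₐ[ℂ] lp B ∞ where
  toFun x := ⟨fun i => f i x, memℓp_infty ⟨‖x‖, by
    rintro _ ⟨i, rfl⟩
    exact NonUnitalStarAlgHom.norm_apply_le (f i) x⟩⟩
  map_smul' c x := by ext i; exact map_smul (f i) c x
  map_zero' := by ext i; exact map_zero (f i)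
  map_add' x y := by ext i; exact map_add (f i) x y
  map_mul' x y := by ext i; exact map_mul (f i) x y
  map_star' x := by ext i; exact map_star (f i) x

/-- Finite dimensional representations of a residually finite dimensional C⋆-algebra determine
the norm. -/
theorem IsResiduallyFiniteDimensional.exists_lt_norm {A : Type u} [CStarAlgebra A]
    (hA : IsResiduallyFiniteDimensional A) (x : A) (c : ℝ) (hc : c < ‖x‖) :
    ∃ (n : ℕ) (π : A →⋆ₙₐ[ℂ] CStarMatrix (Fin n) (Fin n) ℂ), c < ‖π x‖ := by
  by_contra! h
  let ι := Σ n : ℕ, (A →⋆ₙₐ[ℂ] CStarMatrix (Fin n) (Fin n) ℂ)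
  let f : A →⋆ₙₐ[ℂ] lp (fun i : ι => CStarMatrix (Fin i.1) (Fin i.1) ℂ) ∞ :=
    lpInftyProd fun i => i.2
  -- The product of all finite dimensional representations is injective, hence isometric, so the
  -- norm of x is the supremum of the norms of its components.
  have hinj : Function.Injective f := by
    rw [injective_iff_map_eq_zero]
    intro y hy
    by_contra hne
    obtain ⟨n, π, hπ⟩ := hA y hne
    let π' : A →⋆ₙₐ[ℂ] CStarMatrix (Fin n) (Fin n) ℂ :=
      { toFun := fun z => CStarMatrix.ofMatrix (π z)
        map_smul' := fun c z => map_smul π c z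
        map_zero' := map_zero π
        map_add' := fun z w => map_add π z w
        map_mul' := fun z w => map_mul π z w
        map_star' := fun z => map_star π z }
    have : f y ⟨n, π'⟩ = 0 := by rw [hy]; rfl
    exact hπ this
  have h0 : 0 ≤ c := (norm_nonneg _).trans (h 0 0)
  have : ‖f x‖ ≤ c := lp.norm_le_of_forall_le h0 fun i => h i.1 i.2
  rw [NonUnitalStarAlgHom.norm_map f hinj] at this
  exact absurd this (not_le.2 hc)

namespace Matrix

/-- A projection in `M_k(ℂ)` has trace at most `k`. -/
theorem re_trace_le_card_of_projection {κ : Type*} [Fintype κ] (M : Matrix κ κ ℂ)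
    (h1 : M * M = M) (h2 : M.conjTranspose = M) : (M.trace).re ≤ Fintype.card κ := by
  rw [Matrix.trace, Complex.re_sum]
  have : ∀ k, (M k k).re ≤ 1 := by
    intro k
    have e : M k k = ∑ j, M k j * M j k := by
      conv_lhs => rw [← h1]
      rfl
    have e2 : ∀ j, M j k = star (M k j) := fun j => by
      conv_lhs => rw [← h2]
      rfl
    have e3 : (M k k).re = ∑ j, Complex.normSq (M k j) := by
      rw [e, Complex.re_sum]
      refine Finset.sum_congr rfl fun j _ => ?_
      rw [e2 j]
      simp [Complex.mul_conj]
    -- A diagonal entry of a projection is the squared norm of its row, which is at least its own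
    -- square; hence it is at most 1.
    have e4 : Complex.normSq (M k k) ≤ (M k k).re := by
      rw [e3]
      exact Finset.single_le_sum (f := fun j => Complex.normSq (M k j))
        (fun j _ => Complex.normSq_nonneg _) (Finset.mem_univ k)
    rw [Complex.normSq_apply] at e4
    nlinarith [mul_self_nonneg (M k k).im]
  calc ∑ k, (M.diag k).re ≤ ∑ k : κ, (1 : ℝ) := Finset.sum_le_sum fun k _ => this k
    _ = _ := by simp

end Matrix

open Matrix in
/-- The block diagonal embedding of a finite product of matrix algebras in a larger matrix
algebra, padded by zero. -/
noncomputable def paddedBlockDiagonal {ι : Type*} [Fintype ι] [DecidableEq ι] (d : ι → ℕ) {N : ℕ}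
    (f : (Σ i, Fin (d i)) ↪ Fin N) :
    (∀ i, CStarMatrix (Fin (d i)) (Fin (d i)) ℂ) →⋆ₙₐ[ℂ] CStarMatrix (Fin N) (Fin N) ℂ :=
  let V : Matrix (Fin N) (Σ i, Fin (d i)) ℂ := Matrix.of fun a k => if a = f k then 1 else 0
  have hV : Vᴴ * V = 1 := by
    ext k l
    simp [V, Matrix.mul_apply, Matrix.one_apply, eq_comm]
  { toFun := fun M => CStarMatrix.ofMatrix (V * Matrix.blockDiagonal' (fun i => CStarMatrix.ofMatrix.symm (M i)) * Vᴴ)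
    map_smul' := fun c M => by
      change V * Matrix.blockDiagonal' (c • fun i => CStarMatrix.ofMatrix.symm (M i)) * Vᴴ
        = c • (V * Matrix.blockDiagonal' (fun i => CStarMatrix.ofMatrix.symm (M i)) * Vᴴ)
      rw [Matrix.blockDiagonal'_smul, Matrix.mul_smul, Matrix.smul_mul]
    map_zero' := by
      change V * Matrix.blockDiagonal' (0 : ∀ i, Matrix (Fin (d i)) (Fin (d i)) ℂ) * Vᴴ = 0
      rw [Matrix.blockDiagonal'_zero, Matrix.mul_zero, Matrix.zero_mul]
    map_add' := fun M M' => by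
      change V * Matrix.blockDiagonal' ((fun i => CStarMatrix.ofMatrix.symm (M i)) +
          fun i => CStarMatrix.ofMatrix.symm (M' i)) * Vᴴ
        = V * Matrix.blockDiagonal' (fun i => CStarMatrix.ofMatrix.symm (M i)) * Vᴴ +
          V * Matrix.blockDiagonal' (fun i => CStarMatrix.ofMatrix.symm (M' i)) * Vᴴ
      rw [Matrix.blockDiagonal'_add, Matrix.mul_add, Matrix.add_mul]
    map_mul' := fun M M' => by
      change V * Matrix.blockDiagonal' (fun i => CStarMatrix.ofMatrix.symm (M i) *
          CStarMatrix.ofMatrix.symm (M' i)) * Vᴴ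
        = (V * Matrix.blockDiagonal' (fun i => CStarMatrix.ofMatrix.symm (M i)) * Vᴴ) *
          (V * Matrix.blockDiagonal' (fun i => CStarMatrix.ofMatrix.symm (M' i)) * Vᴴ)
      rw [Matrix.blockDiagonal'_mul]
      simp only [Matrix.mul_assoc]
      rw [← Matrix.mul_assoc Vᴴ V, hV, Matrix.one_mul]
    map_star' := fun M => by
      change V * Matrix.blockDiagonal' (fun i => (CStarMatrix.ofMatrix.symm (M i))ᴴ) * Vᴴ
        = (V * Matrix.blockDiagonal' (fun i => CStarMatrix.ofMatrix.symm (M i)) * Vᴴ)ᴴ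
      rw [Matrix.conjTranspose_mul, Matrix.conjTranspose_mul, Matrix.conjTranspose_conjTranspose,
        Matrix.blockDiagonal'_conjTranspose, Matrix.mul_assoc] }

open Matrix in
theorem paddedBlockDiagonal_injective {ι : Type*} [Fintype ι] [DecidableEq ι] (d : ι → ℕ) {N : ℕ}
    (f : (Σ i, Fin (d i)) ↪ Fin N) : Function.Injective (paddedBlockDiagonal d f) := by
  intro M M' h
  let V : Matrix (Fin N) (Σ i, Fin (d i)) ℂ := Matrix.of fun a k => if a = f k then 1 else 0
  have hV : Vᴴ * V = 1 := by
    ext k l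
    simp [V, Matrix.mul_apply, Matrix.one_apply, eq_comm]
  have h' : V * Matrix.blockDiagonal' (fun i => CStarMatrix.ofMatrix.symm (M i)) * Vᴴ
      = V * Matrix.blockDiagonal' (fun i => CStarMatrix.ofMatrix.symm (M' i)) * Vᴴ := h
  have key : ∀ D : Matrix (Σ i, Fin (d i)) (Σ i, Fin (d i)) ℂ, Vᴴ * (V * D * Vᴴ) * V = D := by
    intro D
    simp only [Matrix.mul_assoc]
    rw [hV, Matrix.mul_one, ← Matrix.mul_assoc, hV, Matrix.one_mul]
  have h2 := congrArg (fun D => Vᴴ * D * V) h'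
  simp only [key] at h2
  exact Matrix.blockDiagonal'_injective h2

open Matrix in
-- The bound does not involve `N`: conjugation by the isometry `V` preserves the trace. Enlarging
-- `N` therefore makes the normalised trace as small as desired.
theorem re_trace_paddedBlockDiagonal_le {ι : Type*} [Fintype ι] [DecidableEq ι] (d : ι → ℕ) {N : ℕ}
    (f : (Σ i, Fin (d i)) ↪ Fin N) (M : ∀ i, CStarMatrix (Fin (d i)) (Fin (d i)) ℂ)
    (h1 : M * M = M) (h2 : star M = M) :
    (∑ a, paddedBlockDiagonal d f M a a).re ≤ ∑ i, (d i : ℝ) := by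
  let V : Matrix (Fin N) (Σ i, Fin (d i)) ℂ := Matrix.of fun a k => if a = f k then 1 else 0
  have hV : Vᴴ * V = 1 := by
    ext k l
    simp [V, Matrix.mul_apply, Matrix.one_apply, eq_comm]
  set D := Matrix.blockDiagonal' (fun i => CStarMatrix.ofMatrix.symm (M i)) with hD
  have e : ∑ a, paddedBlockDiagonal d f M a a = D.trace := by
    change (V * D * Vᴴ).trace = _
    rw [Matrix.trace_mul_comm, ← Matrix.mul_assoc, hV, Matrix.one_mul]
  have := Matrix.re_trace_le_card_of_projection D
    (by
      rw [hD, ← Matrix.blockDiagonal'_mul]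
      congr 1)
    (by
      rw [hD, Matrix.blockDiagonal'_conjTranspose]
      congr 1)
  rw [e]
  refine this.trans (le_of_eq ?_)
  simp

/-- A residually finite dimensional C⋆-algebra has representations on `ℂ^(2^l)` that are almost
isometric on a given finite set and whose range projection has small normalised trace. -/
theorem IsResiduallyFiniteDimensional.exists_representation {A : Type u} [CStarAlgebra A]
    [Nontrivial A] (hA : IsResiduallyFiniteDimensional A) (F : Finset A) (δ : ℝ) (hδ : 0 < δ) :
    ∃ (l : ℕ) (π : A →⋆ₙₐ[ℂ] CStarMatrix (Fin (2 ^ l)) (Fin (2 ^ l)) ℂ), 0 < l ∧ π 1 ≠ 0 ∧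
      (∑ i, π 1 i i).re ≤ δ * 2 ^ l ∧ ∀ x ∈ F, ‖x‖ ≤ 2 * ‖π x‖ := by
  classical
  have h : ∀ x : A, ∃ (n : ℕ) (π : A →⋆ₙₐ[ℂ] CStarMatrix (Fin n) (Fin n) ℂ), ‖x‖ ≤ 2 * ‖π x‖ := by
    intro x
    by_cases hx : x = 0
    · exact ⟨0, 0, by simp [hx]⟩
    · obtain ⟨n, π, h⟩ := hA.exists_lt_norm x (‖x‖ / 2) (by
        have := norm_pos_iff.2 hx; linarith)
      exact ⟨n, π, by linarith⟩
  choose d π hπ using h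
  -- Including 1 ensures that the representation is nonzero at the unit.
  let G := insert 1 F
  let d' : G → ℕ := fun x => d x
  -- The three terms force 0 < l, leave room for all blocks, and bound the normalised trace by δ.
  obtain ⟨l, hl⟩ := pow_unbounded_of_one_lt (max 1 (max (∑ i, (d' i : ℝ)) ((∑ i, (d' i : ℝ)) / δ)))
    (one_lt_two (α := ℝ))
  have hl1 : (1 : ℝ) < 2 ^ l := (le_max_left _ _).trans_lt hl
  have hl2 : ∑ i, (d' i : ℝ) < 2 ^ l := (le_max_left _ _).trans_lt ((le_max_right _ _).trans_lt hl)
  have hl3 : (∑ i, (d' i : ℝ)) / δ < 2 ^ l :=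
    (le_max_right _ _).trans_lt ((le_max_right _ _).trans_lt hl)
  have hcard : Fintype.card (Σ i, Fin (d' i)) ≤ Fintype.card (Fin (2 ^ l)) := by
    simp only [Fintype.card_sigma, Fintype.card_fin]
    exact_mod_cast hl2.le
  obtain ⟨f⟩ := Function.Embedding.nonempty_of_card_le hcard
  let p : A →⋆ₙₐ[ℂ] (∀ i : G, CStarMatrix (Fin (d' i)) (Fin (d' i)) ℂ) :=
    { toFun := fun x i => π i x
      map_smul' := fun c x => by ext1 i; exact map_smul (π i) c x
      map_zero' := by ext1 i; exact map_zero (π i)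
      map_add' := fun x y => by ext1 i; exact map_add (π i) x y
      map_mul' := fun x y => by ext1 i; exact map_mul (π i) x y
      map_star' := fun x => by ext1 i; exact map_star (π i) x }
  let Φ := (paddedBlockDiagonal d' f).comp p
  have hnorm : ∀ x ∈ G, ‖x‖ ≤ 2 * ‖Φ x‖ := by
    intro x hx
    have e : ‖Φ x‖ = ‖p x‖ :=
      NonUnitalStarAlgHom.norm_map (paddedBlockDiagonal d' f) (paddedBlockDiagonal_injective d' f) _
    rw [e]
    have := norm_le_pi_norm (p x) ⟨x, hx⟩
    have h2 : ‖x‖ ≤ 2 * ‖p x ⟨x, hx⟩‖ := hπ x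
    linarith
  refine ⟨l, Φ, ?_, ?_, ?_, fun x hx => hnorm x (Finset.mem_insert_of_mem hx)⟩
  · rcases Nat.eq_zero_or_pos l with h | h
    · simp [h] at hl1
    · exact h
  · intro h0
    have := hnorm 1 (Finset.mem_insert_self _ _)
    rw [h0] at this
    simp at this
    exact absurd this (by norm_num)
  · refine (re_trace_paddedBlockDiagonal_le d' f (p 1) ?_ ?_).trans ?_
    · rw [← map_mul, one_mul]
    · rw [← map_star, star_one]
    · rw [div_lt_iff₀ hδ] at hl3
      linarith

/-- Matrix algebras over a residually finite dimensional C⋆-algebra are residually finite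
dimensional. -/
theorem IsResiduallyFiniteDimensional.cstarMatrix {A : Type u} [CStarAlgebra A] [PartialOrder A]
    [StarOrderedRing A] (hA : IsResiduallyFiniteDimensional A) (n : ℕ) :
    IsResiduallyFiniteDimensional (CStarMatrix (Fin n) (Fin n) A) := by
  intro x hx
  obtain ⟨i, j, hij⟩ : ∃ i j, x i j ≠ 0 := by
    by_contra! h
    exact hx (CStarMatrix.ext h)
  obtain ⟨k, π, hπ⟩ := hA _ hij
  let e : Fin n × Fin k ≃ Fin (n * k) := finProdFinEquiv
  refine ⟨n * k,
    { toFun := fun y => Matrix.of fun p q => π (y (e.symm p).1 (e.symm q).1) (e.symm p).2 (e.symm q).2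
      map_smul' := fun c y => by ext p q; simp
      map_zero' := by ext p q; simp
      map_add' := fun y z => by ext p q; simp
      map_mul' := fun y z => by
        ext p q
        simp only [CStarMatrix.mul_apply, map_sum, map_mul, Matrix.mul_apply, Matrix.of_apply,
          Matrix.sum_apply]
        rw [← e.sum_comp, Fintype.sum_prod_type]
        simp
      map_star' := fun y => by
        ext p q
        simp [CStarMatrix.star_apply, Matrix.star_apply, map_star] }, ?_⟩
  intro h0
  apply hπ
  ext a b
  have := congrFun (congrFun h0 (e (i, a))) (e (j, b))
  simpa using this
-- Recursive construction of the tower.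
/-- A C⋆-algebra together with the data carried along the construction of the tower. -/
structure Stage (C : ∀ (B : Type u) [CStarAlgebra B], Prop) where
  carrier : Type u
  [inst : CStarAlgebra carrier]
  [nontrivial : Nontrivial carrier]
  [separable : TopologicalSpace.SeparableSpace carrier]
  mem : C carrier
  rfd : IsResiduallyFiniteDimensional carrier
  G : ℕ → Finset carrier
  mono : Monotone G
  dense : Dense (⋃ k, (G k : Set carrier))

attribute [instance] Stage.inst Stage.nontrivial Stage.separable

namespace Stage
variable {C : ∀ (B : Type u) [CStarAlgebra B], Prop}

/-- The trace bound is a power of 1/4 because the norm of a projection applied to a vector is the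
square root of a trace; the defects are then summable like powers of 1/2. -/
noncomputable def size (S : Stage C) (m : ℕ) : ℕ :=
  (S.rfd.exists_representation (S.G m) ((1 / 4) ^ (m + 1)) (by positivity)).choose

noncomputable def rep (S : Stage C) (m : ℕ) :
    S.carrier →⋆ₙₐ[ℂ] CStarMatrix (Fin (2 ^ S.size m)) (Fin (2 ^ S.size m)) ℂ :=
  (S.rfd.exists_representation (S.G m) ((1 / 4) ^ (m + 1)) (by positivity)).choose_spec.choose

theorem rep_spec (S : Stage C) (m : ℕ) : 0 < S.size m ∧ S.rep m 1 ≠ 0 ∧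
      (∑ i, S.rep m 1 i i).re ≤ (1 / 4) ^ (m + 1) * 2 ^ S.size m ∧
        ∀ x ∈ S.G m, ‖x‖ ≤ 2 * ‖S.rep m x‖ :=
  (S.rfd.exists_representation (S.G m) ((1 / 4) ^ (m + 1)) (by positivity)).choose_spec.choose_spec

theorem exists_dense_finsets (A : Type u) [TopologicalSpace A] [Nonempty A]
    [TopologicalSpace.SeparableSpace A] :
    ∃ G : ℕ → Finset A, Monotone G ∧ Dense (⋃ k, (G k : Set A)) := by
  classical
  refine ⟨fun k => (Finset.range k).image (TopologicalSpace.denseSeq A), ?_, ?_⟩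
  · intro a b h
    exact Finset.image_subset_image (Finset.range_mono h)
  · refine (TopologicalSpace.denseRange_denseSeq A).mono ?_
    rintro _ ⟨n, rfl⟩
    exact Set.mem_iUnion.2 ⟨n + 1, by simpa using ⟨n, le_rfl, rfl⟩⟩

/-- The next stage of the tower: `2^l × 2^l` matrices. -/
noncomputable def next (hC : ClosedUnderMatrixTensoring C) (S : Stage C) (m : ℕ) : Stage C :=
  letI := CStarAlgebra.spectralOrder S.carrier
  letI := CStarAlgebra.spectralOrderedRing S.carrier
  let B := CStarMatrix (Fin (2 ^ S.size m)) (Fin (2 ^ S.size m)) S.carrier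
  letI : DecidableEq B := Classical.decEq B
  haveI : TopologicalSpace.SeparableSpace B := inferInstanceAs
    (TopologicalSpace.SeparableSpace (Fin (2 ^ S.size m) → Fin (2 ^ S.size m) → S.carrier))
  { carrier := B
    mem := hC S.carrier (2 ^ S.size m) Nat.one_le_two_pow S.mem
    rfd := S.rfd.cstarMatrix _
    G := fun k => (S.G k).image (CStarMatrix.connect (S.rep m)) ∪
      (exists_dense_finsets B).choose k
    mono := fun a b h => Finset.union_subset_union (Finset.image_subset_image (S.mono h))
      ((exists_dense_finsets B).choose_spec.1 h)
    dense := (exists_dense_finsets B).choose_spec.2.mono (Set.iUnion_mono fun k => by simp) }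

noncomputable def nextIso (hC : ClosedUnderMatrixTensoring C) (S : Stage C) (m : ℕ) :
    (S.next hC m).carrier ≃⋆ₐ[ℂ]
      CStarMatrix (Fin (2 ^ S.size m)) (Fin (2 ^ S.size m)) S.carrier where
  toFun x := x
  invFun x := x
  left_inv _ := rfl
  right_inv _ := rfl
  map_mul' _ _ := rfl
  map_add' _ _ := rfl
  map_star' _ := rfl
  map_smul' _ _ := rfl

/-- An element of the k-th finite set thus stays in the k-th finite set of all later stages, and
from stage k on the chosen representations almost preserve its norm. -/
theorem connect_mem_next (hC : ClosedUnderMatrixTensoring C) (S : Stage C) (m k : ℕ)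
    (x : S.carrier) (hx : x ∈ S.G k) :
    (S.nextIso hC m).symm (CStarMatrix.connect (S.rep m) x) ∈ (S.next hC m).G k := by
  let _ : DecidableEq (S.next hC m).carrier := Classical.decEq _
  exact Finset.mem_union_left _ (Finset.mem_image_of_mem _ hx)

end Stage

/-- An inductive sequence of matrix algebras over a given C⋆-algebra, each connected to the next
by means of a finite dimensional representation. -/
structure Tower (C : ∀ (B : Type u) [CStarAlgebra B], Prop) (E : Type u) [CStarAlgebra E] where
  A : ℕ → Type u
  [inst : ∀ m, CStarAlgebra (A m)]
  [nontrivial : ∀ m, Nontrivial (A m)]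
  [separable : ∀ m, TopologicalSpace.SeparableSpace (A m)]
  mem : ∀ m, C (A m)
  base : E ≃⋆ₐ[ℂ] A 0
  l : ℕ → ℕ
  l_pos : ∀ m, 0 < l m
  rep : ∀ m, A m →⋆ₙₐ[ℂ] CStarMatrix (Fin (2 ^ l m)) (Fin (2 ^ l m)) ℂ
  rep_one : ∀ m, rep m 1 ≠ 0
  trace_le : ∀ m, (∑ i, rep m 1 i i).re ≤ (1 / 4) ^ (m + 1) * 2 ^ l m
  iso : ∀ m, A (m + 1) ≃⋆ₐ[ℂ] CStarMatrix (Fin (2 ^ l m)) (Fin (2 ^ l m)) (A m)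
  G : ∀ m, ℕ → Finset (A m)
  mono : ∀ m, Monotone (G m)
  dense : ∀ m, Dense (⋃ k, (G m k : Set (A m)))
  connect_mem : ∀ m k x, x ∈ G m k → (iso m).symm (CStarMatrix.connect (rep m) x) ∈ G (m + 1) k
  norm_le : ∀ m, ∀ x ∈ G m m, ‖x‖ ≤ 2 * ‖rep m x‖

theorem exists_tower (C : ∀ (B : Type u) [CStarAlgebra B], Prop)
    (hC : ClosedUnderMatrixTensoring C) (E : Type u) [CStarAlgebra E] [Nontrivial E]
    [TopologicalSpace.SeparableSpace E] (hE : C E) (hE' : IsResiduallyFiniteDimensional E) :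
    Nonempty (Tower C E) := by
  obtain ⟨G, hG1, hG2⟩ := Stage.exists_dense_finsets E
  let S0 : Stage C := { carrier := E, mem := hE, rfd := hE', G := G, mono := hG1, dense := hG2 }
  let S : ℕ → Stage C := fun n => Nat.rec S0 (fun m T => T.next hC m) n
  exact ⟨{
    A := fun m => (S m).carrier
    inst := fun m => (S m).inst
    nontrivial := fun m => (S m).nontrivial
    separable := fun m => (S m).separable
    mem := fun m => (S m).mem
    base := StarAlgEquiv.refl ℂ E
    l := fun m => (S m).size m
    l_pos := fun m => ((S m).rep_spec m).1
    rep := fun m => (S m).rep m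
    rep_one := fun m => ((S m).rep_spec m).2.1
    trace_le := fun m => ((S m).rep_spec m).2.2.1
    iso := fun m => (S m).nextIso hC m
    G := fun m => (S m).G
    mono := fun m => (S m).mono
    dense := fun m => (S m).dense
    connect_mem := fun m k x hx => (S m).connect_mem_next hC m k x hx
    norm_le := fun m => ((S m).rep_spec m).2.2.2 }⟩

/-! ### Strong limits of asymptotically compatible representations. -/

section StrongLimits

variable {H : Type*} [NormedAddCommGroup H] [NormedSpace ℂ H]

/-- Strong convergence of a bounded sequence may be tested on a dense set. -/
theorem tendsto_apply_of_dense {u : ℕ → H →L[ℂ] H} {T : H →L[ℂ] H} {C : ℝ} (hu : ∀ n, ‖u n‖ ≤ C)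
    {D : Set H} (hD : Dense D) (h : ∀ f ∈ D, Tendsto (fun n => u n f) atTop (𝓝 (T f))) (f : H) :
    Tendsto (fun n => u n f) atTop (𝓝 (T f)) := by
  rw [Metric.tendsto_atTop]
  intro ε hε
  have hC : 0 ≤ C := (norm_nonneg _).trans (hu 0)
  set K := C + ‖T‖ + 1 with hK
  have hKpos : 0 < K := by positivity
  obtain ⟨g, hg, hfg⟩ := hD.exists_dist_lt f (div_pos (half_pos hε) hKpos)
  obtain ⟨N, hN⟩ := (Metric.tendsto_atTop.1 (h g hg)) (ε / 2) (half_pos hε)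
  refine ⟨N, fun n hn => ?_⟩
  have h1 := hN n hn
  rw [dist_eq_norm] at h1 hfg ⊢
  have e : u n f - T f = (u n - T) (f - g) + (u n g - T g) := by simp; abel
  have h2 : ‖(u n - T) (f - g)‖ ≤ K * ‖f - g‖ :=
    ((u n - T).le_opNorm _).trans <| by
      gcongr
      exact (norm_sub_le _ _).trans (by rw [hK]; linarith [hu n])
  have h3 : K * ‖f - g‖ < ε / 2 := by
    rw [lt_div_iff₀ hKpos] at hfg
    linarith
  rw [e]
  exact (norm_add_le _ _).trans_lt (by linarith)

/-- A bounded sequence of operators which is pointwise Cauchy on a dense set converges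
strongly. -/
theorem exists_tendsto_apply_of_dense [CompleteSpace H] {u : ℕ → H →L[ℂ] H} {C : ℝ}
    (hu : ∀ n, ‖u n‖ ≤ C) {D : Set H} (hD : Dense D)
    (h : ∀ f ∈ D, CauchySeq (fun n => u n f)) :
    ∃ T : H →L[ℂ] H, ∀ f, Tendsto (fun n => u n f) atTop (𝓝 (T f)) := by
  have hC : 0 ≤ C := (norm_nonneg _).trans (hu 0)
  have hall : ∀ f, CauchySeq (fun n => u n f) := by
    intro f
    rw [Metric.cauchySeq_iff']
    intro ε hε
    set K := 2 * C + 1 with hK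
    have hKpos : 0 < K := by positivity
    obtain ⟨g, hg, hfg⟩ := hD.exists_dist_lt f (div_pos (half_pos hε) hKpos)
    obtain ⟨N, hN⟩ := Metric.cauchySeq_iff'.1 (h g hg) (ε / 2) (half_pos hε)
    refine ⟨N, fun n hn => ?_⟩
    have h1 := hN n hn
    rw [dist_eq_norm] at h1 hfg ⊢
    have e : u n f - u N f = (u n - u N) (f - g) + (u n g - u N g) := by simp; abel
    have h2 : ‖(u n - u N) (f - g)‖ ≤ K * ‖f - g‖ :=
      ((u n - u N).le_opNorm _).trans <| by
        gcongr
        exact (norm_sub_le _ _).trans (by rw [hK]; linarith [hu n, hu N])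
    have h3 : K * ‖f - g‖ < ε / 2 := by
      rw [lt_div_iff₀ hKpos] at hfg
      linarith
    rw [e]
    exact (norm_add_le _ _).trans_lt (by linarith)
  choose g hg using fun f => cauchySeq_tendsto_of_complete (hall f)
  exact ⟨continuousLinearMapOfTendsto u (tendsto_pi_nhds.2 hg), hg⟩

end StrongLimits

section Connecting

variable {A : ℕ → Type u} [∀ m, CStarAlgebra (A m)] (φ : ∀ m, A m →⋆ₐ[ℂ] A (m + 1))

/-- The composition `A m → A n` of the connecting maps. -/
noncomputable def iterHom {m n : ℕ} (h : m ≤ n) : A m →⋆ₐ[ℂ] A n :=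
  Nat.leRec (motive := fun n _ => A m →⋆ₐ[ℂ] A n) (StarAlgHom.id ℂ (A m))
    (fun k _ f => (φ k).comp f) h

theorem iterHom_self (m : ℕ) (x : A m) : iterHom φ le_rfl x = x := by
  rw [iterHom, Nat.leRec_self]; rfl

theorem iterHom_succ {m n : ℕ} (h : m ≤ n) (x : A m) :
    iterHom φ (Nat.le_succ_of_le h) x = φ n (iterHom φ h x) := by
  rw [iterHom, Nat.leRec_succ]; rfl

theorem iterHom_succ_left {m n : ℕ} (h : m + 1 ≤ n) (x : A m) :
    iterHom φ h (φ m x) = iterHom φ (Nat.le_of_succ_le h) x := by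
  induction n, h using Nat.le_induction with
  | base => rw [iterHom_self, iterHom_succ φ le_rfl, iterHom_self]
  | succ n h ih => rw [iterHom_succ φ h, ih, iterHom_succ φ (Nat.le_of_succ_le h)]

theorem norm_iterHom_le {m n : ℕ} (h : m ≤ n) (x : A m) : ‖iterHom φ h x‖ ≤ ‖x‖ :=
  NonUnitalStarAlgHom.norm_apply_le (iterHom φ h) x

/-- A sequence of representations which is asymptotically compatible with the connecting maps, in
the strong operator topology. -/
structure AsymptoticRep (H : Type*) [NormedAddCommGroup H] [InnerProductSpace ℂ H]
    [CompleteSpace H] where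
  ψ : ∀ m, A m →⋆ₐ[ℂ] (H →L[ℂ] H)
  w : H → ℕ → ℝ
  w_nonneg : ∀ f m, 0 ≤ w f m
  D : Set H
  dense : Dense D
  summable : ∀ f ∈ D, Summable (w f)
  step_le : ∀ m (x : A m) f, ‖ψ (m + 1) (φ m x) f - ψ m x f‖ ≤ ‖x‖ * w f m

namespace AsymptoticRep

variable {φ} {H : Type*} [NormedAddCommGroup H] [InnerProductSpace ℂ H] [CompleteSpace H]
  (R : AsymptoticRep φ H)

/-- The representation of `A m` at stage `m + k`. -/
noncomputable def approx (m k : ℕ) : A m →⋆ₐ[ℂ] (H →L[ℂ] H) :=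
  (R.ψ (m + k)).comp (iterHom φ (Nat.le_add_right m k))

theorem norm_approx_le (m k : ℕ) (x : A m) : ‖R.approx m k x‖ ≤ ‖x‖ :=
  NonUnitalStarAlgHom.norm_apply_le (R.approx m k) x

theorem approx_zero (m : ℕ) (x : A m) : R.approx m 0 x = R.ψ m x :=
  congrArg (R.ψ m) (iterHom_self φ m x)

theorem approx_step_le (m k : ℕ) (x : A m) (f : H) :
    ‖R.approx m (k + 1) x f - R.approx m k x f‖ ≤ ‖x‖ * R.w f (m + k) := by
  have h : R.approx m (k + 1) x = R.ψ (m + k + 1) (φ (m + k) (iterHom φ (Nat.le_add_right m k) x)) :=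
    congrArg (R.ψ (m + k + 1)) (iterHom_succ φ (Nat.le_add_right m k) x)
  rw [h]
  refine (R.step_le (m + k) _ f).trans ?_
  exact mul_le_mul_of_nonneg_right (norm_iterHom_le φ _ x) (R.w_nonneg _ _)

theorem exists_limit (m : ℕ) (x : A m) :
    ∃ T : H →L[ℂ] H, ∀ f, Tendsto (fun k => R.approx m k x f) atTop (𝓝 (T f)) := by
  refine exists_tendsto_apply_of_dense (fun k => R.norm_approx_le m k x) R.dense fun f hf => ?_
  refine cauchySeq_of_dist_le_of_summable (fun k => ‖x‖ * R.w f (m + k)) (fun k => ?_) ?_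
  · rw [dist_comm, dist_eq_norm]
    exact R.approx_step_le m k x f
  · refine Summable.mul_left _ ?_
    simpa only [add_comm] using (summable_nat_add_iff m).2 (R.summable f hf)

/-- The strong limit of the representations `approx m k` as `k → ∞`. -/
noncomputable def limit (m : ℕ) : A m →⋆ₐ[ℂ] (H →L[ℂ] H) :=
  let L : A m → H →L[ℂ] H := fun x => (R.exists_limit m x).choose
  have hL : ∀ x f, Tendsto (fun k => R.approx m k x f) atTop (𝓝 (L x f)) :=
    fun x => (R.exists_limit m x).choose_spec
  have scal : ∀ r : ℂ, L (algebraMap ℂ (A m) r) = algebraMap ℂ _ r := fun r => by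
    ext f
    refine tendsto_nhds_unique (hL _ f) ?_
    simp only [AlgHomClass.commutes]
    exact tendsto_const_nhds
  { toFun := L
    map_one' := by simpa using scal 1
    map_zero' := by simpa using scal 0
    commutes' := scal
    map_add' := fun x y => by
      ext f
      refine tendsto_nhds_unique (hL _ f) ?_
      simpa using (hL x f).add (hL y f)
    map_mul' := fun x y => by
      ext f
      refine tendsto_nhds_unique (hL _ f) ?_
      have h1 := hL x (L y f)
      -- Multiplication is strongly continuous on bounded sets: the approximants of x are bounded by
      -- ‖x‖, so replacing the inner vector by its limit costs nothing.
      have h2 : Tendsto (fun k => R.approx m k x (R.approx m k y f - L y f)) atTop (𝓝 0) := by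
        refine squeeze_zero_norm (a := fun k => ‖x‖ * ‖R.approx m k y f - L y f‖) (fun k => ?_) ?_
        · exact ((R.approx m k x).le_opNorm _).trans
            (mul_le_mul_of_nonneg_right (R.norm_approx_le m k x) (norm_nonneg _))
        · have h3 : Tendsto (fun k => R.approx m k y f - L y f) atTop (𝓝 0) := by
            simpa using (hL y f).sub_const (L y f)
          simpa using h3.norm.const_mul ‖x‖
      have h4 := h2.add h1
      simpa using h4
    map_star' := fun x => by
      refine ContinuousLinearMap.ext fun f => ext_inner_right ℂ fun g => ?_
      have h1 : Tendsto (fun k => inner ℂ (R.approx m k (star x) f) g) atTop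
          (𝓝 (inner ℂ (L (star x) f) g)) := (hL (star x) f).inner tendsto_const_nhds
      have h2 : Tendsto (fun k => inner ℂ f (R.approx m k x g)) atTop (𝓝 (inner ℂ f (L x g))) :=
        tendsto_const_nhds.inner (hL x g)
      rw [ContinuousLinearMap.star_eq_adjoint, ContinuousLinearMap.adjoint_inner_left]
      refine tendsto_nhds_unique h1 (h2.congr fun k => ?_)
      rw [map_star, ContinuousLinearMap.star_eq_adjoint, ContinuousLinearMap.adjoint_inner_left] }

theorem tendsto_limit (m : ℕ) (x : A m) (f : H) :
    Tendsto (fun k => R.approx m k x f) atTop (𝓝 (R.limit m x f)) :=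
  (R.exists_limit m x).choose_spec f

theorem limit_succ (m : ℕ) (x : A m) : R.limit (m + 1) (φ m x) = R.limit m x := by
  ext f
  refine tendsto_nhds_unique (R.tendsto_limit (m + 1) (φ m x) f)
    (((tendsto_add_atTop_iff_nat 1).2 (R.tendsto_limit m x f)).congr fun k => ?_)
  -- The stages `m + 1 + k` and `m + (k + 1)` are not definitionally the same, so the algebras are
  -- compared along an arbitrary equality of indices.
  have key : ∀ n n' (_ : n = n') (h : m ≤ n) (h' : m ≤ n'),
      R.ψ n (iterHom φ h x) = R.ψ n' (iterHom φ h' x) := by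
    rintro n _ rfl h h'; rfl
  have h2 : R.approx (m + 1) k (φ m x) = R.approx m (k + 1) x := by
    refine (congrArg (R.ψ (m + 1 + k)) (iterHom_succ_left φ _ x)).trans ?_
    exact key _ _ (by omega) _ _
  rw [h2]

theorem limit_iterHom {m n : ℕ} (h : m ≤ n) (x : A m) :
    R.limit n (iterHom φ h x) = R.limit m x := by
  induction n, h using Nat.le_induction with
  | base => rw [iterHom_self]
  | succ n h ih => rw [iterHom_succ φ h, R.limit_succ, ih]

/-- Telescoping from stage m on. Only the tail of the defects enters, so the limit is close to `ψ m`
when m is large. -/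
theorem norm_limit_sub_le (m : ℕ) (x : A m) {f : H} (hf : f ∈ R.D) :
    ‖R.limit m x f - R.ψ m x f‖ ≤ ‖x‖ * ∑' k, R.w f (k + m) := by
  have hs : Summable fun k => R.w f (k + m) := (summable_nat_add_iff m).2 (R.summable f hf)
  have h : ∀ k, ‖R.approx m k x f - R.ψ m x f‖ ≤ ‖x‖ * ∑ j ∈ Finset.range k, R.w f (j + m) := by
    intro k
    induction k with
    | zero => simp [R.approx_zero]
    | succ k ih =>
      rw [Finset.sum_range_succ, mul_add]
      have h1 := R.approx_step_le m k x f
      rw [add_comm m k] at h1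
      calc _ = ‖(R.approx m k x f - R.ψ m x f) + (R.approx m (k + 1) x f - R.approx m k x f)‖ := by
            congr 1; abel
        _ ≤ _ := (norm_add_le _ _).trans (add_le_add ih h1)
  refine le_of_tendsto ((R.tendsto_limit m x f).sub_const _).norm (Eventually.of_forall fun k => ?_)
  refine (h k).trans (mul_le_mul_of_nonneg_left ?_ (norm_nonneg _))
  exact hs.sum_le_tsum _ fun j _ => R.w_nonneg _ _

/-- If `d` is a second system of connecting maps, with which the `ψ m` are strictly compatible, then
the limits recover the `ψ m`. -/
theorem tendsto_limit_iterHom {d : ∀ m, A m →⋆ₐ[ℂ] A (m + 1)}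
    (hd : ∀ m x, R.ψ (m + 1) (d m x) = R.ψ m x) (m : ℕ) (x : A m) (f : H) :
    Tendsto (fun k => R.limit (m + k) (iterHom d (Nat.le_add_right m k) x) f) atTop
      (𝓝 (R.ψ m x f)) := by
  -- Along `d` the representations do not move at all, so the error at stage m + k is a tail of a
  -- convergent series.
  have hψ : ∀ n (h : m ≤ n), R.ψ n (iterHom d h x) = R.ψ m x := by
    intro n h
    induction n, h using Nat.le_induction with
    | base => rw [iterHom_self]
    | succ n h ih => rw [iterHom_succ d h, hd, ih]
  refine tendsto_apply_of_dense (C := ‖x‖) (fun k => ?_) R.dense (fun f hf => ?_) f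
  · exact (NonUnitalStarAlgHom.norm_apply_le (R.limit (m + k)) _).trans (norm_iterHom_le d _ x)
  · rw [tendsto_iff_norm_sub_tendsto_zero]
    have h0 : Tendsto (fun k => ‖x‖ * ∑' j, R.w f (j + (m + k))) atTop (𝓝 0) := by
      have h1 := (tendsto_sum_nat_add (R.w f)).comp (tendsto_add_atTop_nat m)
      have h2 := h1.const_mul ‖x‖
      simpa [Function.comp_def, add_comm] using h2
    refine squeeze_zero (fun k => norm_nonneg _) (fun k => ?_) h0
    have h1 := R.norm_limit_sub_le (m + k) (iterHom d (Nat.le_add_right m k) x) hf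
    rw [hψ] at h1
    exact h1.trans (mul_le_mul_of_nonneg_right (norm_iterHom_le d _ x)
      (tsum_nonneg fun j => R.w_nonneg _ _))

end AsymptoticRep

end Connecting

/-! ### Pauli systems and blocks of matrix units. -/

/-- The matrix units of the algebra generated by a pair of Pauli matrices. -/
noncomputable def pauliUnit {B : Type*} [Ring B] [Algebra ℂ B] (X Z : B) (a b : Fin 2) : B :=
  (if a = b then 1 else X) * ((1 / 2 : ℂ) • (1 + (if b = 0 then Z else -Z)))

section

variable {B : Type*} [Ring B] [StarRing B] [Algebra ℂ B] [StarModule ℂ B]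

theorem pauliUnit_isMatrixUnits {X Z : B} (hX : star X = X) (hZ : star Z = Z) (hXX : X * X = 1)
    (hZZ : Z * Z = 1) (hXZ : X * Z = -(Z * X)) : IsMatrixUnits (pauliUnit X Z) := by
  set P : Fin 2 → B := fun b => (1 / 2 : ℂ) • (1 + (if b = 0 then Z else -Z)) with hP
  have hPP : ∀ b c, P b * P c = if b = c then P b else 0 := by
    intro b c
    fin_cases b <;> fin_cases c <;>
      simp [hP, mul_add, add_mul, hZZ] <;> module
  have hPX : ∀ b, P b * X = X * P (1 - b) := by
    intro b
    have hZX : Z * X = -(X * Z) := by rw [hXZ, neg_neg]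
    fin_cases b <;> simp [hP, mul_add, add_mul, hZX]
  have hPs : ∀ b, star (P b) = P b := by
    intro b
    fin_cases b <;> simp [hP, hZ]
  have hu : ∀ a b, pauliUnit X Z a b = (if a = b then 1 else X) * P b := fun a b => rfl
  have hPX' : ∀ b c, P b * (X * P c) = if b = 1 - c then X * P c else 0 := by
    intro b c
    rw [← mul_assoc, hPX, mul_assoc, hPP]
    fin_cases b <;> fin_cases c <;> simp
  refine ⟨fun i j k l => ?_, fun i j => ?_, ?_⟩
  · rw [hu, hu, hu]
    fin_cases i <;> fin_cases j <;> fin_cases k <;> fin_cases l <;>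
      simp [hPP, hPX', mul_assoc] <;> rw [← mul_assoc, hXX, one_mul]
  · rw [hu, hu, star_mul, hPs]
    fin_cases i <;> fin_cases j <;> simp [hX, hPX]
  · simp only [hu, Fin.sum_univ_two, if_true, one_mul]
    simp [hP, ← smul_add]
    module

theorem commute_pauliUnit {X Z T : B} (hX : Commute T X) (hZ : Commute T Z) (a b : Fin 2) :
    Commute T (pauliUnit X Z a b) := by
  have h1 : Commute T (1 : B) := Commute.one_right T
  refine Commute.mul_right ?_ (Commute.smul_right (Commute.add_right h1 ?_) _)
  · split_ifs
    exacts [h1, hX]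
  · split_ifs
    exacts [hZ, hZ.neg_right]

/-- The Pauli matrices are recovered as e₁₀ + e₀₁ and e₀₀ - e₁₁, so no commutant is lost in passing
to matrix units. -/
theorem commute_of_commute_pauliUnit {X Z T : B} (h : ∀ a b, Commute T (pauliUnit X Z a b)) :
    Commute T X ∧ Commute T Z := by
  have eX : X = pauliUnit X Z 1 0 + pauliUnit X Z 0 1 := by
    simp [pauliUnit, ← mul_add, ← smul_add]
    have : 1 + Z + (1 + -Z) = (2 : ℂ) • (1 : B) := by rw [two_smul]; abel
    rw [this, mul_smul_comm, smul_smul, mul_one]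
    norm_num
  have eZ : Z = pauliUnit X Z 0 0 - pauliUnit X Z 1 1 := by
    simp [pauliUnit]
    module
  constructor
  · rw [eX]; exact (h 1 0).add_right (h 0 1)
  · rw [eZ]; exact (h 0 0).sub_right (h 1 1)

/-- The product of two commuting systems of matrix units. -/
theorem IsMatrixUnits.prod {n m k : Type*} [Fintype n] [DecidableEq n] [Fintype m] [DecidableEq m]
    [Fintype k] [DecidableEq k] {F : n → n → B} {G : m → m → B} (hF : IsMatrixUnits F)
    (hG : IsMatrixUnits G) (hc : ∀ a b c d, Commute (F a b) (G c d)) (e : k ≃ n × m) :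
    IsMatrixUnits fun p q => F (e p).1 (e q).1 * G (e p).2 (e q).2 := by
  refine ⟨fun i j k l => ?_, fun i j => ?_, ?_⟩
  · rw [mul_assoc, ← mul_assoc (G _ _), ← (hc _ _ _ _).eq, mul_assoc, hG.mul_eq, ← mul_assoc,
      hF.mul_eq]
    by_cases h : j = k
    · simp [h]
    · have : ¬ ((e j).1 = (e k).1 ∧ (e j).2 = (e k).2) := fun h' =>
        h (e.injective (Prod.ext h'.1 h'.2))
      rw [if_neg h]
      by_cases h1 : (e j).1 = (e k).1
      · rw [if_neg (fun h2 => this ⟨h1, h2⟩), mul_zero]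
      · rw [if_neg h1, zero_mul]
  · rw [star_mul, hF.star_eq, hG.star_eq, (hc _ _ _ _).eq]
  · rw [e.sum_comp (fun p => F p.1 p.1 * G p.2 p.2), Fintype.sum_prod_type]
    simp only [← Finset.mul_sum, hG.sum_eq, mul_one, hF.sum_eq]

end

/-- Operators satisfying the relations of the Pauli matrices in an infinite tensor product, with
an increasing sequence of subspaces `V s` on which the first `s` of them act, and to which the
later ones are orthogonal. -/
structure PauliSystem (H : Type*) [NormedAddCommGroup H] [InnerProductSpace ℂ H]
    [CompleteSpace H] where
  X : ℕ → H →L[ℂ] H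
  Z : ℕ → H →L[ℂ] H
  star_X : ∀ i, star (X i) = X i
  star_Z : ∀ i, star (Z i) = Z i
  X_mul_X : ∀ i, X i * X i = 1
  Z_mul_Z : ∀ i, Z i * Z i = 1
  X_mul_Z : ∀ i, X i * Z i = -(Z i * X i)
  commute_XX : ∀ i j, Commute (X i) (X j)
  commute_ZZ : ∀ i j, Commute (Z i) (Z j)
  commute_XZ : ∀ i j, i ≠ j → Commute (X i) (Z j)
  V : ℕ → Submodule ℂ H
  mono : Monotone V
  dense : Dense (⋃ s, (V s : Set H))
  X_mem : ∀ i s, i < s → ∀ f ∈ V s, X i f ∈ V s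
  Z_mem : ∀ i s, i < s → ∀ f ∈ V s, Z i f ∈ V s
  inner_X : ∀ s, ∀ f ∈ V s, ∀ g ∈ V s, inner ℂ f (X s g) = 0
  inner_Z : ∀ s, ∀ f ∈ V s, ∀ g ∈ V s, inner ℂ f (Z s g) = 0
  inner_XZ : ∀ s, ∀ f ∈ V s, ∀ g ∈ V s, inner ℂ f (X s (Z s g)) = 0

namespace PauliSystem

variable {H : Type*} [NormedAddCommGroup H] [InnerProductSpace ℂ H] [CompleteSpace H]
  (P : PauliSystem H)

/-- The matrix units of the `i`-th tensor factor. -/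
noncomputable def unit (i : ℕ) : Fin 2 → Fin 2 → H →L[ℂ] H := pauliUnit (P.X i) (P.Z i)

theorem unit_isMatrixUnits (i : ℕ) : IsMatrixUnits (P.unit i) :=
  pauliUnit_isMatrixUnits (P.star_X i) (P.star_Z i) (P.X_mul_X i) (P.Z_mul_Z i) (P.X_mul_Z i)

theorem unit_mem (i s : ℕ) (h : i < s) (a b : Fin 2) {f : H} (hf : f ∈ P.V s) :
    P.unit i a b f ∈ P.V s := by
  have h1 : ((1 / 2 : ℂ) • (1 + (if b = 0 then P.Z i else -P.Z i))) f ∈ P.V s := by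
    refine (P.V s).smul_mem _ ((P.V s).add_mem hf ?_)
    split_ifs
    · exact P.Z_mem i s h f hf
    · exact (P.V s).neg_mem (P.Z_mem i s h f hf)
  change (if a = b then 1 else P.X i) (((1 / 2 : ℂ) • (1 + (if b = 0 then P.Z i else -P.Z i))) f) ∈ _
  split_ifs at h1 ⊢
  all_goals first
  | exact h1
  | exact P.X_mem i s h _ h1

/-- Compressed to `V s`, the s-th tensor factor acts through its normalised trace: of the expansion
in 1, X, Z, XZ only the identity part survives. -/
theorem inner_unit (s : ℕ) (a b : Fin 2) {f g : H} (hf : f ∈ P.V s) (hg : g ∈ P.V s) :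
    inner ℂ f (P.unit s a b g) = if a = b then (1 / 2 : ℂ) * inner ℂ f g else 0 := by
  have hX := P.inner_X s f hf g hg
  have hZ := P.inner_Z s f hf g hg
  have hXZ := P.inner_XZ s f hf g hg
  fin_cases a <;> fin_cases b <;>
    simp [unit, pauliUnit, inner_smul_right, hX, hZ, hXZ]

theorem commute_unit_of_ne {i j : ℕ} (h : i ≠ j) (a b : Fin 2) :
    Commute (P.unit i a b) (P.X j) ∧ Commute (P.unit i a b) (P.Z j) :=
  ⟨(commute_pauliUnit (P.commute_XX j i) (P.commute_XZ j i h.symm) a b).symm,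
    (commute_pauliUnit (P.commute_XZ i j h).symm (P.commute_ZZ j i) a b).symm⟩

/-- The algebra generated by the Pauli operators with indices in `[s, s + l)` is the span of a
system of `2 ^ l × 2 ^ l` matrix units. -/
theorem exists_block (s l : ℕ) : ∃ F : Fin (2 ^ l) → Fin (2 ^ l) → H →L[ℂ] H,
    IsMatrixUnits F ∧
    (∀ T : H →L[ℂ] H, (∀ i, s ≤ i → i < s + l → Commute T (P.X i) ∧ Commute T (P.Z i)) →
      ∀ a b, Commute T (F a b)) ∧
    (∀ T : H →L[ℂ] H, (∀ a b, Commute T (F a b)) →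
      ∀ i, s ≤ i → i < s + l → Commute T (P.X i) ∧ Commute T (P.Z i)) ∧
    (∀ a b, ∀ f ∈ P.V s, ∀ g ∈ P.V s,
      inner ℂ f (F a b g) = if a = b then (1 / 2 : ℂ) ^ l * inner ℂ f g else 0) ∧
    (∀ t, s + l ≤ t → ∀ a b, ∀ f ∈ P.V t, F a b f ∈ P.V t) := by
  induction l with
  | zero =>
    have : Subsingleton (Fin (2 ^ 0)) := inferInstanceAs (Subsingleton (Fin 1))
    refine ⟨fun _ _ => 1, ⟨fun i j k l => ?_, fun _ _ => star_one _, ?_⟩,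
      fun T _ _ _ => Commute.one_right T, fun T _ i h1 h2 => absurd h2 (by omega), ?_,
      fun _ _ _ _ f hf => hf⟩
    · simp [Subsingleton.elim j k]
    · simp
    · intro a b f _ g _
      simp [Subsingleton.elim a b]
  | succ l ih =>
    obtain ⟨F, hF, hF1, hF2, hF3, hF4⟩ := ih
    let e : Fin (2 ^ (l + 1)) ≃ Fin (2 ^ l) × Fin 2 :=
      (finCongr (pow_succ 2 l)).trans finProdFinEquiv.symm
    have hc : ∀ a b c d, Commute (F a b) (P.unit (s + l) c d) := fun a b c d =>
      (hF1 _ (fun i _ h2 => P.commute_unit_of_ne (by omega) c d) a b).symm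
    have hU := P.unit_isMatrixUnits (s + l)
    refine ⟨fun p q => F (e p).1 (e q).1 * P.unit (s + l) (e p).2 (e q).2, hF.prod hU hc e,
      fun T hT p q => ?_, fun T hT => ?_, ?_, ?_⟩
    · refine Commute.mul_right (hF1 T (fun i h1 h2 => hT i h1 (by omega)) _ _) ?_
      have := hT (s + l) (by omega) (by omega)
      exact commute_pauliUnit this.1 this.2 _ _
    · have hT' : ∀ a b c d, Commute T (F a b * P.unit (s + l) c d) := fun a b c d => by
        simpa using hT (e.symm (a, c)) (e.symm (b, d))
      -- Each factor of the product system is recovered by summing over the diagonal units of the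
      -- other one.
      have hTF : ∀ a b, Commute T (F a b) := fun a b => by
        have : F a b = ∑ c, F a b * P.unit (s + l) c c := by
          rw [← Finset.mul_sum, hU.sum_eq, mul_one]
        rw [this]
        exact Commute.sum_right _ _ _ fun c _ => hT' a b c c
      have hTU : ∀ c d, Commute T (P.unit (s + l) c d) := fun c d => by
        have : P.unit (s + l) c d = ∑ a, F a a * P.unit (s + l) c d := by
          rw [← Finset.sum_mul, hF.sum_eq, one_mul]
        rw [this]
        exact Commute.sum_right _ _ _ fun a _ => hT' a a c d
      intro i h1 h2
      by_cases hi : i < s + l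
      · exact hF2 T hTF i h1 hi
      · obtain rfl : i = s + l := by omega
        exact commute_of_commute_pauliUnit hTU
    · intro p q f hf g hg
      beta_reduce
      rw [(hc _ _ _ _).eq, mul_apply_eq_comp, P.inner_unit (s + l) _ _
        (P.mono (Nat.le_add_right s l) hf) (hF4 _ le_rfl _ _ _ (P.mono (Nat.le_add_right s l) hg)),
        hF3 _ _ f hf g hg]
      by_cases hpq : p = q
      · simp [hpq, pow_succ]; ring
      · rw [if_neg hpq]
        by_cases h2 : (e p).2 = (e q).2
        · rw [if_pos h2, if_neg (fun h1 => hpq (e.injective (Prod.ext h1 h2))), mul_zero]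
        · rw [if_neg h2]
    · intro t ht p q f hf
      exact hF4 t (by omega) _ _ _ (P.unit_mem _ _ (by omega) _ _ hf)

end PauliSystem

-- Connecting maps of the tower.

attribute [instance] Tower.inst Tower.nontrivial Tower.separable

namespace Tower

variable {C : ∀ (B : Type u) [CStarAlgebra B], Prop} {E : Type u} [CStarAlgebra E] (T : Tower C E)

/-- The connecting maps of the tower. -/
noncomputable def step (m : ℕ) : T.A m →⋆ₐ[ℂ] T.A (m + 1) :=
  (T.iso m).symm.toStarAlgHom.comp (CStarMatrix.connect (T.rep m))

/-- The amplification `x ↦ x ⊗ 1`. -/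
noncomputable def amp (m : ℕ) : T.A m →⋆ₐ[ℂ] T.A (m + 1) :=
  (T.iso m).symm.toStarAlgHom.comp (CStarMatrix.amplify _ _)

/-- The scalar matrices. -/
noncomputable def scalar (m : ℕ) :
    CStarMatrix (Fin (2 ^ T.l m)) (Fin (2 ^ T.l m)) ℂ →⋆ₐ[ℂ] T.A (m + 1) :=
  (T.iso m).symm.toStarAlgHom.comp (CStarMatrix.ofScalar _ _)

theorem iso_step (m : ℕ) (x : T.A m) : T.iso m (T.step m x) = CStarMatrix.connect (T.rep m) x :=
  (T.iso m).apply_symm_apply _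

theorem iso_amp (m : ℕ) (x : T.A m) : T.iso m (T.amp m x) = CStarMatrix.amplify _ _ x :=
  (T.iso m).apply_symm_apply _

theorem iso_scalar (m : ℕ) (x) : T.iso m (T.scalar m x) = CStarMatrix.ofScalar _ _ x :=
  (T.iso m).apply_symm_apply _

theorem scalar_mul_step (m : ℕ) (x : T.A m) :
    T.scalar m (T.rep m 1) * T.step m x = T.scalar m (T.rep m x) := by
  exact (map_mul (T.iso m).symm _ _).symm.trans
    (congrArg (T.iso m).symm (CStarMatrix.ofScalar_mul_connect (T.rep m) x))

theorem step_mul_scalar (m : ℕ) (x : T.A m) :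
    T.step m x * T.scalar m (T.rep m 1) = T.scalar m (T.rep m x) := by
  exact (map_mul (T.iso m).symm _ _).symm.trans
    (congrArg (T.iso m).symm (CStarMatrix.connect_mul_ofScalar (T.rep m) x))

theorem step_mem (m k : ℕ) {x : T.A m} (hx : x ∈ T.G m k) : T.step m x ∈ T.G (m + 1) k :=
  T.connect_mem m k x hx

/-- The identity has normalised trace 1, above the allowed 4^{-(m+1)}; this is the hypothesis of
`CStarMatrix.connect_injective`. -/
theorem rep_one_ne_one (m : ℕ) : T.rep m 1 ≠ 1 := by
  intro h
  have h1 := T.trace_le m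
  rw [h] at h1
  have h2 : (1 / 4 : ℝ) ^ (m + 1) < 1 := pow_lt_one₀ (by norm_num) (by norm_num) (by omega)
  have h3 : (0 : ℝ) < 2 ^ T.l m := by positivity
  have h4 : (∑ i, (1 : CStarMatrix (Fin (2 ^ T.l m)) (Fin (2 ^ T.l m)) ℂ) i i).re = 2 ^ T.l m := by
    have : ∑ i, (1 : CStarMatrix (Fin (2 ^ T.l m)) (Fin (2 ^ T.l m)) ℂ) i i
        = ((2 ^ T.l m : ℝ) : ℂ) := by simp
    rw [this, Complex.ofReal_re]
  rw [h4] at h1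
  nlinarith

theorem step_injective (m : ℕ) : Function.Injective (T.step m) :=
  (T.iso m).symm.injective.comp (CStarMatrix.connect_injective (T.rep m) (T.rep_one_ne_one m))

theorem amp_injective (m : ℕ) : Function.Injective (T.amp m) := by
  refine (T.iso m).symm.injective.comp fun x y h => ?_
  have := congrArg (fun M : CStarMatrix (Fin (2 ^ T.l m)) (Fin (2 ^ T.l m)) (T.A m) => M 0 0) h
  simpa [CStarMatrix.amplify_apply] using this

/-- The number of Pauli pairs used up by the first `m` stages. -/
def offset (m : ℕ) : ℕ := ∑ j ∈ Finset.range m, T.l j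

theorem offset_succ (m : ℕ) : T.offset (m + 1) = T.offset m + T.l m := Finset.sum_range_succ _ _

/-- Positivity of the `l m` makes the blocks exhaust all Pauli indices, and places every vector of
the dense union in `V (T.offset m)` for large m. -/
theorem le_offset (m : ℕ) : m ≤ T.offset m := by
  induction m with
  | zero => simp
  | succ m ih => rw [offset_succ]; have := T.l_pos m; omega

end Tower

/-! ### Representations of the tower on a Pauli system. -/

/-- A Pauli system together with a commuting representation of a C⋆-algebra. -/
structure PauliRep (E : Type u) [CStarAlgebra E] (H : Type*) [NormedAddCommGroup H]
    [InnerProductSpace ℂ H] [CompleteSpace H] extends PauliSystem H where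
  π : E →⋆ₐ[ℂ] (H →L[ℂ] H)
  commute_X : ∀ x i, Commute (π x) (X i)
  commute_Z : ∀ x i, Commute (π x) (Z i)
  π_mem : ∀ x s, ∀ f ∈ V s, π x f ∈ V s

namespace PauliRep

variable {C : ∀ (B : Type u) [CStarAlgebra B], Prop} {E : Type u} [CStarAlgebra E]
  {H : Type*} [NormedAddCommGroup H] [InnerProductSpace ℂ H] [CompleteSpace H]
  (P : PauliRep E H) (T : Tower C E)

/-- The matrix units used at stage `m`. -/
noncomputable def block (m : ℕ) : Fin (2 ^ T.l m) → Fin (2 ^ T.l m) → H →L[ℂ] H :=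
  (P.exists_block (T.offset m) (T.l m)).choose

theorem block_isMatrixUnits (m : ℕ) : IsMatrixUnits (P.block T m) :=
  (P.exists_block (T.offset m) (T.l m)).choose_spec.1

theorem commute_block (m : ℕ) (S : H →L[ℂ] H)
    (hS : ∀ i, T.offset m ≤ i → i < T.offset (m + 1) → Commute S (P.X i) ∧ Commute S (P.Z i)) :
    ∀ a b, Commute S (P.block T m a b) :=
  (P.exists_block (T.offset m) (T.l m)).choose_spec.2.1 S (by rwa [T.offset_succ] at hS)

theorem commute_of_commute_block (m : ℕ) (S : H →L[ℂ] H)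
    (hS : ∀ a b, Commute S (P.block T m a b)) (i : ℕ) (h1 : T.offset m ≤ i)
    (h2 : i < T.offset (m + 1)) : Commute S (P.X i) ∧ Commute S (P.Z i) :=
  (P.exists_block (T.offset m) (T.l m)).choose_spec.2.2.1 S hS i h1 (by rwa [T.offset_succ] at h2)

theorem inner_block (m : ℕ) (a b) {f g : H} (hf : f ∈ P.V (T.offset m)) (hg : g ∈ P.V (T.offset m)) :
    inner ℂ f (P.block T m a b g) = if a = b then (1 / 2 : ℂ) ^ T.l m * inner ℂ f g else 0 :=
  (P.exists_block (T.offset m) (T.l m)).choose_spec.2.2.2.1 a b f hf g hg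

/-- The representations of the stages of the tower, together with the fact that they commute with
the unused Pauli operators. -/
noncomputable def stageAux : ∀ m, {ψ : T.A m →⋆ₐ[ℂ] (H →L[ℂ] H) //
    ∀ x i, T.offset m ≤ i → Commute (ψ x) (P.X i) ∧ Commute (ψ x) (P.Z i)}
  | 0 => ⟨P.π.comp T.base.symm.toStarAlgHom, fun _ _ _ => ⟨P.commute_X _ _, P.commute_Z _ _⟩⟩
  | m + 1 =>
    let ψ := stageAux m
    have hc : ∀ a b x, Commute (ψ.1 x) (P.block T m a b) := fun a b x =>
      P.commute_block T m (ψ.1 x) (fun i h1 _ => ψ.2 x i h1) a b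
    ⟨((P.block_isMatrixUnits T m).lift ψ.1 hc).comp (T.iso m).toStarAlgHom, fun x i hi => by
      have hle : T.offset m ≤ i := by rw [T.offset_succ] at hi; omega
      have h1 : ∀ a b, Commute (P.block T m a b) (P.X i) := fun a b =>
        (P.commute_block T m (P.X i) (fun j _ hj =>
          ⟨P.commute_XX i j, P.commute_XZ i j (by omega)⟩) a b).symm
      have h2 : ∀ a b, Commute (P.block T m a b) (P.Z i) := fun a b =>
        (P.commute_block T m (P.Z i) (fun j _ hj =>
          ⟨(P.commute_XZ j i (by omega)).symm, P.commute_ZZ i j⟩) a b).symm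
      constructor
      · exact Commute.sum_left _ _ _ fun a _ => Commute.sum_left _ _ _ fun b _ =>
          (ψ.2 _ i hle).1.mul_left (h1 a b)
      · exact Commute.sum_left _ _ _ fun a _ => Commute.sum_left _ _ _ fun b _ =>
          (ψ.2 _ i hle).2.mul_left (h2 a b)⟩

/-- The representation of the `m`-th stage of the tower. -/
noncomputable def stage (m : ℕ) : T.A m →⋆ₐ[ℂ] (H →L[ℂ] H) := (P.stageAux T m).1

theorem stage_commute_block (m : ℕ) (a b) (x : T.A m) :
    Commute (P.stage T m x) (P.block T m a b) :=
  P.commute_block T m _ (fun i h1 _ => (P.stageAux T m).2 x i h1) a b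

theorem stage_zero (x : E) : P.stage T 0 (T.base x) = P.π x :=
  congrArg P.π (T.base.symm_apply_apply x)

theorem stage_succ (m : ℕ) (y : T.A (m + 1)) : P.stage T (m + 1) y =
    (P.block_isMatrixUnits T m).lift (P.stage T m) (P.stage_commute_block T m) (T.iso m y) := rfl

theorem stage_succ_apply (m : ℕ) (y : T.A (m + 1)) : P.stage T (m + 1) y =
    ∑ a, ∑ b, P.stage T m (T.iso m y a b) * P.block T m a b := rfl

theorem stage_amp (m : ℕ) (x : T.A m) : P.stage T (m + 1) (T.amp m x) = P.stage T m x := by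
  rw [stage_succ, T.iso_amp, IsMatrixUnits.lift_amplify]

theorem stage_scalar (m : ℕ) (M) :
    P.stage T (m + 1) (T.scalar m M) = ∑ a, ∑ b, M a b • P.block T m a b := by
  rw [stage_succ, T.iso_scalar, IsMatrixUnits.lift_ofScalar]

/-- The defect of compatibility, with the small projection `proj` as its right factor. -/
theorem stage_step_sub (m : ℕ) (x : T.A m) :
    P.stage T (m + 1) (T.step m x) - P.stage T m x =
      (P.stage T (m + 1) (T.scalar m (T.rep m x)) - P.stage T m x) *
        P.stage T (m + 1) (T.scalar m (T.rep m 1)) := by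
  simp only [stage_succ, T.iso_scalar, T.iso_step]
  exact IsMatrixUnits.lift_connect_sub _ _ _ _ _

theorem stage_mem (m : ℕ) (x : T.A m) {f : H} (hf : f ∈ P.V (T.offset m)) :
    P.stage T m x f ∈ P.V (T.offset m) := by
  -- Stage m + 1 is built from operators of stage m acting on the larger space `V (T.offset (m +
  -- 1))`, so the induction needs invariance of all later subspaces.
  suffices h : ∀ m (x : T.A m) t, T.offset m ≤ t → ∀ f ∈ P.V t, P.stage T m x f ∈ P.V t from
    h m x _ le_rfl f hf
  clear hf f x m
  intro m
  induction m with
  | zero => exact fun x t _ f hf => P.π_mem _ _ f hf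
  | succ m ih =>
    intro x t ht f hf
    rw [stage_succ_apply]
    simp only [_root_.sum_apply]
    refine Submodule.sum_mem _ fun a _ => Submodule.sum_mem _ fun b _ => ?_
    rw [T.offset_succ] at ht
    exact ih _ t (by omega) _
      ((P.exists_block (T.offset m) (T.l m)).choose_spec.2.2.2.2 _ ht a b f hf)

/-- On vectors of the earlier factors the new matrix units contribute only the normalised trace: the
functional is tr ⊗ (functional of stage m). -/
theorem inner_stage_succ (m : ℕ) (y : T.A (m + 1)) {f g : H} (hf : f ∈ P.V (T.offset m))
    (hg : g ∈ P.V (T.offset m)) : inner ℂ f (P.stage T (m + 1) y g) =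
      (1 / 2 : ℂ) ^ T.l m * ∑ a, inner ℂ f (P.stage T m (T.iso m y a a) g) := by
  rw [stage_succ_apply]
  simp only [_root_.sum_apply, inner_sum, Finset.mul_sum]
  refine Finset.sum_congr rfl fun a _ => ?_
  rw [Finset.sum_eq_single a]
  · rw [(P.stage_commute_block T m a a _).eq, mul_apply_eq_comp,
      P.inner_block T m a a hf (P.stage_mem T m _ hg), if_pos rfl]
  · intro b _ hb
    rw [(P.stage_commute_block T m a b _).eq, mul_apply_eq_comp,
      P.inner_block T m a b hf (P.stage_mem T m _ hg), if_neg hb.symm]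
  · simp

/-- The range projection of the finite dimensional part of the connecting map. -/
noncomputable def proj (m : ℕ) : H →L[ℂ] H := P.stage T (m + 1) (T.scalar m (T.rep m 1))

/-- For a projection p, ‖p f‖² = ⟨f, p f⟩, which here is the normalised trace of `T.rep m 1` times
‖f‖², hence at most 4^{-(m+1)}‖f‖². -/
theorem norm_proj_apply_le (m : ℕ) {f : H} (hf : f ∈ P.V (T.offset m)) :
    ‖P.proj T m f‖ ≤ (1 / 2) ^ (m + 1) * ‖f‖ := by
  have hsa : star (P.proj T m) = P.proj T m := by
    rw [proj, ← map_star, ← map_star, ← map_star, star_one]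
  have hid : P.proj T m * P.proj T m = P.proj T m := by
    rw [proj, ← map_mul, ← map_mul, ← map_mul, one_mul]
  have h1 : inner ℂ (P.proj T m f) (P.proj T m f) = inner ℂ f (P.proj T m f) := by
    conv_lhs => rw [← ContinuousLinearMap.adjoint_inner_right, ← ContinuousLinearMap.star_eq_adjoint,
      hsa, ← mul_apply_eq_comp, hid]
  have h2 : inner ℂ f (P.proj T m f) =
      (∑ a, T.rep m 1 a a) * (1 / 2 : ℂ) ^ T.l m * inner ℂ f f := by
    rw [proj, stage_scalar]
    simp only [_root_.sum_apply, inner_sum, Finset.sum_mul]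
    refine Finset.sum_congr rfl fun a _ => ?_
    rw [Finset.sum_eq_single a]
    · rw [_root_.smul_apply, inner_smul_right, P.inner_block T m a a hf hf, if_pos rfl]
      ring
    · intro b _ hb
      rw [_root_.smul_apply, inner_smul_right, P.inner_block T m a b hf hf,
        if_neg hb.symm, mul_zero]
    · simp
  have h3 : ‖P.proj T m f‖ ^ 2 = (∑ a, T.rep m 1 a a).re * (1 / 2 : ℝ) ^ T.l m * ‖f‖ ^ 2 := by
    have h4 := h1.trans h2
    rw [inner_self_eq_norm_sq_to_K, inner_self_eq_norm_sq_to_K] at h4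
    have h5 := congrArg Complex.re h4
    have e1 : ((1 / 2 : ℂ) ^ T.l m * ((‖f‖ : ℂ)) ^ 2) = (((1 / 2 : ℝ) ^ T.l m * ‖f‖ ^ 2 : ℝ) : ℂ) := by
      push_cast; ring
    have e2 : ((‖P.proj T m f‖ : ℂ)) ^ 2 = ((‖P.proj T m f‖ ^ 2 : ℝ) : ℂ) := by push_cast; ring
    simp only [Complex.coe_algebraMap] at h5
    rw [mul_assoc, e1, e2, Complex.ofReal_re, Complex.re_mul_ofReal] at h5
    rw [h5]; ring
  have h4 : ‖P.proj T m f‖ ^ 2 ≤ ((1 / 2) ^ (m + 1) * ‖f‖) ^ 2 := by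
    rw [h3, mul_pow, ← pow_mul, mul_comm (m + 1) 2, pow_mul]
    refine mul_le_mul_of_nonneg_right ?_ (by positivity)
    have := mul_le_mul_of_nonneg_right (T.trace_le m) (by positivity : (0 : ℝ) ≤ (1 / 2) ^ T.l m)
    refine this.trans (le_of_eq ?_)
    rw [mul_assoc, ← mul_pow]
    norm_num
  exact le_of_sq_le_sq h4 (by positivity)

/-- The representations of the stages are asymptotically compatible with the connecting maps. -/
noncomputable def asymptoticRep : AsymptoticRep T.step H where
  ψ := P.stage T
  w f m := 2 * ‖P.proj T m f‖
  w_nonneg f m := by positivity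
  D := ⋃ s, (P.V s : Set H)
  dense := P.dense
  summable f hf := by
    obtain ⟨s, hs⟩ := Set.mem_iUnion.1 hf
    -- The first s terms are discarded: from there on f lies in `V (T.offset m)` and the geometric
    -- bound applies.
    rw [← summable_nat_add_iff s]
    refine Summable.of_nonneg_of_le (fun m => by positivity) (fun m => ?_)
      ((summable_geometric_two.mul_right (‖f‖)))
    have h : f ∈ P.V (T.offset (m + s)) := P.mono ((Nat.le_add_left s m).trans (T.le_offset _)) hs
    refine (mul_le_mul_of_nonneg_left (P.norm_proj_apply_le T (m + s) h) two_pos.le).trans ?_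
    have h2 : (1 / 2 : ℝ) ^ (m + s) ≤ (1 / 2) ^ m :=
      pow_le_pow_of_le_one (by norm_num) (by norm_num) (Nat.le_add_right m s)
    rw [pow_succ]
    nlinarith [norm_nonneg f]
  step_le m x f := by
    have h := congrArg (fun S : H →L[ℂ] H => S f) (P.stage_step_sub T m x)
    simp only [_root_.sub_apply, mul_apply_eq_comp] at h
    rw [h]
    have h1 : ‖P.stage T (m + 1) (T.scalar m (T.rep m x))‖ ≤ ‖x‖ :=
      NonUnitalStarAlgHom.norm_apply_le
        (((P.stage T (m + 1)).comp (T.scalar m)).toNonUnitalStarAlgHom.comp (T.rep m)) x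
    have h2 : ‖P.stage T m x‖ ≤ ‖x‖ := NonUnitalStarAlgHom.norm_apply_le (P.stage T m) x
    refine (norm_sub_le _ _).trans ?_
    have h3 := (P.stage T (m + 1) (T.scalar m (T.rep m x))).le_of_opNorm_le h1 (P.proj T m f)
    have h4 := (P.stage T m x).le_of_opNorm_le h2 (P.proj T m f)
    refine (add_le_add h3 h4).trans (le_of_eq ?_)
    ring

theorem commute_stage {S : H →L[ℂ] H} (hX : ∀ i, Commute S (P.X i)) (hZ : ∀ i, Commute S (P.Z i))
    (hπ : ∀ x, Commute S (P.π x)) (m : ℕ) (x : T.A m) : Commute S (P.stage T m x) := by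
  induction m with
  | zero => exact hπ _
  | succ m ih =>
    rw [stage_succ_apply]
    exact Commute.sum_right _ _ _ fun a _ => Commute.sum_right _ _ _ fun b _ =>
      (ih _).mul_right (P.commute_block T m S (fun i _ _ => ⟨hX i, hZ i⟩) a b)

/-- The block units are images of scalar matrix units, and every Pauli index lies in some block; the
base of the tower gives `P.π`. -/
theorem commute_of_commute_stage {S : H →L[ℂ] H} (h : ∀ m x, Commute S (P.stage T m x)) :
    (∀ i, Commute S (P.X i) ∧ Commute S (P.Z i)) ∧ ∀ x, Commute S (P.π x) := by
  refine ⟨fun i => ?_, fun x => by rw [← P.stage_zero T]; exact h 0 _⟩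
  have hblock : ∀ m a b, Commute S (P.block T m a b) := fun m a b => by
    have e : ∀ M : CStarMatrix (Fin (2 ^ T.l m)) (Fin (2 ^ T.l m)) ℂ,
        (∀ c d, M c d = if a = c ∧ b = d then 1 else 0) →
        P.stage T (m + 1) (T.scalar m M) = P.block T m a b := by
      intro M hM
      rw [stage_scalar, Finset.sum_eq_single a, Finset.sum_eq_single b]
      · simp [hM]
      · intro d _ hd; simp [hM, hd.symm]
      · simp
      · intro c _ hc; simp [hM, hc.symm]
      · simp
    rw [← e (CStarMatrix.ofMatrix fun c d => if a = c ∧ b = d then 1 else 0) fun c d => rfl]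
    exact h _ _
  have key : ∀ m i, i < T.offset m → Commute S (P.X i) ∧ Commute S (P.Z i) := by
    intro m
    induction m with
    | zero => intro i hi; simp [Tower.offset] at hi
    | succ m ih =>
      intro i hi
      by_cases h1 : i < T.offset m
      · exact ih i h1
      · exact P.commute_of_commute_block T m S (hblock m) i (not_lt.1 h1) hi
  exact key (i + 1) i (T.le_offset (i + 1))

/-- Each family consists of strong limits of elements of the other: limits of stages along `T.step`,
and stages as limits along the amplifications `T.amp`. A commutant is stable under strong limits. -/
theorem commute_limit_iff {S : H →L[ℂ] H} :
    (∀ m x, Commute S ((P.asymptoticRep T).limit m x)) ↔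
      (∀ i, Commute S (P.X i) ∧ Commute S (P.Z i)) ∧ ∀ x, Commute S (P.π x) := by
  have lim : ∀ {u : ℕ → H →L[ℂ] H} {t : H →L[ℂ] H},
      (∀ f, Tendsto (fun k => u k f) atTop (𝓝 (t f))) → (∀ k, Commute S (u k)) → Commute S t := by
    intro u t hu hc
    ext f
    have h1 : Tendsto (fun k => S (u k f)) atTop (𝓝 (S (t f))) :=
      (S.continuous.tendsto _).comp (hu f)
    refine tendsto_nhds_unique h1 ((hu (S f)).congr fun k => ?_)
    exact congrArg (fun W : H →L[ℂ] H => W f) (hc k).eq.symm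
  constructor
  · intro h
    refine P.commute_of_commute_stage T fun m x => ?_
    exact lim ((P.asymptoticRep T).tendsto_limit_iterHom (d := T.amp) (P.stage_amp T) m x)
      fun k => h _ _
  · rintro ⟨h1, h2⟩ m x
    exact lim ((P.asymptoticRep T).tendsto_limit m x) fun k =>
      P.commute_stage T (fun i => (h1 i).1) (fun i => (h1 i).2) h2 _ _

/-- A vector which is cyclic for the Pauli operators and the representation is cyclic for the limit
representations. -/
theorem dense_limit_apply {Ω : H} (hΩ : ∀ L : Submodule ℂ H, IsClosed (L : Set H) → Ω ∈ L →
      (∀ i, ∀ f ∈ L, P.X i f ∈ L ∧ P.Z i f ∈ L) → (∀ x, ∀ f ∈ L, P.π x f ∈ L) → L = ⊤) :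
    Dense {f | ∃ m x, f = (P.asymptoticRep T).limit m x Ω} := by
  set R := P.asymptoticRep T with hR
  let K₀ : Submodule ℂ H :=
    { carrier := {f | ∃ m x, f = R.limit m x Ω}
      zero_mem' := ⟨0, 0, by simp⟩
      add_mem' := by
        rintro _ _ ⟨m, x, rfl⟩ ⟨n, y, rfl⟩
        refine ⟨max m n, iterHom T.step (le_max_left m n) x + iterHom T.step (le_max_right m n) y, ?_⟩
        rw [map_add, R.limit_iterHom, R.limit_iterHom]; rfl
      smul_mem' := by
        rintro c _ ⟨m, x, rfl⟩
        exact ⟨m, c • x, by rw [map_smul]; rfl⟩ }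
  have hinv : ∀ n y, ∀ f ∈ K₀.topologicalClosure, R.limit n y f ∈ K₀.topologicalClosure := by
    intro n y f hf
    refine map_mem_closure (R.limit n y).continuous hf ?_
    rintro _ ⟨m, x, rfl⟩
    refine ⟨max n m, iterHom T.step (le_max_left n m) y * iterHom T.step (le_max_right n m) x, ?_⟩
    rw [map_mul, R.limit_iterHom, R.limit_iterHom]; rfl
  set K := K₀.topologicalClosure with hK
  have hcl : IsClosed (K : Set H) := K₀.isClosed_topologicalClosure
  have : CompleteSpace K := hcl.completeSpace_coe
  -- The orthogonal projection onto an invariant subspace of a star closed family commutes with it.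
  -- Through `commute_limit_iff` it then commutes with the Pauli operators and `P.π`, for which Ω is
  -- cyclic.
  have hcomm : ∀ n y, Commute K.starProjection (R.limit n y) := by
    have h1 : ∀ n y, K.starProjection * R.limit n y * K.starProjection
        = R.limit n y * K.starProjection := fun n y => by
      ext f
      exact Submodule.starProjection_eq_self_iff.2
        (hinv n y _ (Submodule.starProjection_apply_mem _ f))
    have hs : star K.starProjection = K.starProjection := isSelfAdjoint_starProjection K
    intro n y
    have h2 := congrArg star (h1 n (star y))
    rw [map_star, star_mul, star_mul, star_mul, star_star, hs, ← mul_assoc, h1] at h2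
    exact h2.symm
  have h2 := (P.commute_limit_iff T).1 hcomm
  have hmem : ∀ W : H →L[ℂ] H, Commute K.starProjection W → ∀ f ∈ K, W f ∈ K := by
    intro W hW f hf
    have := congrArg (fun W : H →L[ℂ] H => W f) hW.eq
    simp only [mul_apply_eq_comp] at this
    rw [Submodule.starProjection_eq_self_iff.2 hf] at this
    rw [← this]
    exact Submodule.starProjection_apply_mem _ _
  have htop := hΩ K hcl (subset_closure ⟨0, 1, by simp⟩)
    (fun i f hf => ⟨hmem _ (h2.1 i).1 f hf, hmem _ (h2.1 i).2 f hf⟩)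
    (fun x f hf => hmem _ (h2.2 x) f hf)
  have : Dense (K₀ : Set H) := by
    rw [dense_iff_closure_eq, ← Submodule.topologicalClosure_coe, ← hK, htop]; rfl
  exact this

/-- The vector state of a trace vector in `V 0` restricts to a trace on every stage. -/
theorem inner_stage_mul_comm {Ω : H} (h0 : Ω ∈ P.V 0)
    (hΩ : ∀ x y, inner ℂ Ω (P.π (x * y) Ω) = inner ℂ Ω (P.π (y * x) Ω)) (m : ℕ) (x y : T.A m) :
    inner ℂ Ω (P.stage T m (x * y) Ω) = inner ℂ Ω (P.stage T m (y * x) Ω) := by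
  have hV : ∀ m, Ω ∈ P.V (T.offset m) := fun m => P.mono (Nat.zero_le _) h0
  induction m with
  | zero =>
    have := hΩ (T.base.symm x) (T.base.symm y)
    rwa [← map_mul, ← map_mul] at this
  | succ m ih =>
    rw [P.inner_stage_succ T m _ (hV m) (hV m), P.inner_stage_succ T m _ (hV m) (hV m), map_mul,
      map_mul]
    simp only [CStarMatrix.mul_apply, map_sum, _root_.sum_apply, inner_sum]
    -- The trace identity for matrices: the two indices are interchanged, then the identity of stage
    -- m is used entrywise.
    rw [Finset.sum_comm]
    simp only [ih]

theorem inner_limit_mul_comm {Ω : H} (h0 : Ω ∈ P.V 0)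
    (hΩ : ∀ x y, inner ℂ Ω (P.π (x * y) Ω) = inner ℂ Ω (P.π (y * x) Ω)) (m : ℕ) (x y : T.A m) :
    inner ℂ Ω ((P.asymptoticRep T).limit m (x * y) Ω) =
      inner ℂ Ω ((P.asymptoticRep T).limit m (y * x) Ω) := by
  have h : ∀ z, Tendsto (fun k => inner ℂ Ω ((P.asymptoticRep T).approx m k z Ω)) atTop
      (𝓝 (inner ℂ Ω ((P.asymptoticRep T).limit m z Ω))) := fun z =>
    tendsto_const_nhds.inner ((P.asymptoticRep T).tendsto_limit m z Ω)
  refine tendsto_nhds_unique (h (x * y)) ((h (y * x)).congr fun k => ?_)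
  have := P.inner_stage_mul_comm T h0 hΩ (m + k) (iterHom T.step (Nat.le_add_right m k) y)
    (iterHom T.step (Nat.le_add_right m k) x)
  rwa [← map_mul, ← map_mul] at this

/-- Since Ω lies in `V 0`, the geometric estimate for the defects holds from the very first stage,
which makes the bound explicit. -/
theorem norm_limit_apply_sub_le {Ω : H} (h0 : Ω ∈ P.V 0) (m : ℕ) (x : T.A m) :
    ‖(P.asymptoticRep T).limit m x Ω - P.stage T m x Ω‖ ≤ ‖x‖ * (2 * (1 / 2) ^ m * ‖Ω‖) := by
  refine ((P.asymptoticRep T).norm_limit_sub_le m x (Set.mem_iUnion.2 ⟨0, h0⟩)).trans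
    (mul_le_mul_of_nonneg_left ?_ (norm_nonneg _))
  have hle : ∀ k, (P.asymptoticRep T).w Ω (k + m) ≤ (1 / 2) ^ k * ((1 / 2) ^ m * ‖Ω‖) := fun k => by
    have := P.norm_proj_apply_le T (k + m) (P.mono (Nat.zero_le _) h0)
    change 2 * ‖P.proj T (k + m) Ω‖ ≤ _
    rw [pow_succ, pow_add] at this
    linarith
  have hs := (summable_geometric_two.mul_right ((1 / 2) ^ m * ‖Ω‖))
  refine (Summable.tsum_le_tsum hle ?_ hs).trans (le_of_eq ?_)
  · exact Summable.of_nonneg_of_le (fun k => (P.asymptoticRep T).w_nonneg _ _) hle hs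
  · rw [tsum_mul_right, tsum_geometric_two]; ring

end PauliRep

/-! ### Operators on Hilbert space tensor products. -/

section OperatorTensor

variable {H : Type u} [NormedAddCommGroup H] [InnerProductSpace ℂ H] [CompleteSpace H]
variable {K : Type v} [NormedAddCommGroup K] [InnerProductSpace ℂ K] [CompleteSpace K]

/-- The elementary tensor `ξ ⊗ η` in the Hilbert space tensor product. -/
noncomputable def hilbertTmul (ξ : H) (η : K) : HilbertTensor H K := ((ξ ⊗ₜ[ℂ] η : H ⊗[ℂ] K) : HilbertTensor H K)

theorem operatorTensor_tmul (x : H →L[ℂ] H) (y : K →L[ℂ] K) (ξ : H) (η : K) :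
    operatorTensor x y (hilbertTmul ξ η) = hilbertTmul (x ξ) (y η) := by
  simp [operatorTensor, hilbertTmul]

theorem inner_hilbertTmul (ξ ξ' : H) (η η' : K) :
    inner ℂ (hilbertTmul ξ η) (hilbertTmul ξ' η') = inner ℂ ξ ξ' * inner ℂ η η' := by
  simp [hilbertTmul]

/-- `hilbertTmul` as a continuous bilinear map. -/
noncomputable def hilbertTmulL (H : Type u) [NormedAddCommGroup H] [InnerProductSpace ℂ H]
    (K : Type v) [NormedAddCommGroup K] [InnerProductSpace ℂ K] :
    H →L[ℂ] K →L[ℂ] HilbertTensor H K :=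
  (ContinuousLinearMap.compL ℂ K (H ⊗[ℂ] K) (HilbertTensor H K)
    (UniformSpace.Completion.toComplL)).comp (TensorProduct.mkL ℂ H K)

theorem closed_submodule_eq_top_of_tmul_mem (L : Submodule ℂ (HilbertTensor H K))
    (hL : IsClosed (L : Set (HilbertTensor H K))) (h : ∀ ξ η, hilbertTmul ξ η ∈ L) : L = ⊤ := by
  rw [eq_top_iff]
  intro z _
  have hc : ∀ t : H ⊗[ℂ] K, (t : HilbertTensor H K) ∈ L := by
    intro t
    induction t with
    | zero => rw [UniformSpace.Completion.coe_zero]; exact L.zero_mem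
    | tmul ξ η => exact h ξ η
    | add a b ha hb => rw [UniformSpace.Completion.coe_add]; exact L.add_mem ha hb
  exact UniformSpace.Completion.induction_on z hL hc

theorem hilbertTensor_hom_ext {F : Type*} [NormedAddCommGroup F] [NormedSpace ℂ F]
    {S T : HilbertTensor H K →L[ℂ] F}
    (h : ∀ ξ η, S (hilbertTmul ξ η) = T (hilbertTmul ξ η)) : S = T := by
  let M : Submodule ℂ (HilbertTensor H K) :=
    LinearMap.eqLocus S.toLinearMap T.toLinearMap
  have hM : M = ⊤ :=
    closed_submodule_eq_top_of_tmul_mem M (isClosed_eq S.continuous T.continuous) h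
  ext z
  have hz : z ∈ M := hM ▸ Submodule.mem_top
  exact hz

theorem operatorTensor_mul (x x' : H →L[ℂ] H) (y y' : K →L[ℂ] K) :
    operatorTensor x y * operatorTensor x' y' = operatorTensor (x * x') (y * y') := by
  refine hilbertTensor_hom_ext fun ξ η => ?_
  rw [mul_apply_eq_comp, operatorTensor_tmul, operatorTensor_tmul, operatorTensor_tmul]; rfl

theorem operatorTensor_one : operatorTensor (1 : H →L[ℂ] H) (1 : K →L[ℂ] K) = 1 :=
  hilbertTensor_hom_ext fun ξ η => by rw [operatorTensor_tmul]; rfl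

theorem star_operatorTensor (x : H →L[ℂ] H) (y : K →L[ℂ] K) :
    star (operatorTensor x y) = operatorTensor (star x) (star y) := by
  refine hilbertTensor_hom_ext fun ξ η => ext_inner_left ℂ fun z => ?_
  rw [ContinuousLinearMap.star_eq_adjoint, ContinuousLinearMap.adjoint_inner_right,
    operatorTensor_tmul]
  have h : innerSL ℂ (hilbertTmul ξ η) ∘L operatorTensor x y
      = innerSL ℂ (hilbertTmul (star x ξ) (star y η)) := by
    refine hilbertTensor_hom_ext fun ξ' η' => ?_
    simp only [ContinuousLinearMap.comp_apply, innerSL_apply_apply, operatorTensor_tmul,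
      inner_hilbertTmul, ContinuousLinearMap.star_eq_adjoint,
      ContinuousLinearMap.adjoint_inner_left]
  have h2 := congrArg (fun S : HilbertTensor H K →L[ℂ] ℂ => S z) h
  simp only [ContinuousLinearMap.comp_apply, innerSL_apply_apply] at h2
  rw [← inner_conj_symm, h2, inner_conj_symm]

theorem operatorTensor_add_right (x : H →L[ℂ] H) (y y' : K →L[ℂ] K) :
    operatorTensor x (y + y') = operatorTensor x y + operatorTensor x y' := by
  refine hilbertTensor_hom_ext fun ξ η => ?_
  rw [_root_.add_apply, operatorTensor_tmul, operatorTensor_tmul, operatorTensor_tmul]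
  exact map_add (hilbertTmulL H K (x ξ)) (y η) (y' η)

theorem operatorTensor_smul_right (c : ℂ) (x : H →L[ℂ] H) (y : K →L[ℂ] K) :
    operatorTensor x (c • y) = c • operatorTensor x y := by
  refine hilbertTensor_hom_ext fun ξ η => ?_
  rw [_root_.smul_apply, operatorTensor_tmul, operatorTensor_tmul]
  exact map_smul (hilbertTmulL H K (x ξ)) c (y η)

variable (H) in
/-- The representation `y ↦ 1 ⊗ y`. -/
noncomputable def oneTensor : (K →L[ℂ] K) →⋆ₐ[ℂ] (HilbertTensor H K →L[ℂ] HilbertTensor H K) where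
  toFun y := operatorTensor 1 y
  map_one' := operatorTensor_one
  map_mul' y y' := by rw [operatorTensor_mul, one_mul]
  map_zero' := by simpa using operatorTensor_smul_right (0 : ℂ) (1 : H →L[ℂ] H) (0 : K →L[ℂ] K)
  map_add' := operatorTensor_add_right 1
  commutes' r := by
    rw [Algebra.algebraMap_eq_smul_one, Algebra.algebraMap_eq_smul_one, operatorTensor_smul_right,
      operatorTensor_one]
  map_star' y := by rw [star_operatorTensor, star_one]

theorem operatorTensor_neg_left (x : H →L[ℂ] H) (y : K →L[ℂ] K) :
    operatorTensor (-x) y = -operatorTensor x y := by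
  refine hilbertTensor_hom_ext fun ξ η => ?_
  rw [_root_.neg_apply, operatorTensor_tmul, operatorTensor_tmul]
  exact map_neg ((hilbertTmulL H K).flip (y η)) (x ξ)

end OperatorTensor

section

variable {H : Type u} [NormedAddCommGroup H] [InnerProductSpace ℂ H] [CompleteSpace H]
  {K : Type v} [NormedAddCommGroup K] [InnerProductSpace ℂ K] [CompleteSpace K]

/-- The subspace of the tensor product spanned by the `ξ ⊗ η` with `ξ ∈ V`. -/
noncomputable def tensorSubspace (V : Submodule ℂ H) (K : Type v) [NormedAddCommGroup K]
    [InnerProductSpace ℂ K] : Submodule ℂ (HilbertTensor H K) :=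
  Submodule.span ℂ {z | ∃ ξ ∈ V, ∃ η : K, z = ((ξ ⊗ₜ[ℂ] η : H ⊗[ℂ] K) : HilbertTensor H K)}

theorem tensorSubspace_invariant {V V' : Submodule ℂ H} {x : H →L[ℂ] H} (hx : ∀ ξ ∈ V, x ξ ∈ V')
    (y : K →L[ℂ] K) {z : HilbertTensor H K} (hz : z ∈ tensorSubspace V K) :
    operatorTensor x y z ∈ tensorSubspace V' K := by
  have : tensorSubspace V K ≤ (tensorSubspace V' K).comap
      (operatorTensor x y : HilbertTensor H K →ₗ[ℂ] HilbertTensor H K) := by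
    refine Submodule.span_le.2 ?_
    rintro _ ⟨ξ, hξ, η, rfl⟩
    exact Submodule.subset_span ⟨x ξ, hx ξ hξ, y η, operatorTensor_tmul x y ξ η⟩
  exact this hz

theorem inner_tensorSubspace_eq_zero {V : Submodule ℂ H} {x : H →L[ℂ] H}
    (hx : ∀ ξ ∈ V, ∀ ξ' ∈ V, inner ℂ ξ (x ξ') = 0) {z w : HilbertTensor H K}
    (hz : z ∈ tensorSubspace V K) (hw : w ∈ tensorSubspace V K) :
    inner ℂ z (operatorTensor x 1 w) = 0 := by
  induction hz using Submodule.span_induction with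
  | zero => exact inner_zero_left _
  | add a b _ _ ha hb => rw [inner_add_left, ha, hb, add_zero]
  | smul c a _ ha => rw [inner_smul_left, ha, mul_zero]
  | mem a ha =>
    obtain ⟨ξ, hξ, η, rfl⟩ := ha
    induction hw using Submodule.span_induction with
    | zero => rw [map_zero]; exact inner_zero_right _
    | add a b _ _ ha hb => rw [map_add, inner_add_right, ha, hb, add_zero]
    | smul c a _ ha => rw [map_smul, inner_smul_right, ha, mul_zero]
    | mem a ha =>
      obtain ⟨ξ', hξ', η', rfl⟩ := ha
      change inner ℂ (hilbertTmul ξ η) (operatorTensor x 1 (hilbertTmul ξ' η')) = 0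
      rw [operatorTensor_tmul, inner_hilbertTmul, hx ξ hξ ξ' hξ', zero_mul]

theorem tensorSubspace_mono {V V' : Submodule ℂ H} (h : V ≤ V') :
    tensorSubspace V K ≤ tensorSubspace V' K :=
  Submodule.span_mono fun _ ⟨ξ, hξ, η, hz⟩ => ⟨ξ, h hξ, η, hz⟩

theorem dense_iUnion_tensorSubspace {V : ℕ → Submodule ℂ H} (hm : Monotone V)
    (hd : Dense (⋃ s, (V s : Set H))) :
    Dense (⋃ s, (tensorSubspace (V s) K : Set (HilbertTensor H K))) := by
  let L : Submodule ℂ (HilbertTensor H K) := ⨆ s, tensorSubspace (V s) K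
  have hL : (L : Set (HilbertTensor H K)) = ⋃ s, (tensorSubspace (V s) K : Set (HilbertTensor H K)) :=
    Submodule.coe_iSup_of_directed _ (Monotone.directed_le fun a b h => tensorSubspace_mono (hm h))
  rw [← hL, dense_iff_closure_eq, ← Submodule.topologicalClosure_coe,
    closed_submodule_eq_top_of_tmul_mem L.topologicalClosure L.isClosed_topologicalClosure]
  · rfl
  · intro ξ η
    have hc : Continuous fun ξ : H => hilbertTmul ξ η :=
      ((hilbertTmulL H K).flip η).continuous
    refine map_mem_closure (f := fun ξ : H => hilbertTmul ξ η) hc (hd ξ) ?_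
    intro ξ' hξ'
    obtain ⟨s, hs⟩ := Set.mem_iUnion.1 hξ'
    exact Submodule.mem_iSup_of_mem s (Submodule.subset_span ⟨ξ', hs, η, rfl⟩)

/-- The Pauli system `X ⊗ 1`, `Z ⊗ 1` on a tensor product. -/
noncomputable def PauliSystem.tensor (P : PauliSystem H) (K : Type v) [NormedAddCommGroup K]
    [InnerProductSpace ℂ K] [CompleteSpace K] : PauliSystem (HilbertTensor H K) where
  X i := operatorTensor (P.X i) 1
  Z i := operatorTensor (P.Z i) 1
  star_X i := by rw [star_operatorTensor, P.star_X, star_one]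
  star_Z i := by rw [star_operatorTensor, P.star_Z, star_one]
  X_mul_X i := by rw [operatorTensor_mul, P.X_mul_X, one_mul, operatorTensor_one]
  Z_mul_Z i := by rw [operatorTensor_mul, P.Z_mul_Z, one_mul, operatorTensor_one]
  X_mul_Z i := by rw [operatorTensor_mul, operatorTensor_mul, P.X_mul_Z, operatorTensor_neg_left]
  commute_XX i j := by
    rw [commute_iff_eq, operatorTensor_mul, operatorTensor_mul, (P.commute_XX i j).eq]
  commute_ZZ i j := by
    rw [commute_iff_eq, operatorTensor_mul, operatorTensor_mul, (P.commute_ZZ i j).eq]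
  commute_XZ i j h := by
    rw [commute_iff_eq, operatorTensor_mul, operatorTensor_mul, (P.commute_XZ i j h).eq]
  V s := tensorSubspace (P.V s) K
  mono a b h := tensorSubspace_mono (P.mono h)
  dense := dense_iUnion_tensorSubspace P.mono P.dense
  X_mem i s h f hf := tensorSubspace_invariant (fun ξ hξ => P.X_mem i s h ξ hξ) 1 hf
  Z_mem i s h f hf := tensorSubspace_invariant (fun ξ hξ => P.Z_mem i s h ξ hξ) 1 hf
  inner_X s f hf g hg := inner_tensorSubspace_eq_zero (P.inner_X s) hf hg
  inner_Z s f hf g hg := inner_tensorSubspace_eq_zero (P.inner_Z s) hf hg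
  inner_XZ s f hf g hg := by
    rw [← mul_apply_eq_comp, operatorTensor_mul, one_mul]
    exact inner_tensorSubspace_eq_zero (x := P.X s * P.Z s) (P.inner_XZ s) hf hg

/-- The representation `1 ⊗ π` on a tensor product with the space of a Pauli system. -/
noncomputable def PauliSystem.tensorRep {E : Type*} [CStarAlgebra E] (P : PauliSystem H)
    (π : E →⋆ₐ[ℂ] (K →L[ℂ] K)) : PauliRep E (HilbertTensor H K) where
  __ := P.tensor K
  π := (oneTensor H).comp π
  commute_X x i := by
    change operatorTensor 1 (π x) * operatorTensor (P.X i) 1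
      = operatorTensor (P.X i) 1 * operatorTensor 1 (π x)
    simp [operatorTensor_mul]
  commute_Z x i := by
    change operatorTensor 1 (π x) * operatorTensor (P.Z i) 1
      = operatorTensor (P.Z i) 1 * operatorTensor 1 (π x)
    simp [operatorTensor_mul]
  π_mem x s f hf := tensorSubspace_invariant (fun ξ hξ => hξ) (π x) hf

end

/-! ### The Pauli system on L²(R). -/

section WeightedPermutation

variable {ι : Type} (e : Equiv.Perm ι) (c : ι → ℂ) (hc : ∀ i, ‖c i‖ = 1)

theorem norm_weightedPermutation_apply (f : lp (fun _ : ι => ℂ) 2) :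
    ‖weightedPermutation e c hc f‖ = ‖f‖ := by
  rw [weightedPermutation, LinearIsometry.coe_toContinuousLinearMap, LinearIsometry.norm_map]

theorem star_weightedPermutation_of_mul_self
    (h : weightedPermutation e c hc * weightedPermutation e c hc = 1) :
    star (weightedPermutation e c hc) = weightedPermutation e c hc := by
  set U := weightedPermutation e c hc with hU
  have h1 : star U * U = 1 := by
    rw [ContinuousLinearMap.star_eq_adjoint]
    exact (ContinuousLinearMap.norm_map_iff_adjoint_comp_self U).1
      (norm_weightedPermutation_apply e c hc)
  calc star U = star U * (U * U) := by rw [h, mul_one]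
    _ = U := by rw [← mul_assoc, h1, one_mul]

end WeightedPermutation

theorem pauliX_apply (j : ℕ) (f : PauliSpace) (p : Finset ℕ × Finset ℕ) :
    pauliX j f p = f (p.1 ∆ {j}, p.2) :=
  one_mul _

theorem pauliZ_apply (j : ℕ) (f : PauliSpace) (p : Finset ℕ × Finset ℕ) :
    pauliZ j f p = (if j ∈ p.1 then -1 else 1) * f (p.1, p.2 ∆ {j}) := rfl

theorem pauliX_mul_self (j : ℕ) : pauliX j * pauliX j = 1 := by
  ext f p
  simp [pauliX_apply]

theorem pauliZ_mul_self (j : ℕ) : pauliZ j * pauliZ j = 1 := by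
  ext f p
  simp only [mul_apply_eq_comp, pauliZ_apply, symmDiff_symmDiff_cancel_right, one_apply_eq_self]
  split_ifs <;> simp

theorem symmDiff_singleton_subset_range {i s : ℕ} (h : i < s) {S : Finset ℕ}
    (hS : S ∆ {i} ⊆ Finset.range s) : S ⊆ Finset.range s := by
  intro a ha
  by_cases hai : a = i
  · exact hai ▸ Finset.mem_range.2 h
  · exact hS (Finset.mem_symmDiff.2 (Or.inl ⟨ha, by simpa using hai⟩))

theorem mem_symmDiff_singleton_of_subset_range {s : ℕ} {S : Finset ℕ}
    (hS : S ⊆ Finset.range s) : ¬ S ∆ {s} ⊆ Finset.range s := by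
  intro h
  have : s ∈ S ∆ {s} := Finset.mem_symmDiff.2
    (Or.inr ⟨Finset.mem_singleton_self s, fun hs => by simpa using hS hs⟩)
  simpa using h this

/-- The span of the Pauli monomials supported in `range s`. -/
def pauliSubspace (s : ℕ) : Submodule ℂ PauliSpace where
  carrier := {f | ∀ p, ¬ (p.1 ⊆ Finset.range s ∧ p.2 ⊆ Finset.range s) → f p = 0}
  zero_mem' _ _ := rfl
  add_mem' := by
    intro f g hf hg p hp
    simp [hf p hp, hg p hp]
  smul_mem' := by
    intro c f hf p hp
    simp [hf p hp]

theorem single_mem_pauliSubspace {s : ℕ} {p : Finset ℕ × Finset ℕ} (h1 : p.1 ⊆ Finset.range s)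
    (h2 : p.2 ⊆ Finset.range s) (c : ℂ) : (lp.single 2 p c : PauliSpace) ∈ pauliSubspace s := by
  intro q hq
  refine lp.single_apply_ne (E := fun _ => ℂ) 2 p c ?_
  rintro rfl
  exact hq ⟨h1, h2⟩

theorem pauliSubspace_mono : Monotone pauliSubspace := by
  intro s t h f hf p hp
  exact hf p fun hp' => hp ⟨hp'.1.trans (Finset.range_mono h), hp'.2.trans (Finset.range_mono h)⟩

/-- A closed subspace containing the Pauli monomials is everything. -/
theorem closed_submodule_eq_top_of_single_mem (L : Submodule ℂ PauliSpace)
    (hL : IsClosed (L : Set PauliSpace)) (h : ∀ p, (lp.single 2 p (1 : ℂ) : PauliSpace) ∈ L) :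
    L = ⊤ := by
  rw [eq_top_iff]
  intro f _
  refine hL.mem_of_tendsto (lp.hasSum_single (by norm_num) f) (Eventually.of_forall fun t => ?_)
  refine L.sum_mem fun p _ => ?_
  have : (lp.single 2 p (f p) : PauliSpace) = f p • lp.single 2 p (1 : ℂ) := by
    rw [← lp.single_smul, smul_eq_mul, mul_one]
  rw [this]
  exact L.smul_mem _ (h p)

/-- The Pauli operators on the space `L²(⨂_ℕ M₂(ℂ), tr)`. -/
noncomputable def pauliSystem : PauliSystem PauliSpace where
  X := pauliX
  Z := pauliZ
  star_X i := star_weightedPermutation_of_mul_self _ _ _ (pauliX_mul_self i)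
  star_Z i := star_weightedPermutation_of_mul_self _ _ _ (pauliZ_mul_self i)
  X_mul_X := pauliX_mul_self
  Z_mul_Z := pauliZ_mul_self
  X_mul_Z i := by
    ext f p
    simp only [mul_apply_eq_comp, pauliZ_apply, pauliX_apply, _root_.neg_apply, lp.coeFn_neg,
      Pi.neg_apply]
    by_cases h : i ∈ p.1 <;> simp [h, Finset.mem_symmDiff]
  commute_XX i j := by
    ext f p
    simp only [mul_apply_eq_comp, pauliX_apply, symmDiff_right_comm]
  commute_ZZ i j := by
    ext f p
    simp only [mul_apply_eq_comp, pauliZ_apply, symmDiff_right_comm]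
    ring
  commute_XZ i j h := by
    ext f p
    have : j ∈ p.1 ∆ {i} ↔ j ∈ p.1 := by simp [Finset.mem_symmDiff, h.symm]
    simp only [mul_apply_eq_comp, pauliZ_apply, pauliX_apply, this]
  V := pauliSubspace
  mono := pauliSubspace_mono
  dense := by
    let L : Submodule ℂ PauliSpace := ⨆ s, pauliSubspace s
    have hL : (L : Set PauliSpace) = ⋃ s, (pauliSubspace s : Set PauliSpace) :=
      Submodule.coe_iSup_of_directed _ (Monotone.directed_le pauliSubspace_mono)
    rw [← hL, dense_iff_closure_eq, ← Submodule.topologicalClosure_coe,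
      closed_submodule_eq_top_of_single_mem L.topologicalClosure L.isClosed_topologicalClosure]
    · rfl
    · intro p
      refine subset_closure (Submodule.mem_iSup_of_mem ((p.1 ∪ p.2).sup id + 1)
        (single_mem_pauliSubspace ?_ ?_ 1))
      · exact fun a ha => Finset.mem_range_succ_iff.2
          (Finset.le_sup (f := id) (Finset.mem_union_left _ ha))
      · exact fun a ha => Finset.mem_range_succ_iff.2
          (Finset.le_sup (f := id) (Finset.mem_union_right _ ha))
  X_mem i s h f hf p hp := by
    rw [pauliX_apply]
    exact hf _ fun h' => hp ⟨symmDiff_singleton_subset_range h h'.1, h'.2⟩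
  Z_mem i s h f hf p hp := by
    have h0 : f (p.1, p.2 ∆ {i}) = 0 :=
      hf _ fun h' => hp ⟨h'.1, symmDiff_singleton_subset_range h h'.2⟩
    rw [pauliZ_apply, h0, mul_zero]
  inner_X s f hf g hg := by
    rw [lp.inner_eq_tsum]
    refine (tsum_congr fun p => ?_).trans tsum_zero
    by_cases hp : p.1 ⊆ Finset.range s ∧ p.2 ⊆ Finset.range s
    -- The operator with index s toggles s in every monomial, so monomials supported in `range s`
    -- leave that range and the supports become disjoint.
    · rw [pauliX_apply, hg _ fun h => mem_symmDiff_singleton_of_subset_range hp.1 h.1,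
        inner_zero_right]
    · rw [hf p hp, inner_zero_left]
  inner_Z s f hf g hg := by
    rw [lp.inner_eq_tsum]
    refine (tsum_congr fun p => ?_).trans tsum_zero
    by_cases hp : p.1 ⊆ Finset.range s ∧ p.2 ⊆ Finset.range s
    · rw [pauliZ_apply, hg _ fun h => mem_symmDiff_singleton_of_subset_range hp.2 h.2, mul_zero,
        inner_zero_right]
    · rw [hf p hp, inner_zero_left]
  inner_XZ s f hf g hg := by
    rw [lp.inner_eq_tsum]
    refine (tsum_congr fun p => ?_).trans tsum_zero
    by_cases hp : p.1 ⊆ Finset.range s ∧ p.2 ⊆ Finset.range s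
    · rw [pauliX_apply, pauliZ_apply,
        hg _ fun h => mem_symmDiff_singleton_of_subset_range hp.1 h.1, mul_zero, inner_zero_right]
    · rw [hf p hp, inner_zero_left]

/-- The trace vector of `PauliSpace`. -/
noncomputable def pauliVector : PauliSpace := lp.single 2 (∅, ∅) 1

theorem norm_pauliVector : ‖pauliVector‖ = 1 := by
  rw [pauliVector, lp.norm_single (by norm_num), norm_one]

theorem pauliX_single (j : ℕ) (p : Finset ℕ × Finset ℕ) :
    pauliX j (lp.single 2 p (1 : ℂ)) = lp.single 2 (p.1 ∆ {j}, p.2) (1 : ℂ) := by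
  ext q
  rw [pauliX_apply, lp.single_apply, lp.single_apply, Pi.single_apply, Pi.single_apply]
  refine if_congr ?_ rfl rfl
  constructor
  · rintro rfl; simp
  · rintro rfl; simp

theorem pauliZ_single (j : ℕ) (p : Finset ℕ × Finset ℕ) :
    pauliZ j (lp.single 2 p (1 : ℂ)) =
      (if j ∈ p.1 then -1 else 1 : ℂ) • lp.single 2 (p.1, p.2 ∆ {j}) (1 : ℂ) := by
  ext q
  rw [pauliZ_apply, lp.coeFn_smul, Pi.smul_apply, lp.single_apply, lp.single_apply,
    Pi.single_apply, Pi.single_apply, smul_eq_mul]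
  by_cases h : q = (p.1, p.2 ∆ {j})
  · subst h; simp
  · have h' : (q.1, q.2 ∆ {j}) ≠ p := by
      rintro rfl
      exact h (by simp)
    rw [if_neg h, if_neg h', mul_zero, mul_zero]

/-- The trace vector is cyclic for the Pauli operators. -/
theorem single_tmul_mem {K : Type v} [NormedAddCommGroup K] [InnerProductSpace ℂ K]
    [CompleteSpace K] (L : Submodule ℂ (HilbertTensor PauliSpace K)) (η : K)
    (h0 : hilbertTmul pauliVector η ∈ L)
    (hX : ∀ i, ∀ f ∈ L, operatorTensor (pauliX i) 1 f ∈ L)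
    (hZ : ∀ i, ∀ f ∈ L, operatorTensor (pauliZ i) 1 f ∈ L) (p : Finset ℕ × Finset ℕ) :
    hilbertTmul (lp.single 2 p (1 : ℂ) : PauliSpace) η ∈ L := by
  obtain ⟨S, U⟩ := p
  induction S using Finset.induction_on with
  | empty =>
    induction U using Finset.induction_on with
    | empty => exact h0
    | insert a U ha ih =>
      have := hZ a _ ih
      rw [operatorTensor_tmul, pauliZ_single] at this
      have e : U ∆ {a} = insert a U := by
        rw [(Finset.disjoint_singleton_right.2 ha).symmDiff_eq_sup, Finset.sup_eq_union,
          Finset.union_comm, Finset.insert_eq]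
      simpa [e] using this
  | insert a S ha ih =>
    have := hX a _ ih
    rw [operatorTensor_tmul, pauliX_single] at this
    have e : S ∆ {a} = insert a S := by
      rw [(Finset.disjoint_singleton_right.2 ha).symmDiff_eq_sup, Finset.sup_eq_union,
        Finset.union_comm, Finset.insert_eq]
    simpa [e] using this

/-- Moving the second leg by π and closing up gives all vectors `pauliVector` ⊗ ζ; moving the first
leg by the Pauli operators then gives all monomials tensored with ζ. -/
theorem eq_top_of_cyclic {E : Type*} [CStarAlgebra E] {K : Type v} [NormedAddCommGroup K]
    [InnerProductSpace ℂ K] [CompleteSpace K] (π : E →⋆ₐ[ℂ] (K →L[ℂ] K)) {η : K}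
    (hη : Dense (Set.range fun x => π x η)) (L : Submodule ℂ (HilbertTensor PauliSpace K))
    (hL : IsClosed (L : Set (HilbertTensor PauliSpace K)))
    (h0 : hilbertTmul pauliVector η ∈ L)
    (hXZ : ∀ i, ∀ f ∈ L, operatorTensor (pauliX i) 1 f ∈ L ∧ operatorTensor (pauliZ i) 1 f ∈ L)
    (hπ : ∀ x, ∀ f ∈ L, operatorTensor 1 (π x) f ∈ L) : L = ⊤ := by
  refine closed_submodule_eq_top_of_tmul_mem L hL fun ξ ζ => ?_
  have h1 : ∀ ζ, hilbertTmul pauliVector ζ ∈ L := by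
    intro ζ
    have hc : Continuous fun ζ : K => hilbertTmul pauliVector ζ :=
      (hilbertTmulL PauliSpace K pauliVector).continuous
    have := map_mem_closure (f := fun ζ : K => hilbertTmul pauliVector ζ) hc (hη ζ)
      (t := (L : Set (HilbertTensor PauliSpace K))) (by
        rintro _ ⟨x, rfl⟩
        have := hπ x _ h0
        rwa [operatorTensor_tmul] at this)
    rwa [hL.closure_eq] at this
  have h2 := single_tmul_mem L ζ (h1 ζ) (fun i f hf => (hXZ i f hf).1) fun i f hf => (hXZ i f hf).2
  let M : Submodule ℂ PauliSpace := L.comap ((hilbertTmulL PauliSpace K).flip ζ).toLinearMap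
  have hM : M = ⊤ := closed_submodule_eq_top_of_single_mem M
    (hL.preimage ((hilbertTmulL PauliSpace K).flip ζ).continuous) h2
  have : ξ ∈ M := hM ▸ Submodule.mem_top
  exact this

/-! ### Generated von Neumann algebras and their commutants. -/

section Generated

variable {H : Type u} [NormedAddCommGroup H] [InnerProductSpace ℂ H] [CompleteSpace H]
variable {K : Type v} [NormedAddCommGroup K] [InnerProductSpace ℂ K] [CompleteSpace K]

/-- Membership in terms of commutants alone, so that two generated algebras can be compared through
the commutants of their generators. -/
theorem mem_vonNeumannAlgebraGenerated_iff {S : Set (H →L[ℂ] H)} {T : H →L[ℂ] H} :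
    T ∈ vonNeumannAlgebraGenerated S ↔
      ∀ U, (∀ s ∈ S ∪ star S, Commute U s) → Commute U T := by
  have h : T ∈ vonNeumannAlgebraGenerated S ↔
      T ∈ ((StarSubalgebra.centralizer ℂ (Set.centralizer (S ∪ star S)) :
        StarSubalgebra ℂ (H →L[ℂ] H)) : Set (H →L[ℂ] H)) := Iff.rfl
  have h2 : Set.centralizer (S ∪ star S) =
      ((StarSubalgebra.centralizer ℂ S : StarSubalgebra ℂ (H →L[ℂ] H)) : Set (H →L[ℂ] H)) := rfl
  rw [h, h2, StarSubalgebra.coe_centralizer_centralizer]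
  constructor
  · intro hT U hU
    exact hT U fun s hs => (hU s hs).eq.symm
  · intro hT U hU
    exact (hT U fun s hs => (hU s hs).symm).eq

theorem subset_vonNeumannAlgebraGenerated {S : Set (H →L[ℂ] H)} {s : H →L[ℂ] H} (hs : s ∈ S) :
    s ∈ vonNeumannAlgebraGenerated S :=
  mem_vonNeumannAlgebraGenerated_iff.2 fun _ hU => hU s (Or.inl hs)

theorem VonNeumannAlgebra.one_mem (N : VonNeumannAlgebra H) : (1 : H →L[ℂ] H) ∈ N :=
  OneMemClass.one_mem N.toStarSubalgebra

theorem vonNeumannAlgebraGenerated_congr {S S' : Set (H →L[ℂ] H)}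
    (h : ∀ U, (∀ s ∈ S ∪ star S, Commute U s) ↔ ∀ s ∈ S' ∪ star S', Commute U s) :
    vonNeumannAlgebraGenerated S = vonNeumannAlgebraGenerated S' := by
  refine VonNeumannAlgebra.ext fun T => ?_
  rw [mem_vonNeumannAlgebraGenerated_iff, mem_vonNeumannAlgebraGenerated_iff]
  simp only [h]

theorem isomorphic_of_conj (e : H ≃ₗᵢ[ℂ] K) {ι : Type*} (a : ι → H →L[ℂ] H) (b : ι → K →L[ℂ] K)
    (hab : ∀ i, e.conjStarAlgEquiv (a i) = b i) :
    (vonNeumannAlgebraGenerated (Set.range a)).Isomorphic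
      (vonNeumannAlgebraGenerated (Set.range b)) := by
  have key : ∀ T, T ∈ vonNeumannAlgebraGenerated (Set.range a) ↔
      e.conjStarAlgEquiv T ∈ vonNeumannAlgebraGenerated (Set.range b) := by
    intro T
    rw [mem_vonNeumannAlgebraGenerated_iff, mem_vonNeumannAlgebraGenerated_iff]
    have hset : ∀ s, s ∈ Set.range a ∪ star (Set.range a) ↔
        e.conjStarAlgEquiv s ∈ Set.range b ∪ star (Set.range b) := by
      intro s
      simp only [Set.mem_union, Set.mem_star, Set.mem_range, ← map_star, ← hab,
        EmbeddingLike.apply_eq_iff_eq]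
    have hcomm : ∀ U V, Commute (e.conjStarAlgEquiv U) (e.conjStarAlgEquiv V) ↔ Commute U V := by
      intro U V
      rw [commute_iff_eq, commute_iff_eq, ← map_mul, ← map_mul, EmbeddingLike.apply_eq_iff_eq]
    constructor
    · intro h U hU
      obtain ⟨U, rfl⟩ := e.conjStarAlgEquiv.surjective U
      exact (hcomm U T).2 (h U fun s hs => (hcomm U s).1 (hU _ ((hset s).1 hs)))
    · intro h U hU
      refine (hcomm U T).1 (h _ fun s hs => ?_)
      obtain ⟨s, rfl⟩ := e.conjStarAlgEquiv.surjective s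
      exact (hcomm U s).2 (hU s ((hset s).2 hs))
  let F : (vonNeumannAlgebraGenerated (Set.range a)).toStarSubalgebra →⋆ₐ[ℂ]
      (vonNeumannAlgebraGenerated (Set.range b)).toStarSubalgebra :=
    StarAlgHom.codRestrict (e.conjStarAlgEquiv.toStarAlgHom.comp (StarSubalgebra.subtype _)) _
      fun T => (key T.1).1 T.2
  refine ⟨StarAlgEquiv.ofBijective F ⟨fun x y h => ?_, fun y => ?_⟩⟩
  · exact Subtype.ext (e.conjStarAlgEquiv.injective (congrArg Subtype.val h))
  · obtain ⟨T, hT⟩ := e.conjStarAlgEquiv.surjective y.1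
    exact ⟨⟨T, (key T).2 (hT ▸ y.2)⟩, Subtype.ext hT⟩

end Generated

section Slice

variable {H : Type*} [NormedAddCommGroup H] [InnerProductSpace ℂ H] [CompleteSpace H]
  {G : Type*} [NormedAddCommGroup G] [InnerProductSpace ℂ G] [CompleteSpace G]

/-- If `T` commutes with an amplification of the generators of a von Neumann algebra, then it
commutes with the amplification of the von Neumann algebra. -/
theorem commute_amplification {ι : Type*} (V : ι → H →L[ℂ] G) (ρ : (H →L[ℂ] H) → (G →L[ℂ] G))
    (hV : ∀ i a ξ, ρ a (V i ξ) = V i (a ξ)) (hstar : ∀ a, star (ρ a) = ρ (star a))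
    (htot : ∀ L : Submodule ℂ G, IsClosed (L : Set G) → (∀ i ξ, V i ξ ∈ L) → L = ⊤)
    {S : Set (H →L[ℂ] H)} {T : G →L[ℂ] G} (hT : ∀ s ∈ S ∪ star S, Commute T (ρ s))
    {x : H →L[ℂ] H} (hx : x ∈ vonNeumannAlgebraGenerated S) : Commute T (ρ x) := by
  have hadj : ∀ i a z, (V i).adjoint (ρ a z) = a ((V i).adjoint z) := by
    intro i a z
    refine ext_inner_left ℂ fun ξ => ?_
    rw [ContinuousLinearMap.adjoint_inner_right, ← ContinuousLinearMap.adjoint_inner_left,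
      ← ContinuousLinearMap.star_eq_adjoint, hstar, hV,
      ← ContinuousLinearMap.adjoint_inner_left, ContinuousLinearMap.adjoint_inner_right,
      ContinuousLinearMap.star_eq_adjoint]
  -- The slices of T commute with the generators on H, hence with x; since the ranges of the `V i`
  -- are total, the slices determine T.
  have hslice : ∀ i j, Commute ((V i).adjoint ∘L T ∘L V j) x := by
    intro i j
    refine mem_vonNeumannAlgebraGenerated_iff.1 hx _ fun s hs => ?_
    ext ξ
    have h := congrArg (fun W : G →L[ℂ] G => W (V j ξ)) (hT s hs).eq
    simp only [mul_apply_eq_comp] at h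
    simp only [mul_apply_eq_comp, ContinuousLinearMap.comp_apply]
    rw [← hV, h, hadj]
  have h0 : ∀ j ξ, (T * ρ x) (V j ξ) = (ρ x * T) (V j ξ) := by
    intro j ξ
    have hker : LinearMap.ker (innerSL ℂ ((T * ρ x) (V j ξ) - (ρ x * T) (V j ξ))).toLinearMap = ⊤ := by
      refine htot _ (ContinuousLinearMap.isClosed_ker _) fun i ξ' => ?_
      change inner ℂ ((T * ρ x) (V j ξ) - (ρ x * T) (V j ξ)) (V i ξ') = 0
      have h := congrArg (fun W : H →L[ℂ] H => W ξ) (hslice i j).eq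
      simp only [mul_apply_eq_comp, ContinuousLinearMap.comp_apply] at h
      rw [← ContinuousLinearMap.adjoint_inner_left, map_sub, mul_apply_eq_comp, mul_apply_eq_comp,
        hadj, hV, h, sub_self, inner_zero_left]
    have h1 : (T * ρ x) (V j ξ) - (ρ x * T) (V j ξ) ∈ LinearMap.ker
        (innerSL ℂ ((T * ρ x) (V j ξ) - (ρ x * T) (V j ξ))).toLinearMap := hker ▸ Submodule.mem_top
    exact sub_eq_zero.1 (inner_self_eq_zero.1 h1)
  have htop := htot (LinearMap.eqLocus (T * ρ x).toLinearMap (ρ x * T).toLinearMap)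
    (isClosed_eq (T * ρ x).continuous (ρ x * T).continuous) h0
  ext z
  have hz : z ∈ LinearMap.eqLocus (T * ρ x).toLinearMap (ρ x * T).toLinearMap :=
    htop ▸ Submodule.mem_top
  exact hz

end Slice

section Tensor

variable {H : Type u} [NormedAddCommGroup H] [InnerProductSpace ℂ H] [CompleteSpace H]
variable {K : Type v} [NormedAddCommGroup K] [InnerProductSpace ℂ K] [CompleteSpace K]

/-- The commutant of a tensor product of von Neumann algebras is the commutant of the
amplifications of the generators. -/
theorem commute_tensor_iff {S : Set (H →L[ℂ] H)} {S' : Set (K →L[ℂ] K)}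
    {T : HilbertTensor H K →L[ℂ] HilbertTensor H K} :
    (∀ W ∈ {T | ∃ x ∈ vonNeumannAlgebraGenerated S, ∃ y ∈ vonNeumannAlgebraGenerated S',
        T = operatorTensor x y} ∪ star {T | ∃ x ∈ vonNeumannAlgebraGenerated S,
        ∃ y ∈ vonNeumannAlgebraGenerated S', T = operatorTensor x y}, Commute T W) ↔
      (∀ s ∈ S ∪ star S, Commute T (operatorTensor s 1)) ∧
        ∀ s ∈ S' ∪ star S', Commute T (operatorTensor 1 s) := by
  constructor
  · intro h
    constructor
    · rintro s (hs | hs)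
      · exact h _ (Or.inl ⟨s, subset_vonNeumannAlgebraGenerated hs, 1, VonNeumannAlgebra.one_mem _, rfl⟩)
      · exact h _ (Or.inr ⟨star s, subset_vonNeumannAlgebraGenerated hs, 1, VonNeumannAlgebra.one_mem _, by
          rw [star_operatorTensor, star_one]⟩)
    · rintro s (hs | hs)
      · exact h _ (Or.inl ⟨1, VonNeumannAlgebra.one_mem _, s, subset_vonNeumannAlgebraGenerated hs, rfl⟩)
      · exact h _ (Or.inr ⟨1, VonNeumannAlgebra.one_mem _, star s, subset_vonNeumannAlgebraGenerated hs, by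
          rw [star_operatorTensor, star_one]⟩)
  · rintro ⟨h1, h2⟩
    have key : ∀ x ∈ vonNeumannAlgebraGenerated S, ∀ y ∈ vonNeumannAlgebraGenerated S',
        Commute T (operatorTensor x y) := by
      intro x hx y hy
      have hx' : Commute T (operatorTensor x 1) :=
        commute_amplification (fun η : K => (hilbertTmulL H K).flip η)
          (fun a => operatorTensor a 1) (fun η a ξ => operatorTensor_tmul a 1 ξ η)
          (fun a => by rw [star_operatorTensor, star_one])
          (fun L hL h => closed_submodule_eq_top_of_tmul_mem L hL fun ξ η => h η ξ) h1 hx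
      have hy' : Commute T (operatorTensor 1 y) :=
        commute_amplification (fun ξ : H => hilbertTmulL H K ξ)
          (fun a => operatorTensor 1 a) (fun ξ a η => operatorTensor_tmul 1 a ξ η)
          (fun a => by rw [star_operatorTensor, star_one])
          (fun L hL h => closed_submodule_eq_top_of_tmul_mem L hL fun ξ η => h ξ η) h2 hy
      have := hx'.mul_right hy'
      rwa [operatorTensor_mul, one_mul, mul_one] at this
    rintro W (⟨x, hx, y, hy, rfl⟩ | ⟨x, hx, y, hy, hW⟩)
    · exact key x hx y hy
    · have : W = operatorTensor (star x) (star y) := by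
        rw [← star_star W, hW, star_operatorTensor]
      rw [this]
      exact key _ (star_mem hx) _ (star_mem hy)

end Tensor

/-! ### GNS representations and their trace vectors. -/

section GNS

variable {A : Type u} [CStarAlgebra A] [PartialOrder A] [StarOrderedRing A]
  {H : Type v} [NormedAddCommGroup H] [InnerProductSpace ℂ H] [CompleteSpace H]

/-- Uniqueness of the GNS representation. -/
theorem exists_gns_equiv (f : A →ₚ[ℂ] ℂ) (Ψ : A →⋆ₐ[ℂ] (H →L[ℂ] H)) (Ω : H)
    (hf : ∀ a, f a = inner ℂ Ω (Ψ a Ω)) (hΩ : Dense (Set.range fun a => Ψ a Ω)) :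
    ∃ e : f.GNS ≃ₗᵢ[ℂ] H, ∀ a, e.conjStarAlgEquiv (f.gnsStarAlgHom a) = Ψ a := by
  let e₁ : A →ₗ[ℂ] f.GNS :=
    (UniformSpace.Completion.toComplL (𝕜 := ℂ) (E := f.PreGNS)).toLinearMap ∘ₗ f.toPreGNS.toLinearMap
  let e₂ : A →ₗ[ℂ] H :=
    { toFun := fun a => Ψ a Ω
      map_add' := fun a b => by rw [map_add]; rfl
      map_smul' := fun c a => by rw [map_smul]; rfl }
  have hd₁ : DenseRange e₁ := by
    have : DenseRange ((↑) : f.PreGNS → f.GNS) := UniformSpace.Completion.denseRange_coe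
    exact this.comp f.toPreGNS.surjective.denseRange (UniformSpace.Completion.continuous_coe _)
  have hn : ∀ a, ‖e₂ (LinearEquiv.refl ℂ A a)‖ = ‖e₁ a‖ := by
    intro a
    refine (sq_eq_sq₀ (norm_nonneg _) (norm_nonneg _)).1 ?_
    have h1 : ‖e₁ a‖ = ‖f.toPreGNS a‖ := UniformSpace.Completion.norm_coe _
    have h2 := f.preGNS_norm_sq (f.toPreGNS a)
    have h3 : inner ℂ (Ψ a Ω) (Ψ a Ω) = f (star a * a) := by
      rw [hf, map_mul, map_star, mul_apply_eq_comp, ContinuousLinearMap.star_eq_adjoint,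
        ContinuousLinearMap.adjoint_inner_right]
    rw [inner_self_eq_norm_sq_to_K] at h3
    rw [h1]
    change ‖Ψ a Ω‖ ^ 2 = _
    refine Complex.ofReal_injective ?_
    push_cast
    exact h3.trans h2.symm
  let e : f.GNS ≃ₗᵢ[ℂ] H := (LinearEquiv.refl ℂ A).extendOfIsometry e₁ e₂ hd₁ hΩ hn
  have he : ∀ a, e (e₁ a) = Ψ a Ω := fun a =>
    LinearEquiv.extendOfIsometry_eq (LinearEquiv.refl ℂ A) e₁ e₂ hd₁ hΩ hn a
  refine ⟨e, fun a => ?_⟩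
  have hcomm : ∀ b, e.conjStarAlgEquiv (f.gnsStarAlgHom a) (Ψ b Ω) = Ψ a (Ψ b Ω) := by
    intro b
    rw [LinearIsometryEquiv.conjStarAlgEquiv_apply_apply, ← he b, e.symm_apply_apply]
    have : f.gnsStarAlgHom a (e₁ b) = e₁ (a * b) := f.gnsNonUnitalStarAlgHom_apply_coe
    rw [this, he, he, map_mul, mul_apply_eq_comp]
  exact ContinuousLinearMap.coeFn_injective (Continuous.ext_on hΩ
    (ContinuousLinearMap.continuous _) (ContinuousLinearMap.continuous _)
    (by rintro _ ⟨b, rfl⟩; exact hcomm b))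

/-- The vacuum vector of a tracial state. -/
noncomputable def TracialState.vector (τ : TracialState A) : τ.toFunctional.GNS :=
  ((τ.toFunctional.toPreGNS 1 : τ.toFunctional.PreGNS) : τ.toFunctional.GNS)

theorem TracialState.gns_vector (τ : TracialState A) (x : A) :
    τ.toFunctional.gnsStarAlgHom x τ.vector =
      ((τ.toFunctional.toPreGNS x : τ.toFunctional.PreGNS) : τ.toFunctional.GNS) := by
  have : τ.toFunctional.gnsStarAlgHom x τ.vector =
      ((τ.toFunctional.toPreGNS (x * 1) : τ.toFunctional.PreGNS) : τ.toFunctional.GNS) :=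
    τ.toFunctional.gnsNonUnitalStarAlgHom_apply_coe
  rw [this, mul_one]

theorem TracialState.inner_vector (τ : TracialState A) (x : A) :
    inner ℂ τ.vector (τ.toFunctional.gnsStarAlgHom x τ.vector) = τ.toFunctional x := by
  rw [τ.gns_vector, TracialState.vector, UniformSpace.Completion.inner_coe,
    PositiveLinearMap.preGNS_inner_def]
  simp

theorem TracialState.norm_vector (τ : TracialState A) : ‖τ.vector‖ = 1 := by
  have h := τ.inner_vector 1
  rw [τ.map_one, _root_.map_one, one_apply_eq_self, inner_self_eq_norm_sq_to_K] at h
  have h' : ‖τ.vector‖ ^ 2 = 1 := by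
    refine Complex.ofReal_injective ?_
    push_cast
    exact h
  exact (pow_eq_one_iff_of_nonneg (norm_nonneg _) two_ne_zero).1 h'

theorem TracialState.dense_vector (τ : TracialState A) :
    Dense (Set.range fun x => τ.toFunctional.gnsStarAlgHom x τ.vector) := by
  have : DenseRange ((↑) : τ.toFunctional.PreGNS → τ.toFunctional.GNS) :=
    UniformSpace.Completion.denseRange_coe
  refine this.mono ?_
  rintro _ ⟨x, rfl⟩
  exact ⟨τ.toFunctional.ofPreGNS x, τ.gns_vector _⟩

end GNS

/-! ### Ideals, simplicity and the Popa property of the limit. -/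

section Ideal

open InnerProductSpace in
/-- An ideal which is close to an operator on a finite dimensional space, in comparison with the
norm of the operator, contains the unit. -/
theorem TwoSidedIdeal.one_mem_of_norm_sub_lt {V : Type*} [NormedAddCommGroup V]
    [InnerProductSpace ℂ V] [FiniteDimensional ℂ V] [CompleteSpace V] {B : Type*} [CStarAlgebra B]
    (σ : (V →L[ℂ] V) →⋆ₐ[ℂ] B) (I : TwoSidedIdeal B) {y : B} (hy : y ∈ I) (M : V →L[ℂ] V)
    (h : ‖y - σ M‖ < ‖M‖) : (1 : B) ∈ I := by
  obtain ⟨v, hv, hMv⟩ := M.exists_lt_apply_of_lt_opNorm h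
  have hpos : 0 < ‖M v‖ := (norm_nonneg _).trans_lt hMv
  obtain ⟨w, hw, hwv⟩ : ∃ w : V, ‖w‖ = 1 ∧ inner ℂ w (M v) = (‖M v‖ : ℂ) := by
    refine ⟨((‖M v‖⁻¹ : ℝ) : ℂ) • M v, ?_, ?_⟩
    · rw [norm_smul, Complex.norm_real, norm_inv, norm_norm, inv_mul_cancel₀ hpos.ne']
    · rw [inner_smul_left, Complex.conj_ofReal, inner_self_eq_norm_sq_to_K]
      simp only [Complex.coe_algebraMap]
      rw [← Complex.ofReal_pow, ← Complex.ofReal_mul]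
      congr 1
      field_simp
  have hww : inner ℂ w w = (1 : ℂ) := by
    rw [inner_self_eq_norm_sq_to_K, hw]; simp
  -- With w the unit vector along M v, the rank one operators p and d turn M into the multiple ‖M v‖
  -- p, and y into an ideal element near it.
  set p : V →L[ℂ] V := rankOne ℂ w w with hp
  set d : V →L[ℂ] V := rankOne ℂ v w with hd
  have hpM : p * M * d = (‖M v‖ : ℂ) • p := by
    ext z
    simp only [hp, hd, mul_apply_eq_comp, rankOne_apply, map_smul, _root_.smul_apply,
      hwv, smul_smul]
    rw [mul_comm]
  have hpp : p * p = p := by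
    ext z
    simp only [hp, mul_apply_eq_comp, rankOne_apply, inner_smul_right, hww, mul_one]
  set z : B := σ p * y * σ d with hz
  have hzI : z ∈ I := I.mul_mem_right _ _ (I.mul_mem_left _ _ hy)
  have hσp : ‖σ p‖ ≤ 1 := (NonUnitalStarAlgHom.norm_apply_le σ p).trans (by simp [hp, hw])
  have hσd : ‖σ d‖ ≤ 1 := (NonUnitalStarAlgHom.norm_apply_le σ d).trans (by simp [hd, hw, hv.le])
  have h1 : ‖z - (‖M v‖ : ℂ) • σ p‖ < ‖M v‖ := by
    have e : z - (‖M v‖ : ℂ) • σ p = σ p * (y - σ M) * σ d := by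
      rw [mul_sub, sub_mul, ← map_mul, ← map_mul, hpM, map_smul]
    rw [e]
    refine lt_of_le_of_lt ?_ hMv
    calc ‖σ p * (y - σ M) * σ d‖ ≤ ‖σ p‖ * ‖y - σ M‖ * ‖σ d‖ :=
          (norm_mul_le _ _).trans (mul_le_mul_of_nonneg_right (norm_mul_le _ _) (norm_nonneg _))
      _ ≤ 1 * ‖y - σ M‖ * 1 := by gcongr
      _ = ‖y - σ M‖ := by ring
  set t : B := (‖M v‖⁻¹ : ℂ) • z with ht
  have htI : t ∈ I := by
    rw [ht, ← one_mul z, ← smul_mul_assoc]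
    exact I.mul_mem_left _ _ hzI
  have hpt : σ p * t = t := by
    rw [ht, mul_smul_comm, hz, ← mul_assoc, ← mul_assoc, ← map_mul, hpp]
  have h2 : ‖σ p - t‖ < 1 := by
    have hne : (‖M v‖ : ℂ) ≠ 0 := by exact_mod_cast hpos.ne'
    have e : σ p - t = (‖M v‖⁻¹ : ℂ) • ((‖M v‖ : ℂ) • σ p - z) := by
      rw [smul_sub, smul_smul, inv_mul_cancel₀ hne, one_smul]
    rw [e, norm_smul, norm_sub_rev, norm_inv, Complex.norm_real, norm_norm,
      inv_mul_lt_one₀ hpos]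
    exact h1
  -- As p t = t and ‖p - t‖ < 1, the element 1 - (p - t) is invertible and p (1 - (p - t)) = t.
  -- Solving for p places it in the ideal.
  have hpI : σ p ∈ I := by
    have e : σ p * ((Units.oneSub (σ p - t) h2 : Bˣ) : B) = t := by
      rw [Units.val_oneSub, mul_sub, mul_sub, hpt, mul_one, ← map_mul, hpp]
      abel
    have e2 : σ p = t * ((Units.oneSub (σ p - t) h2)⁻¹ : Bˣ) :=
      (Units.eq_mul_inv_iff_mul_eq _).2 e
    rw [e2]
    exact I.mul_mem_right _ _ htI
  -- The unit is a sum of rank one projections, each obtained from p by multiplication on both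
  -- sides.
  have hsum : (1 : V →L[ℂ] V) =
      ∑ i, rankOne ℂ (stdOrthonormalBasis ℂ V i) w * p *
        rankOne ℂ w (stdOrthonormalBasis ℂ V i) := by
    ext z
    simp only [_root_.sum_apply, mul_apply_eq_comp, rankOne_apply, hp, inner_smul_right, hww,
      mul_one]
    exact ((stdOrthonormalBasis ℂ V).sum_repr' z).symm
  rw [← map_one σ, hsum, map_sum]
  refine sum_mem fun i _ => ?_
  rw [map_mul, map_mul]
  exact I.mul_mem_right _ _ (I.mul_mem_left _ _ hpI)

theorem TwoSidedIdeal.one_mem_of_norm_sub_matrix_lt {n : Type*} [Fintype n] [DecidableEq n]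
    {B : Type*} [CStarAlgebra B] (σ : CStarMatrix n n ℂ →⋆ₐ[ℂ] B) (I : TwoSidedIdeal B) {y : B}
    (hy : y ∈ I) (M : CStarMatrix n n ℂ) (h : ‖y - σ M‖ < ‖M‖) : (1 : B) ∈ I := by
  let e : CStarMatrix n n ℂ ≃⋆ₐ[ℂ] (EuclideanSpace ℂ n →L[ℂ] EuclideanSpace ℂ n) :=
    (CStarMatrix.ofMatrixStarAlgEquiv (n := n) (A := ℂ)).symm.trans Matrix.toEuclideanCLM
  have hn : ‖e M‖ = ‖M‖ := NonUnitalStarAlgHom.norm_map e e.injective M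
  refine I.one_mem_of_norm_sub_lt (σ.comp e.symm.toStarAlgHom) hy (e M) ?_
  rw [hn]
  have : (σ.comp e.symm.toStarAlgHom) (e M) = σ M := congrArg σ (e.symm_apply_apply M)
  rwa [this]

end Ideal

namespace Tower

variable {C : ∀ (B : Type u) [CStarAlgebra B], Prop} {E : Type u} [CStarAlgebra E] (T : Tower C E)
  {B : Type*} [CStarAlgebra B] (θ : ∀ m, T.A m →⋆ₐ[ℂ] B)

theorem map_iterHom_step (hθ : ∀ m x, θ (m + 1) (T.step m x) = θ m x)
    {m n : ℕ} (h : m ≤ n) (x : T.A m) : θ n (iterHom T.step h x) = θ m x := by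
  induction n, h using Nat.le_induction with
  | base => rw [iterHom_self]
  | succ n h ih => rw [iterHom_succ _ h, hθ, ih]

theorem norm_iterHom_step {m n : ℕ} (h : m ≤ n) (x : T.A m) : ‖iterHom T.step h x‖ = ‖x‖ := by
  induction n, h using Nat.le_induction with
  | base => rw [iterHom_self]
  | succ n h ih =>
    rw [iterHom_succ _ h, NonUnitalStarAlgHom.norm_map (T.step n) (T.step_injective n), ih]

theorem iterHom_step_mem {m n k : ℕ} (h : m ≤ n) {x : T.A m} (hx : x ∈ T.G m k) :
    iterHom T.step h x ∈ T.G n k := by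
  induction n, h using Nat.le_induction with
  | base => rwa [iterHom_self]
  | succ n h ih => rw [iterHom_succ _ h]; exact T.step_mem n k ih

/-- Cutting y by the scalar projection of a late stage gives an ideal element near a scalar matrix.
With x' within ‖x‖/8 of x, the error is below ‖x‖/4, while the matrix has norm at least ‖x'‖/2 ≥
7‖x‖/16. -/
theorem one_mem_of_norm_sub_lt (hθ : ∀ m x, θ (m + 1) (T.step m x) = θ m x)
    (I : TwoSidedIdeal B) {y : B} (hy : y ∈ I) {m : ℕ} {x : T.A m}
    (h : ‖y - θ m x‖ < ‖x‖ / 8) : (1 : B) ∈ I := by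
  have hx : 0 < ‖x‖ := by linarith [norm_nonneg (y - θ m x)]
  obtain ⟨x', hx'1, hx'2⟩ := Metric.mem_closure_iff.1 (T.dense m x) (‖x‖ / 8) (by positivity)
  obtain ⟨k, hk⟩ := Set.mem_iUnion.1 hx'1
  rw [dist_eq_norm] at hx'2
  -- At this stage the image of x' belongs to the finite set on which `T.rep n` is bounded below by
  -- one half.
  set n := max m k
  set x'' := iterHom T.step (le_max_left m k) x' with hx''
  have hmem : x'' ∈ T.G n n := T.mono n (le_max_right m k) (T.iterHom_step_mem _ hk)
  have hrep := T.norm_le n x'' hmem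
  have hnorm : ‖x''‖ = ‖x'‖ := T.norm_iterHom_step _ _
  have hθx : θ n x'' = θ m x' := T.map_iterHom_step θ hθ _ _
  refine I.one_mem_of_norm_sub_matrix_lt ((θ (n + 1)).comp (T.scalar n))
    (I.mul_mem_left ((θ (n + 1)).comp (T.scalar n) (T.rep n 1)) y hy) (T.rep n x'') ?_
  have e : ((θ (n + 1)).comp (T.scalar n)) (T.rep n x'') =
      ((θ (n + 1)).comp (T.scalar n)) (T.rep n 1) * θ n x'' := by
    rw [← hθ]
    exact (congrArg (θ (n + 1)) (T.scalar_mul_step n x'').symm).trans (map_mul _ _ _)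
  have hp : ‖((θ (n + 1)).comp (T.scalar n)) (T.rep n 1)‖ ≤ 1 := by
    refine (NonUnitalStarAlgHom.norm_apply_le ((θ (n + 1)).comp (T.scalar n)) _).trans ?_
    refine (NonUnitalStarAlgHom.norm_apply_le (T.rep n) _).trans ?_
    rw [CStarRing.norm_one]
  have h1 : ‖y - θ m x'‖ < ‖x‖ / 4 := by
    have h2 : ‖θ m (x - x')‖ ≤ ‖x - x'‖ := NonUnitalStarAlgHom.norm_apply_le (θ m) _
    have h3 : y - θ m x' = (y - θ m x) + θ m (x - x') := by rw [map_sub]; abel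
    rw [h3]
    linarith [norm_add_le (y - θ m x) (θ m (x - x'))]
  have h4 : ‖x‖ ≤ ‖x'‖ + ‖x - x'‖ := by
    simpa [add_comm] using norm_add_le x' (x - x')
  rw [e, ← mul_sub, hθx]
  refine (norm_mul_le _ _).trans_lt (lt_of_le_of_lt (b := 1 * ‖y - θ m x'‖) ?_ ?_)
  · gcongr
  · linarith

/-- The zero ideal is used with y = 0: a nonzero x in the kernel would put 1 in it. -/
theorem map_injective (hθ : ∀ m x, θ (m + 1) (T.step m x) = θ m x)
    [Nontrivial B] (m : ℕ) : Function.Injective (θ m) := by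
  rw [injective_iff_map_eq_zero]
  intro x hx
  by_contra hne
  have := T.one_mem_of_norm_sub_lt θ hθ ⊥ (zero_mem _) (x := x) (by
    rw [hx, sub_zero, norm_zero]
    have := norm_pos_iff.2 hne
    positivity)
  rw [TwoSidedIdeal.mem_bot] at this
  exact one_ne_zero this

theorem isSimple_of_dense (hθ : ∀ m x, θ (m + 1) (T.step m x) = θ m x)
    [Nontrivial B] (hd : Dense (⋃ m, Set.range (θ m))) :
    IsSimpleCStarAlgebra B := by
  refine ⟨inferInstance, fun I _ => ?_⟩
  by_cases hI : I = ⊥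
  · exact Or.inl hI
  · refine Or.inr ?_
    obtain ⟨a, ha, ha0⟩ : ∃ a ∈ I, a ≠ 0 := by
      by_contra! h
      refine hI (le_bot_iff.1 fun a ha => ?_)
      rw [TwoSidedIdeal.mem_bot]
      exact h a ha
    have hpos : 0 < ‖a‖ := norm_pos_iff.2 ha0
    obtain ⟨b, hb, hab⟩ := Metric.mem_closure_iff.1 (hd a) (‖a‖ / 16) (by positivity)
    obtain ⟨m, x, rfl⟩ := Set.mem_iUnion.1 hb
    rw [dist_eq_norm] at hab
    have h1 : ‖θ m x‖ ≤ ‖x‖ := NonUnitalStarAlgHom.norm_apply_le (θ m) x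
    have h2 : ‖a‖ ≤ ‖θ m x‖ + ‖a - θ m x‖ := by
      simpa [add_comm] using norm_add_le (θ m x) (a - θ m x)
    exact (TwoSidedIdeal.one_mem_iff I).1
      (T.one_mem_of_norm_sub_lt θ hθ I ha (x := x) (by linarith))

/-- A nonzero C⋆-algebra which is the limit of the tower is a Popa algebra. -/
theorem isPopaAlgebra_of_dense (hθ : ∀ m x, θ (m + 1) (T.step m x) = θ m x)
    [Nontrivial B] (hd : Dense (⋃ m, Set.range (θ m))) :
    IsPopaAlgebra B where
  simple := T.isSimple_of_dense θ hθ hd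
  separable := by
    rw [← TopologicalSpace.isSeparable_univ_iff, ← hd.closure_eq]
    exact (TopologicalSpace.IsSeparable.iUnion fun m => TopologicalSpace.isSeparable_range
      (NonUnitalStarAlgHom.isometry (θ m) (T.map_injective θ hθ m)).continuous).closure
  finite_dimensional_approximation F ε hε := by
    classical
    have hrange : ∀ {m n : ℕ}, m ≤ n → Set.range (θ m) ⊆ Set.range (θ n) := by
      rintro m n h _ ⟨x, rfl⟩
      exact ⟨_, T.map_iterHom_step θ hθ h x⟩
    have happrox : ∀ F : Finset B, ∃ m, ∀ x ∈ F, ∃ a : T.A m, ‖x - θ m a‖ < ε / 2 := by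
      intro F
      induction F using Finset.induction_on with
      | empty => exact ⟨0, by simp⟩
      | insert x F _ ih =>
        obtain ⟨m, hm⟩ := ih
        obtain ⟨b, hb, hxb⟩ := Metric.mem_closure_iff.1 (hd x) (ε / 2) (by positivity)
        obtain ⟨k, a, rfl⟩ := Set.mem_iUnion.1 hb
        refine ⟨max m k, fun y hy => ?_⟩
        rcases Finset.mem_insert.1 hy with rfl | hy
        · obtain ⟨a', ha'⟩ := hrange (le_max_right m k) ⟨a, rfl⟩
          exact ⟨a', by rwa [ha', ← dist_eq_norm]⟩
        · obtain ⟨a, ha⟩ := hm y hy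
          obtain ⟨a', ha'⟩ := hrange (le_max_left m k) ⟨a, rfl⟩
          exact ⟨a', by rwa [ha']⟩
    obtain ⟨m, hm⟩ := happrox F
    -- Its range is the finite dimensional subalgebra sought: its unit `κ 1` commutes with the image
    -- of `T.A m` and compresses `θ m a` exactly to `κ a`.
    let κ : T.A m →⋆ₙₐ[ℂ] B :=
      ((θ (m + 1)).comp (T.scalar m)).toNonUnitalStarAlgHom.comp (T.rep m)
    have hκ1 : ∀ a, κ 1 * θ m a = κ a := by
      intro a
      change θ (m + 1) (T.scalar m (T.rep m 1)) * _ = θ (m + 1) (T.scalar m (T.rep m a))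
      rw [← hθ m a, ← map_mul, T.scalar_mul_step]
    have hκ2 : ∀ a, θ m a * κ 1 = κ a := by
      intro a
      change _ * θ (m + 1) (T.scalar m (T.rep m 1)) = θ (m + 1) (T.scalar m (T.rep m a))
      rw [← hθ m a, ← map_mul, T.step_mul_scalar]
    have hκn : ‖κ 1‖ ≤ 1 := (NonUnitalStarAlgHom.norm_apply_le κ 1).trans CStarRing.norm_one.le
    refine ⟨NonUnitalStarAlgHom.range κ, κ 1, ?_, ?_, ⟨1, rfl⟩, ?_, fun x hx => ?_, fun x hx => ?_⟩
    · let L : CStarMatrix (Fin (2 ^ T.l m)) (Fin (2 ^ T.l m)) ℂ →ₗ[ℂ] B :=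
        ((θ (m + 1)).comp (T.scalar m)).toAlgHom.toLinearMap
      have : FiniteDimensional ℂ (CStarMatrix (Fin (2 ^ T.l m)) (Fin (2 ^ T.l m)) ℂ) :=
        inferInstanceAs (FiniteDimensional ℂ (Matrix (Fin (2 ^ T.l m)) (Fin (2 ^ T.l m)) ℂ))
      have hle : (NonUnitalStarAlgHom.range κ).toSubmodule ≤ LinearMap.range L := by
        rintro _ ⟨a, rfl⟩
        exact ⟨T.rep m a, rfl⟩
      exact Submodule.finiteDimensional_of_le hle
    · have hs : Function.Injective (T.scalar m) := by
        refine (T.iso m).symm.injective.comp fun M N h => ?_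
        ext i j
        exact (algebraMap ℂ (T.A m)).injective (congrFun (congrFun h i) j)
      have h0 : κ 1 = θ (m + 1) (T.scalar m (T.rep m 1)) := rfl
      rw [h0, map_ne_zero_iff _ (T.map_injective θ hθ _), map_ne_zero_iff _ hs]
      exact T.rep_one m
    · rintro _ ⟨a, rfl⟩
      change κ 1 * κ a = κ a ∧ κ a * κ 1 = κ a
      rw [← map_mul, ← map_mul, one_mul, mul_one]
      exact ⟨rfl, rfl⟩
    · obtain ⟨a, ha⟩ := hm x hx
      have e : κ 1 * x - x * κ 1 = κ 1 * (x - θ m a) - (x - θ m a) * κ 1 := by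
        rw [mul_sub, sub_mul, hκ1, hκ2]; abel
      rw [e]
      have h1 : ‖κ 1 * (x - θ m a)‖ ≤ 1 * ‖x - θ m a‖ := (norm_mul_le _ _).trans (by gcongr)
      have h2 : ‖(x - θ m a) * κ 1‖ ≤ ‖x - θ m a‖ * 1 := (norm_mul_le _ _).trans (by gcongr)
      linarith [norm_sub_le (κ 1 * (x - θ m a)) ((x - θ m a) * κ 1)]
    · obtain ⟨a, ha⟩ := hm x hx
      refine ⟨κ a, ⟨a, rfl⟩, ?_⟩
      have e : κ 1 * x * κ 1 - κ a = κ 1 * (x - θ m a) * κ 1 := by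
        rw [mul_sub, sub_mul, hκ1, ← map_mul κ a 1, mul_one]
      rw [e]
      calc ‖κ 1 * (x - θ m a) * κ 1‖ ≤ ‖κ 1‖ * ‖x - θ m a‖ * ‖κ 1‖ :=
            (norm_mul_le _ _).trans (mul_le_mul_of_nonneg_right (norm_mul_le _ _) (norm_nonneg _))
        _ ≤ 1 * ‖x - θ m a‖ * 1 := by gcongr
        _ ≤ ε := by linarith

end Tower

/-! ### The limit algebra inside a product of representations. -/

/-- The unital C⋆-algebra structure on a bounded product. -/
noncomputable abbrev lpInftyCStarAlgebra {ι : Type*} (B : ι → Type*) [∀ i, CStarAlgebra (B i)]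
    [∀ i, Nontrivial (B i)] : CStarAlgebra (lp B ∞) where

/-- The limit of a sequence of C⋆-algebras, realised in a product of representations. -/
theorem exists_limit_of_representations {A : ℕ → Type u} [∀ m, CStarAlgebra (A m)]
    (φ : ∀ m, A m →⋆ₐ[ℂ] A (m + 1)) {ι : Type u} [Nonempty ι] (B : ι → Type u)
    [∀ i, CStarAlgebra (B i)] [∀ i, Nontrivial (B i)] (θ : ∀ i m, A m →⋆ₐ[ℂ] B i)
    (hθ : ∀ i m x, θ i (m + 1) (φ m x) = θ i m x) :
    ∃ (L : Type u) (_ : CStarAlgebra L) (Θ : ∀ m, A m →⋆ₐ[ℂ] L) (ev : ∀ i, L →⋆ₐ[ℂ] B i),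
      Nontrivial L ∧ (∀ m x, Θ (m + 1) (φ m x) = Θ m x) ∧
      Dense (⋃ m, Set.range (Θ m)) ∧ ∀ i m x, ev i (Θ m x) = θ i m x := by
  let _ : CStarAlgebra (lp B ∞) := lpInftyCStarAlgebra B
  let f : ∀ m, A m →⋆ₐ[ℂ] lp B ∞ := fun m =>
    { lpInftyProd (fun i => (θ i m).toNonUnitalStarAlgHom) with
      map_one' := by ext i; exact map_one (θ i m)
      commutes' := fun r => by ext i; exact AlgHomClass.commutes (θ i m) r }
  have hf : ∀ m x, f (m + 1) (φ m x) = f m x := fun m x => by ext i; exact hθ i m x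
  have hmono : Monotone fun m => (f m).range := by
    refine monotone_nat_of_le_succ fun m => ?_
    rintro _ ⟨x, rfl⟩
    exact ⟨φ m x, hf m x⟩
  -- The ranges increase, so their supremum is their union; the closure is the limit, and the
  -- coordinates of the product are its representations.
  let S : StarSubalgebra ℂ (lp B ∞) := ⨆ m, (f m).range
  have hS : (S : Set (lp B ∞)) = ⋃ m, ((f m).range : Set (lp B ∞)) :=
    StarSubalgebra.coe_iSup_of_directed hmono.directed_le
  have : IsClosed (S.topologicalClosure : Set (lp B ∞)) := S.isClosed_topologicalClosure
  have hmem : ∀ m x, f m x ∈ S.topologicalClosure := fun m x => by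
    refine S.le_topologicalClosure ?_
    rw [← SetLike.mem_coe, hS]
    exact Set.mem_iUnion.2 ⟨m, x, rfl⟩
  let evB : ∀ i, lp B ∞ →⋆ₐ[ℂ] B i := fun i =>
    { toFun := fun x => x i
      map_one' := rfl
      map_mul' := fun _ _ => rfl
      map_zero' := rfl
      map_add' := fun _ _ => rfl
      commutes' := fun _ => rfl
      map_star' := fun _ => rfl }
  refine ⟨S.topologicalClosure, inferInstance, fun m => (f m).codRestrict _ (hmem m),
    fun i => (evB i).comp S.topologicalClosure.subtype, ?_, ?_, ?_, fun i m x => rfl⟩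
  · obtain ⟨i⟩ := ‹Nonempty ι›
    refine ⟨⟨0, 1, fun h => ?_⟩⟩
    exact zero_ne_one (congrArg (fun z : S.topologicalClosure => evB i z.1) h)
  · intro m x
    exact Subtype.ext (hf m x)
  · intro z
    have hz : (z : lp B ∞) ∈ closure (S : Set (lp B ∞)) := z.2
    rw [closure_subtype]
    refine closure_mono ?_ hz
    rw [hS]
    intro w hw
    obtain ⟨m, x, rfl⟩ := Set.mem_iUnion.1 hw
    exact ⟨⟨f m x, hmem m x⟩, Set.mem_iUnion.2 ⟨m, x, rfl⟩, rfl⟩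

/-! ### Construction of tracial states. -/

section TracialStates

variable {A : Type u} [CStarAlgebra A] [PartialOrder A] [StarOrderedRing A]

/-- A linear functional which is nonnegative on the elements `star b * b` is positive. -/
noncomputable def positiveFunctional (f : A →ₗ[ℂ] ℂ) (hf : ∀ b, 0 ≤ f (star b * b)) : A →ₚ[ℂ] ℂ :=
  PositiveLinearMap.mk₀ f fun a ha => by
    obtain ⟨b, rfl⟩ := CStarAlgebra.nonneg_iff_eq_star_mul_self.1 ha
    exact hf b

/-- A nonzero residually finite dimensional C⋆-algebra has a tracial state. -/
theorem IsResiduallyFiniteDimensional.nonempty_tracialState [Nontrivial A]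
    (hA : IsResiduallyFiniteDimensional A) : Nonempty (TracialState A) := by
  obtain ⟨n, π, hπ⟩ := hA 1 one_ne_zero
  have hpos : ∀ b, 0 ≤ (π (star b * b)).trace := by
    intro b
    rw [map_mul, map_star]
    exact (Matrix.posSemidef_conjTranspose_mul_self (π b)).trace_nonneg
  have h0 : (π 1).trace ≠ 0 := by
    intro h
    refine hπ (Matrix.trace_conjTranspose_mul_self_eq_zero_iff.1 ?_)
    rw [← h, ← Matrix.star_eq_conjTranspose, ← map_star, ← map_mul, star_one, one_mul]
  have h1 : 0 ≤ (π 1).trace := by simpa using hpos 1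
  let f : A →ₗ[ℂ] ℂ :=
    { toFun := fun a => ((π 1).trace)⁻¹ * (π a).trace
      map_add' := fun a b => by rw [map_add, Matrix.trace_add, mul_add]
      map_smul' := fun c a => by
        rw [map_smul, Matrix.trace_smul, smul_eq_mul, RingHom.id_apply, smul_eq_mul]; ring }
  refine ⟨⟨positiveFunctional f fun b => mul_nonneg (inv_nonneg.2 h1) (hpos b), ?_, ?_⟩⟩
  · exact inv_mul_cancel₀ h0
  · intro x y
    change ((π 1).trace)⁻¹ * (π (x * y)).trace = ((π 1).trace)⁻¹ * (π (y * x)).trace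
    rw [map_mul, map_mul, Matrix.trace_mul_comm]

/-- The vector state of a unit vector satisfying the trace identity. -/
noncomputable def TracialState.ofVector {H : Type v} [NormedAddCommGroup H] [InnerProductSpace ℂ H]
    [CompleteSpace H] (Ψ : A →⋆ₐ[ℂ] (H →L[ℂ] H)) (Ω : H) (hΩ : ‖Ω‖ = 1)
    (h : ∀ x y, inner ℂ Ω (Ψ (x * y) Ω) = inner ℂ Ω (Ψ (y * x) Ω)) : TracialState A where
  toFunctional := positiveFunctional
    { toFun := fun a => inner ℂ Ω (Ψ a Ω)
      map_add' := fun a b => by rw [map_add, _root_.add_apply, inner_add_right]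
      map_smul' := fun c a => by rw [map_smul, _root_.smul_apply, inner_smul_right]; rfl }
    fun b => by
      change 0 ≤ inner ℂ Ω (Ψ (star b * b) Ω)
      rw [map_mul, map_star, mul_apply_eq_comp, ContinuousLinearMap.star_eq_adjoint,
        ContinuousLinearMap.adjoint_inner_right, inner_self_eq_norm_sq_to_K]
      simp only [Complex.coe_algebraMap]
      exact_mod_cast sq_nonneg ‖Ψ b Ω‖
  map_one := by
    change inner ℂ Ω (Ψ 1 Ω) = 1
    rw [_root_.map_one, one_apply_eq_self, inner_self_eq_norm_sq_to_K, hΩ]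
    simp
  map_mul_comm := h

end TracialStates

/-! ### The representation of the tower attached to a trace. -/

section Main

variable {E : Type u} [CStarAlgebra E] [PartialOrder E] [StarOrderedRing E]

namespace TracialState

variable (τ : TracialState E)

/-- The Hilbert space `L²(R) ⊗ L²(E, τ)`. -/
abbrev TensorSpace : Type u := HilbertTensor PauliSpace τ.toFunctional.GNS

/-- The trace vector of `R ⊗ π_τ(E)''`. -/
noncomputable def tensorVector : τ.TensorSpace := hilbertTmul pauliVector τ.vector

theorem norm_tensorVector : ‖τ.tensorVector‖ = 1 := by
  have h := inner_hilbertTmul pauliVector pauliVector τ.vector τ.vector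
  change inner ℂ τ.tensorVector τ.tensorVector = _ at h
  rw [inner_self_eq_norm_sq_to_K, inner_self_eq_norm_sq_to_K, inner_self_eq_norm_sq_to_K,
    norm_pauliVector, τ.norm_vector] at h
  have h' : ‖τ.tensorVector‖ ^ 2 = 1 := by
    refine Complex.ofReal_injective ?_
    push_cast
    simpa using h
  exact (pow_eq_one_iff_of_nonneg (norm_nonneg _) two_ne_zero).1 h'

instance : Nontrivial τ.TensorSpace :=
  ⟨⟨τ.tensorVector, 0, fun h => by simpa [h] using τ.norm_tensorVector⟩⟩

/-- The Pauli operators and the representation of `E` on `L²(R) ⊗ L²(E, τ)`. -/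
noncomputable def pauliRep : PauliRep E τ.TensorSpace :=
  pauliSystem.tensorRep τ.toFunctional.gnsStarAlgHom

theorem tensorVector_mem : τ.tensorVector ∈ τ.pauliRep.V 0 :=
  Submodule.subset_span ⟨pauliVector,
    single_mem_pauliSubspace (Finset.empty_subset _) (Finset.empty_subset _) 1, τ.vector, rfl⟩

theorem inner_tensorVector (x : E) :
    inner ℂ τ.tensorVector (τ.pauliRep.π x τ.tensorVector) = τ.toFunctional x := by
  change inner ℂ (hilbertTmul pauliVector τ.vector)
    (operatorTensor 1 (τ.toFunctional.gnsStarAlgHom x) (hilbertTmul pauliVector τ.vector)) = _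
  rw [operatorTensor_tmul, inner_hilbertTmul, τ.inner_vector, one_apply_eq_self,
    inner_self_eq_norm_sq_to_K, norm_pauliVector]
  simp

/-- The von Neumann algebra tensor product with `R` in terms of the Pauli operators. -/
theorem commute_hyperfinite_tensor_iff {U : τ.TensorSpace →L[ℂ] τ.TensorSpace} :
    ((∀ i, Commute U (τ.pauliRep.X i) ∧ Commute U (τ.pauliRep.Z i)) ∧
      ∀ x, Commute U (τ.pauliRep.π x)) ↔
    ∀ W ∈ {T | ∃ x ∈ hyperfiniteFactor, ∃ y ∈ τ.gnsVonNeumannAlgebra, T = operatorTensor x y} ∪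
      star {T | ∃ x ∈ hyperfiniteFactor, ∃ y ∈ τ.gnsVonNeumannAlgebra, T = operatorTensor x y},
      Commute U W := by
  rw [hyperfiniteFactor, gnsVonNeumannAlgebra, commute_tensor_iff]
  constructor
  · rintro ⟨h1, h2⟩
    constructor
    · have key : ∀ s ∈ Set.range pauliX ∪ Set.range pauliZ,
          star s = s ∧ Commute U (operatorTensor s 1) := by
        rintro s (⟨i, rfl⟩ | ⟨i, rfl⟩)
        · exact ⟨pauliSystem.star_X i, (h1 i).1⟩
        · exact ⟨pauliSystem.star_Z i, (h1 i).2⟩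
      rintro s (hs | hs)
      · exact (key s hs).2
      · have h := key _ hs
        rw [star_star] at h
        rw [h.1]
        exact h.2
    · rintro s (⟨x, rfl⟩ | ⟨x, hx⟩)
      · exact h2 x
      · have : s = τ.toFunctional.gnsStarAlgHom (star x) := by rw [map_star, hx, star_star]
        rw [this]
        exact h2 (star x)
  · rintro ⟨h1, h2⟩
    exact ⟨fun i => ⟨h1 _ (Or.inl (Or.inl ⟨i, rfl⟩)), h1 _ (Or.inl (Or.inr ⟨i, rfl⟩))⟩,
      fun x => h2 _ (Or.inl ⟨x, rfl⟩)⟩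

end TracialState

end Main

theorem StarAlgHom.continuous_of_cStarAlgebra {A B : Type*} [CStarAlgebra A] [CStarAlgebra B]
    (f : A →⋆ₐ[ℂ] B) : Continuous f :=
  AddMonoidHomClass.continuous_of_bound f 1 fun x => by
    rw [one_mul]; exact NonUnitalStarAlgHom.norm_apply_le f x

theorem StarAlgHom.commute_of_dense {A B : Type*} [CStarAlgebra A] [CStarAlgebra B]
    (f : A →⋆ₐ[ℂ] B) {D : Set A} (hD : Dense D) {U : B} (h : ∀ a ∈ D, Commute U (f a)) (a : A) :
    Commute U (f a) :=
  closure_minimal (fun a ha => (h a ha).eq : D ⊆ {a | U * f a = f a * U})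
    (isClosed_eq (continuous_const.mul f.continuous_of_cStarAlgebra)
      (f.continuous_of_cStarAlgebra.mul continuous_const)) (hD a)

section Main

variable {C : ∀ (B : Type u) [CStarAlgebra B], Prop} {E : Type u} [CStarAlgebra E]

namespace Tower

variable (T : Tower C E)

/-- The embedding of the base of the tower as constant diagonal matrices. -/
noncomputable def baseAmp (m : ℕ) : E →⋆ₐ[ℂ] T.A m :=
  (iterHom T.amp (Nat.zero_le m)).comp T.base.toStarAlgHom

theorem baseAmp_succ (m : ℕ) (x : E) : T.baseAmp (m + 1) x = T.amp m (T.baseAmp m x) :=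
  iterHom_succ T.amp (Nat.zero_le m) (T.base x)

theorem baseAmp_zero (x : E) : T.baseAmp 0 x = T.base x := iterHom_self T.amp 0 (T.base x)

theorem baseAmp_injective (m : ℕ) : Function.Injective (T.baseAmp m) := by
  induction m with
  | zero =>
    intro x y h
    rw [baseAmp_zero, baseAmp_zero] at h
    exact T.base.injective h
  | succ m ih =>
    intro x y h
    rw [baseAmp_succ, baseAmp_succ] at h
    exact ih (T.amp_injective m h)

theorem stage_baseAmp {H : Type*} [NormedAddCommGroup H] [InnerProductSpace ℂ H] [CompleteSpace H]
    (P : PauliRep E H) (m : ℕ) (x : E) : P.stage T m (T.baseAmp m x) = P.π x := by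
  induction m with
  | zero => rw [baseAmp_zero, P.stage_zero]
  | succ m ih => rw [baseAmp_succ, P.stage_amp, ih]

end Tower

namespace TracialState

variable [PartialOrder E] [StarOrderedRing E] (τ : TracialState E) (T : Tower C E)

/-- The representation of the tower on `L²(R) ⊗ L²(E, τ)`. -/
noncomputable def limitRep (m : ℕ) : T.A m →⋆ₐ[ℂ] (τ.TensorSpace →L[ℂ] τ.TensorSpace) :=
  (τ.pauliRep.asymptoticRep T).limit m

theorem limitRep_step (m : ℕ) (x : T.A m) : τ.limitRep T (m + 1) (T.step m x) = τ.limitRep T m x :=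
  (τ.pauliRep.asymptoticRep T).limit_succ m x

theorem dense_limitRep : Dense {f | ∃ m x, f = τ.limitRep T m x τ.tensorVector} :=
  τ.pauliRep.dense_limit_apply T fun L hL h0 hXZ hπ =>
    eq_top_of_cyclic τ.toFunctional.gnsStarAlgHom τ.dense_vector L hL h0 hXZ hπ

theorem inner_limitRep_mul_comm (m : ℕ) (x y : T.A m) :
    inner ℂ τ.tensorVector (τ.limitRep T m (x * y) τ.tensorVector) =
      inner ℂ τ.tensorVector (τ.limitRep T m (y * x) τ.tensorVector) :=
  τ.pauliRep.inner_limit_mul_comm T τ.tensorVector_mem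
    (fun x y => by rw [inner_tensorVector, inner_tensorVector, τ.map_mul_comm]) m x y

/-- Constant diagonals are represented exactly by `π` at stage m, so the error comes only from
passing to the strong limit. With the connecting maps from stage 0 in their place the error would
not be small. -/
theorem norm_inner_limitRep_sub_le (m : ℕ) (x : E) :
    ‖inner ℂ τ.tensorVector (τ.limitRep T m (T.baseAmp m x) τ.tensorVector) - τ.toFunctional x‖ ≤
      2 * (1 / 2) ^ m * ‖x‖ := by
  rw [← τ.inner_tensorVector, ← T.stage_baseAmp τ.pauliRep m x, ← inner_sub_right]
  refine (norm_inner_le_norm _ _).trans ?_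
  rw [τ.norm_tensorVector, one_mul]
  refine (τ.pauliRep.norm_limit_apply_sub_le T τ.tensorVector_mem m _).trans ?_
  rw [τ.norm_tensorVector, mul_one, mul_comm]
  exact mul_le_mul_of_nonneg_left (NonUnitalStarAlgHom.norm_apply_le (T.baseAmp m) x)
    (by positivity)

section Limit

variable {L : Type u} [CStarAlgebra L]
  (Θ : ∀ m, T.A m →⋆ₐ[ℂ] L)
  (ev : L →⋆ₐ[ℂ] (τ.TensorSpace →L[ℂ] τ.TensorSpace))

/-- Two elements of the dense union are brought to a common stage, where the trace identity is
known; both sides are jointly continuous. -/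
theorem inner_ev_mul_comm (hΘ : ∀ m x, Θ (m + 1) (T.step m x) = Θ m x)
    (hd : Dense (⋃ m, Set.range (Θ m))) (hev : ∀ m x, ev (Θ m x) = τ.limitRep T m x) (a b : L) :
    inner ℂ τ.tensorVector (ev (a * b) τ.tensorVector) =
      inner ℂ τ.tensorVector (ev (b * a) τ.tensorVector) := by
  have hev' : Continuous ev :=
    StarAlgHom.continuous_of_cStarAlgebra (B := τ.TensorSpace →L[ℂ] τ.TensorSpace) ev
  have hc : Continuous fun p : L × L => inner ℂ τ.tensorVector (ev (p.1 * p.2) τ.tensorVector) :=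
    continuous_const.inner ((hev'.comp continuous_mul).clm_apply continuous_const)
  have key : Set.EqOn (fun p : L × L => inner ℂ τ.tensorVector (ev (p.1 * p.2) τ.tensorVector))
      (fun p => inner ℂ τ.tensorVector (ev (p.2 * p.1) τ.tensorVector))
      ((⋃ m, Set.range (Θ m)) ×ˢ (⋃ m, Set.range (Θ m))) := by
    rintro ⟨_, _⟩ ⟨ha, hb⟩
    obtain ⟨m, x, rfl⟩ := Set.mem_iUnion.1 ha
    obtain ⟨k, y, rfl⟩ := Set.mem_iUnion.1 hb
    dsimp only
    rw [← T.map_iterHom_step Θ hΘ (le_max_left m k) x,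
      ← T.map_iterHom_step Θ hΘ (le_max_right m k) y, ← map_mul, ← map_mul, hev, hev,
      τ.inner_limitRep_mul_comm]
  exact congrFun (Continuous.ext_on (hd.prod hd) hc (hc.comp continuous_swap) key) (a, b)

theorem dense_ev (hev : ∀ m x, ev (Θ m x) = τ.limitRep T m x) :
    Dense (Set.range fun a => ev a τ.tensorVector) := by
  refine (τ.dense_limitRep T).mono ?_
  rintro _ ⟨m, x, rfl⟩
  exact ⟨Θ m x, by dsimp only; rw [hev]⟩

theorem vonNeumannAlgebraGenerated_range_ev (hd : Dense (⋃ m, Set.range (Θ m)))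
    (hev : ∀ m x, ev (Θ m x) = τ.limitRep T m x) :
    vonNeumannAlgebraGenerated (Set.range ev) = hyperfiniteFactor.tensor τ.gnsVonNeumannAlgebra := by
  refine vonNeumannAlgebraGenerated_congr fun U => ?_
  rw [← τ.commute_hyperfinite_tensor_iff, ← τ.pauliRep.commute_limit_iff T]
  constructor
  · intro h m x
    exact h _ (Or.inl ⟨Θ m x, hev m x⟩)
  · intro h
    have key : ∀ a, Commute U (ev a) := by
      refine StarAlgHom.commute_of_dense (B := τ.TensorSpace →L[ℂ] τ.TensorSpace) ev hd fun a ha => ?_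
      obtain ⟨m, x, rfl⟩ := Set.mem_iUnion.1 ha
      rw [hev]
      exact h m x
    rintro s (⟨a, rfl⟩ | ⟨a, ha⟩)
    · exact key a
    · have : s = ev (star a) := by rw [map_star, ha, star_star]
      rw [this]
      exact key _

end Limit

end TracialState

end Main

theorem mainTheorem3
    (C : ∀ (B : Type u) [CStarAlgebra B], Prop)
    (hC_union : ClosedUnderIncreasingUnions C)
    (hC_matrix : ClosedUnderMatrixTensoring C)
    (E : Type u) [CStarAlgebra E] [PartialOrder E] [StarOrderedRing E]
    [Nontrivial E] [TopologicalSpace.SeparableSpace E]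
    (hE_mem : C E) (hE_rfd : IsResiduallyFiniteDimensional E) :
    ∃ (A : Type u) (_ : CStarAlgebra A) (_ : PartialOrder A) (_ : StarOrderedRing A),
      IsPopaAlgebra A ∧ C A ∧
      ∀ ε : ℝ, 0 < ε → ∃ ρ : E →⋆ₐ[ℂ] A, Function.Injective ρ ∧
        ∀ τ : TracialState E, ∃ γ : TracialState A,
          (∀ x : E, x ≠ 0 → ‖γ.toFunctional (ρ x) - τ.toFunctional x‖ < ε * ‖x‖) ∧
          γ.gnsVonNeumannAlgebra.Isomorphic
            (hyperfiniteFactor.tensor τ.gnsVonNeumannAlgebra) := by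
  obtain ⟨T⟩ := exists_tower C hC_matrix E hE_mem hE_rfd
  have := hE_rfd.nonempty_tracialState
  -- The product runs over all tracial states of E, so that a single algebra A has a representation
  -- `ev τ` for each τ. The existence of one such τ makes A nonzero.
  obtain ⟨A, _, Θ, ev, _, hΘ, hd, hev⟩ := exists_limit_of_representations T.step
    (fun τ : TracialState E => τ.TensorSpace →L[ℂ] τ.TensorSpace) (fun τ => τ.limitRep T)
    fun τ => τ.limitRep_step T
  let _ := CStarAlgebra.spectralOrder A
  have := CStarAlgebra.spectralOrderedRing A
  refine ⟨A, inferInstance, inferInstance, inferInstance, T.isPopaAlgebra_of_dense Θ hΘ hd,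
    hC_union T.A A Θ (T.map_injective Θ hΘ) ?_ hd T.mem, fun ε hε => ?_⟩
  · rintro m _ ⟨x, rfl⟩
    exact ⟨T.step m x, hΘ m x⟩
  -- The stage is chosen so that the error 2 · 2^{-m} is below ε, uniformly in τ.
  · obtain ⟨m, hm⟩ := exists_pow_lt_of_lt_one (half_pos hε) (by norm_num : (1 / 2 : ℝ) < 1)
    refine ⟨(Θ m).comp (T.baseAmp m), (T.map_injective Θ hΘ m).comp (T.baseAmp_injective m),
      fun τ => ?_⟩
    let γ : TracialState A := .ofVector (ev τ) τ.tensorVector τ.norm_tensorVector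
      (τ.inner_ev_mul_comm T Θ (ev τ) hΘ hd (hev τ))
    refine ⟨γ, fun x hx => ?_, ?_⟩
    · have h := τ.norm_inner_limitRep_sub_le T m x
      rw [← hev] at h
      refine lt_of_le_of_lt h (mul_lt_mul_of_pos_right ?_ (norm_pos_iff.2 hx))
      linarith
    · obtain ⟨e, he⟩ := exists_gns_equiv γ.toFunctional (ev τ) τ.tensorVector (fun _ => rfl)
        (τ.dense_ev T Θ (ev τ) (hev τ))
      rw [← τ.vonNeumannAlgebraGenerated_range_ev T Θ (ev τ) hd (hev τ)]
      exact isomorphic_of_conj e _ _ he
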